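/- **Theorem.** All objects are smooth. Let $(M,g)$ be a four-dimensional pseudo-Riemannian manifold, let $\mathcal G_2$ be a two-dimensional Abelian Lie algebra of Killing fields of $g$ spanning a two-dimensional distribution $\Xi$ (whose integral surfaces are the Killing leaves), and let $X$ be a vector field such that $(M,g,X)$ is a steady Ricci soliton, i.e. $\mathrm{Ric}(g)+\tfrac12L_Xg=0$ ($\Lambda=0$). Coordinates $(t_1,t_2,z_1,z_2)$ are called adapted if $\partial_{z_1},\partial_{z_2}$ generate $\mathcal G_2$. In adapted coordinates write $g=b_{ij}\,dt_idt_j+2f_{ik}\,dt_idz_k+h_{kl}\,dz_kdz_l$, with coefficients depending on $(t_1,t_2)$; if $(h_{kl})$ is invertible with inverse $(h^{kl})$, put $f_j^k=f_{js}h^{sk}$, let $\tilde g_{ij}=b_{ij}-f_{ik}f_{jl}h^{kl}$ be the orbit metric, and let $$\mathcal C=\sum_{k}\frac{\partial_{t_2}f^k_1-\partial_{t_1}f^k_2}{\sqrt{|\det\tilde g|}}\,\partial_{z_k}$$ be the curvature vector field. Assume that the Killing leaves are non-null ($g|_\Xi$ is nondegenerate) and orthogonally intransitive ($\mathcal C\neq0$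 everywhere), and that: (i) $g(\mathcal C,\mathcal C)=0$; (ii) $\mathcal G_2$ contains a non-zero field $\xi$ with $g(\xi,\xi)=0$; (iii) $X$ is tangent to $\Xi$ and is a symmetry of $\Xi^\perp$ (the bracket of $X$ with any local section of $\Xi^\perp$ is a section of $\Xi^\perp$). Suppose that in some adapted coordinates, with $\epsilon_0=\pm1$ and with $P,h_{11},h_{12},f^1_1,f^2_1$ functions of $(t_1,t_2)$, $h_{12}\ne0$, $$g=e^{-2P}(dt_1^2+\epsilon_0dt_2^2)+h_{11}(dz_1+f^1_1dt_1)^2+2h_{12}(dz_1+f^1_1dt_1)(dz_2+f^2_1dt_1),$$ and that on the domain of these coordinates $f^1_{1,t_2}=0$, $h_{12,t_1}\neq0$ and $(h_{12,t_1})^2+\epsilon_0(h_{12,t_2})^2>0$. (The last condition follows from $h_{12,t_1}\ne0$ if $\epsilon_0=1$ or if $h_{12}$ depends on $t_1$ only.) Then around every point of that domain there are adapted coordinates, again denoted $(t_1,t_2,z_1,z_2)$, with $t_1>0$, in which, with the same $\epsilon_0$, $$g=\frac1{\sqrt{t_1}}(dt_1^2+\epsilon_0dt_2^2)+2\frac{t_2}{t_1^{3/2}}dt_1dz_1+\Big(\psi\,t_1+\frac{4\epsilon_0}{9\sqrt{t_1}}\Big)dz_1^2+2t_1\,dz_1dz_2,\qquad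 X=a_1\partial_{z_1}+(a_2z_1+a_3)\partial_{z_2},$$ where $a_1,a_2,a_3\in\mathbb R$ and $\psi=\psi(t_1,t_2)$ is a smooth function satisfying $$\psi_{,t_1t_1}+\epsilon_0\psi_{,t_2t_2}+\frac1{t_1}\psi_{,t_1}=\frac{2a_2}{\sqrt{t_1}},$$ and the orbit metric is $\tilde g=t_1^{-1/2}(dt_1^2+\epsilon_0dt_2^2)$. Conversely, the constants and the solution are arbitrary: for $\epsilon_0=\pm1$, all $a_1,a_2,a_3\in\mathbb R$ and every smooth solution $\psi$ of this equation on an open subset $D$ of $\{t_1>0\}$, the above $g$ and $X$ satisfy on $D\times\mathbb R^2$ the equation $\mathrm{Ric}(g)+\frac12L_Xg=0$; moreover $g$ and $(h_{kl})$ are nondegenerate, $\mathcal C\ne0$ and $g(\mathcal C,\mathcal C)=0$. Finally, for $\epsilon_0=\pm1$ the metric $t_1^{-1/2}(dt_1^2+\epsilon_0dt_2^2)$ on $\{t_1>0\}$ has Gauss curvature $-t_1^{-3/2}/4$. -/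

import Mathlib

open Set Filter Topology Manifold
open scoped ContDiff

noncomputable section

/-! ### Tensor calculus in local coordinates -/

/-- The partial derivative `∂f/∂xᵢ` at `x`. -/
def pderiv {n : ℕ} (i : Fin n) (f : (Fin n → ℝ) → ℝ) (x : Fin n → ℝ) : ℝ :=
  fderiv ℝ f x (Pi.single i 1)

/-- Christoffel symbols `Γᵏᵢⱼ` of the metric with coefficients `G`. -/
def christoffel {n : ℕ} (G : (Fin n → ℝ) → Matrix (Fin n) (Fin n) ℝ) (k i j : Fin n)
    (x : Fin n → ℝ) : ℝ :=
  (1 / 2) * ∑ l, (G x)⁻¹ k l *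
    (pderiv i (fun y => G y j l) x + pderiv j (fun y => G y i l) x
      - pderiv l (fun y => G y i j) x)

/-- The curvature tensor: `R(∂ᵢ, ∂ⱼ)∂ₖ = ∑ₗ Rˡₖᵢⱼ ∂ₗ`, where
`R(U, V)W = ∇_U ∇_V W - ∇_V ∇_U W - ∇_[U,V] W`. -/
def riemannCurv {n : ℕ} (G : (Fin n → ℝ) → Matrix (Fin n) (Fin n) ℝ) (l k i j : Fin n)
    (x : Fin n → ℝ) : ℝ :=
  pderiv i (christoffel G l j k) x - pderiv j (christoffel G l i k) x
    + ∑ m, (christoffel G l i m x * christoffel G m j k x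
      - christoffel G l j m x * christoffel G m i k x)

/-- The Ricci tensor `Ricᵢⱼ = ∑ₗ Rˡᵢₗⱼ`. -/
def ricciCurv {n : ℕ} (G : (Fin n → ℝ) → Matrix (Fin n) (Fin n) ℝ) (i j : Fin n)
    (x : Fin n → ℝ) : ℝ :=
  ∑ l, riemannCurv G l i l j x

/-- The Gauss curvature `g(R(∂₁, ∂₂)∂₂, ∂₁) / det g` of a two-dimensional metric. -/
def gaussCurv (G : (Fin 2 → ℝ) → Matrix (Fin 2) (Fin 2) ℝ) (x : Fin 2 → ℝ) : ℝ :=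
  (∑ l, G x 0 l * riemannCurv G l 1 0 1 x) / (G x).det

/-- The Lie derivative `(L_X g)ᵢⱼ`. -/
def lieMetric {n : ℕ} (G : (Fin n → ℝ) → Matrix (Fin n) (Fin n) ℝ)
    (X : (Fin n → ℝ) → (Fin n → ℝ)) (i j : Fin n) (x : Fin n → ℝ) : ℝ :=
  ∑ k, (X x k * pderiv k (fun y => G y i j) x + G x k j * pderiv i (fun y => X y k) x
    + G x i k * pderiv j (fun y => X y k) x)

/-! ### Pseudo-Riemannian manifolds, Killing fields and Ricci solitons -/

/-- Vector fields (not necessarily smooth) on a manifold modelled on `ℝⁿ`. -/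
abbrev VField (n : ℕ) (M : Type*) [TopologicalSpace M] [ChartedSpace (Fin n → ℝ) M] :=
  (p : M) → TangentSpace 𝓘(ℝ, Fin n → ℝ) p

section Manifold

variable {n : ℕ} {M : Type*} [TopologicalSpace M] [ChartedSpace (Fin n → ℝ) M]

/-- The coordinate vector field `∂ᵢ` of the chart `e`, at the point with coordinates `x`. -/
def coordField (e : OpenPartialHomeomorph M (Fin n → ℝ)) (i : Fin n) (x : Fin n → ℝ) :
    TangentSpace 𝓘(ℝ, Fin n → ℝ) (e.symm x) :=
  mfderiv 𝓘(ℝ, Fin n → ℝ) 𝓘(ℝ, Fin n → ℝ) e.symm x (Pi.single i (1 : ℝ) : Fin n → ℝ)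

/-- The components of the vector field `X` in the chart `e`, as functions of the coordinates. -/
def fieldCoeff (X : VField n M) (e : OpenPartialHomeomorph M (Fin n → ℝ)) (x : Fin n → ℝ) :
    Fin n → ℝ :=
  mfderiv 𝓘(ℝ, Fin n → ℝ) 𝓘(ℝ, Fin n → ℝ) e (e.symm x) (X (e.symm x))

/-- The distribution `Ξ` spanned by the fields in `𝒢`. -/
def leafDist (𝒢 : Submodule ℝ (VField n M)) (p : M) :
    Submodule ℝ (TangentSpace 𝓘(ℝ, Fin n → ℝ) p) :=
  𝒢.map (LinearMap.proj p)

variable [IsManifold 𝓘(ℝ, Fin n → ℝ) ∞ M]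

/-- Smoothness of the vector field `X` at `p`. -/
def SmoothFieldAt (X : VField n M) (p : M) : Prop :=
  ContMDiffAt 𝓘(ℝ, Fin n → ℝ) 𝓘(ℝ, Fin n → ℝ).tangent ∞
    (fun q => (⟨q, X q⟩ : TangentBundle 𝓘(ℝ, Fin n → ℝ) M)) p

/-- A smooth pseudo-Riemannian metric, of arbitrary signature. -/
structure PseudoRiemannianMetric (n : ℕ) (M : Type*) [TopologicalSpace M]
    [ChartedSpace (Fin n → ℝ) M] [IsManifold 𝓘(ℝ, Fin n → ℝ) ∞ M] where
  val (p : M) : TangentSpace 𝓘(ℝ, Fin n → ℝ) p →L[ℝ] TangentSpace 𝓘(ℝ, Fin n → ℝ) p →L[ℝ] ℝ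
  symm (p : M) (v w : TangentSpace 𝓘(ℝ, Fin n → ℝ) p) : val p v w = val p w v
  nondegenerate (p : M) (v : TangentSpace 𝓘(ℝ, Fin n → ℝ) p) (hv : ∀ w, val p v w = 0) : v = 0
  contMDiff : ContMDiff 𝓘(ℝ, Fin n → ℝ)
    (𝓘(ℝ, Fin n → ℝ).prod 𝓘(ℝ, (Fin n → ℝ) →L[ℝ] (Fin n → ℝ) →L[ℝ] ℝ)) ∞
    (fun p ↦ Bundle.TotalSpace.mk' ((Fin n → ℝ) →L[ℝ] (Fin n → ℝ) →L[ℝ] ℝ)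
      (E := fun p : M ↦ TangentSpace 𝓘(ℝ, Fin n → ℝ) p →L[ℝ]
        TangentSpace 𝓘(ℝ, Fin n → ℝ) p →L[ℝ] ℝ) p (val p))

/-- The coefficients `g(∂ᵢ, ∂ⱼ)` of `g` in the chart `e`, as functions of the coordinates. -/
def metricCoeff (g : PseudoRiemannianMetric n M) (e : OpenPartialHomeomorph M (Fin n → ℝ))
    (x : Fin n → ℝ) : Matrix (Fin n) (Fin n) ℝ :=
  Matrix.of fun i j => g.val (e.symm x) (coordField e i x) (coordField e j x)

/-- `X` is a Killing field of `g`: it is smooth and `L_X g = 0` (in all smooth charts). -/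
structure IsKilling (g : PseudoRiemannianMetric n M) (X : VField n M) : Prop where
  smooth : ∀ p, SmoothFieldAt X p
  lie_eq_zero : ∀ e ∈ IsManifold.maximalAtlas 𝓘(ℝ, Fin n → ℝ) ∞ M, ∀ x ∈ e.target, ∀ i j,
    lieMetric (metricCoeff g e) (fieldCoeff X e) i j x = 0

/-- `(M, g)` is a Ricci soliton with smooth vector field `X` and constant `Λ`:
`Ric(g) + ½ L_X g = Λ g` (in all smooth charts). -/
structure IsRicciSoliton (g : PseudoRiemannianMetric n M) (X : VField n M) (Λ : ℝ) : Prop where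
  smooth : ∀ p, SmoothFieldAt X p
  soliton_eq : ∀ e ∈ IsManifold.maximalAtlas 𝓘(ℝ, Fin n → ℝ) ∞ M, ∀ x ∈ e.target, ∀ i j,
    ricciCurv (metricCoeff g e) i j x
      + (1 / 2) * lieMetric (metricCoeff g e) (fieldCoeff X e) i j x
      = Λ * metricCoeff g e x i j

/-- `𝒢` is a two-dimensional Abelian Lie algebra of Killing fields of `g`. -/
structure IsAbelianKillingAlgebra (g : PseudoRiemannianMetric n M)
    (𝒢 : Submodule ℝ (VField n M)) : Prop where
  finrank_eq : Module.finrank ℝ 𝒢 = 2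
  killing : ∀ ξ ∈ 𝒢, IsKilling g ξ
  abelian : ∀ ξ ∈ 𝒢, ∀ η ∈ 𝒢, ∀ p, VectorField.mlieBracket 𝓘(ℝ, Fin n → ℝ) ξ η p = 0

/-- `v` belongs to the orthogonal distribution `Ξ^⊥` at `p`. -/
def IsHorizontal (g : PseudoRiemannianMetric n M) (𝒢 : Submodule ℝ (VField n M)) (p : M)
    (v : TangentSpace 𝓘(ℝ, Fin n → ℝ) p) : Prop :=
  ∀ w ∈ leafDist 𝒢 p, g.val p v w = 0

/-- `X` is a symmetry of `Ξ^⊥`: the bracket of `X` with every local section of `Ξ^⊥` is a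
section of `Ξ^⊥`. -/
def IsSymmetryOfHorizontal (g : PseudoRiemannianMetric n M) (𝒢 : Submodule ℝ (VField n M))
    (X : VField n M) : Prop :=
  ∀ (p : M) (Y : VField n M), (∀ᶠ q in 𝓝 p, SmoothFieldAt Y q ∧ IsHorizontal g 𝒢 q (Y q)) →
    IsHorizontal g 𝒢 p (VectorField.mlieBracket 𝓘(ℝ, Fin n → ℝ) X Y p)

end Manifold

/-! ### Adapted coordinates `(t₁, t₂, z₁, z₂)` -/

/-- The index of the coordinate `tᵢ`. -/
def tIdx (i : Fin 2) : Fin 4 := Fin.castAdd 2 i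

/-- The index of the coordinate `zₖ`. -/
def zIdx (k : Fin 2) : Fin 4 := Fin.natAdd 2 k

/-- The projection `(t₁, t₂, z₁, z₂) ↦ (t₁, t₂)`. -/
def tProj (x : Fin 4 → ℝ) : Fin 2 → ℝ := fun i => x (tIdx i)

/-- The matrix `(hₖₗ)` of the restriction of the metric to the Killing leaves. -/
def leafMetric (G : (Fin 4 → ℝ) → Matrix (Fin 4) (Fin 4) ℝ) (x : Fin 4 → ℝ) :
    Matrix (Fin 2) (Fin 2) ℝ :=
  Matrix.of fun k l => G x (zIdx k) (zIdx l)

/-- The functions `f_j^k = ∑ₛ f_{js} h^{sk}`. -/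
def shiftCoeff (G : (Fin 4 → ℝ) → Matrix (Fin 4) (Fin 4) ℝ) (j k : Fin 2) (x : Fin 4 → ℝ) : ℝ :=
  ∑ s, G x (tIdx j) (zIdx s) * (leafMetric G x)⁻¹ s k

/-- The orbit metric `g̃ᵢⱼ = bᵢⱼ - ∑ₖₗ fᵢₖ fⱼₗ hᵏˡ`. -/
def orbitMetric (G : (Fin 4 → ℝ) → Matrix (Fin 4) (Fin 4) ℝ) (x : Fin 4 → ℝ) :
    Matrix (Fin 2) (Fin 2) ℝ :=
  Matrix.of fun i j => G x (tIdx i) (tIdx j)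
    - ∑ k, ∑ l, G x (tIdx i) (zIdx k) * G x (tIdx j) (zIdx l) * (leafMetric G x)⁻¹ k l

/-- The component `𝒞ᵏ` along `∂/∂zₖ` of the curvature vector field of the submersion. -/
def curvatureVec (G : (Fin 4 → ℝ) → Matrix (Fin 4) (Fin 4) ℝ) (x : Fin 4 → ℝ) : Fin 2 → ℝ :=
  fun k => (pderiv (tIdx 1) (shiftCoeff G 0 k) x - pderiv (tIdx 0) (shiftCoeff G 1 k) x)
    / √|(orbitMetric G x).det|

/-- The squared length `g(𝒞, 𝒞) = ∑ₖₗ hₖₗ 𝒞ᵏ 𝒞ˡ`. -/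
def curvatureNormSq (G : (Fin 4 → ℝ) → Matrix (Fin 4) (Fin 4) ℝ) (x : Fin 4 → ℝ) : ℝ :=
  ∑ k, ∑ l, leafMetric G x k l * curvatureVec G x k * curvatureVec G x l

section Adapted

variable {M : Type*} [TopologicalSpace M] [ChartedSpace (Fin 4 → ℝ) M]
  [IsManifold 𝓘(ℝ, Fin 4 → ℝ) ∞ M]

/-- `e` is a chart of adapted coordinates: `∂/∂z₁, ∂/∂z₂` are generators of `𝒢`. -/
def IsAdaptedChart (𝒢 : Submodule ℝ (VField 4 M)) (e : OpenPartialHomeomorph M (Fin 4 → ℝ)) :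
    Prop :=
  e ∈ IsManifold.maximalAtlas 𝓘(ℝ, Fin 4 → ℝ) ∞ M ∧
    ∃ ξ : Fin 2 → VField 4 M, Submodule.span ℝ (Set.range ξ) = 𝒢 ∧
      ∀ k, ∀ x ∈ e.target, fieldCoeff (ξ k) e x = Pi.single (zIdx k) 1

/-- The standing assumptions on `(M, g)`, the algebra `𝒢` and the field `X`. -/
structure StandingAssumptions (g : PseudoRiemannianMetric 4 M) (𝒢 : Submodule ℝ (VField 4 M))
    (X : VField 4 M) : Prop where
  killing_algebra : IsAbelianKillingAlgebra g 𝒢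
  leaves_surfaces : ∀ p, Module.finrank ℝ (leafDist 𝒢 p) = 2
  leaves_nonnull : ∀ p, ∀ v ∈ leafDist 𝒢 p, IsHorizontal g 𝒢 p v → v = 0
  orthogonally_intransitive : ∀ e, IsAdaptedChart 𝒢 e → ∀ x ∈ e.target,
    curvatureVec (metricCoeff g e) x ≠ 0
  curvature_null : ∀ e, IsAdaptedChart 𝒢 e → ∀ x ∈ e.target,
    curvatureNormSq (metricCoeff g e) x = 0
  null_vector : ∃ ξ ∈ 𝒢, ξ ≠ 0 ∧ ∀ p, g.val p (ξ p) (ξ p) = 0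
  tangent : ∀ p, X p ∈ leafDist 𝒢 p
  symmetry : IsSymmetryOfHorizontal g 𝒢 X

/-- In the adapted chart `e` the metric is
`e^{-2P} (dt₁² + ε₀ dt₂²) + h₁₁ (dz₁ + f¹ dt₁)² + 2 h₁₂ (dz₁ + f¹ dt₁) (dz₂ + f² dt₁)`,
with smooth functions `P, h₁₁, h₁₂, f¹, f²` of `(t₁, t₂)` and `h₁₂ ≠ 0`
(here `fᵏ` stands for `f_1^k`). -/
structure HasNormalizedForm (g : PseudoRiemannianMetric 4 M) (𝒢 : Submodule ℝ (VField 4 M))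
    (e : OpenPartialHomeomorph M (Fin 4 → ℝ)) (ε₀ : ℝ)
    (P h₁₁ h₁₂ f₁ f₂ : (Fin 2 → ℝ) → ℝ) : Prop where
  adapted : IsAdaptedChart 𝒢 e
  smooth_P : ContDiffOn ℝ ∞ P (tProj '' e.target)
  smooth_h₁₁ : ContDiffOn ℝ ∞ h₁₁ (tProj '' e.target)
  smooth_h₁₂ : ContDiffOn ℝ ∞ h₁₂ (tProj '' e.target)
  smooth_f₁ : ContDiffOn ℝ ∞ f₁ (tProj '' e.target)
  smooth_f₂ : ContDiffOn ℝ ∞ f₂ (tProj '' e.target)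
  h₁₂_ne_zero : ∀ t ∈ tProj '' e.target, h₁₂ t ≠ 0
  metric_eq : ∀ x ∈ e.target, ∀ t, t = tProj x → metricCoeff g e x =
    !![Real.exp (-2 * P t) + h₁₁ t * f₁ t ^ 2 + 2 * h₁₂ t * f₁ t * f₂ t, 0,
          h₁₁ t * f₁ t + h₁₂ t * f₂ t, h₁₂ t * f₁ t;
       0, ε₀ * Real.exp (-2 * P t), 0, 0;
       h₁₁ t * f₁ t + h₁₂ t * f₂ t, 0, h₁₁ t, h₁₂ t;
       h₁₂ t * f₁ t, 0, h₁₂ t, 0]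

end Adapted

/-! ### The normal form -/

/-- The metric `t₁^{-1/2} (dt₁² + ε₀ dt₂²)` of the `(t₁, t₂)`-plane. -/
def orbitModel (ε₀ : ℝ) (t : Fin 2 → ℝ) : Matrix (Fin 2) (Fin 2) ℝ :=
  !![1 / √(t 0), 0; 0, ε₀ / √(t 0)]

/-- The metric
`t₁^{-1/2} (dt₁² + ε₀ dt₂²) + 2 t₂ t₁^{-3/2} dt₁ dz₁ + (ψ t₁ + 4 ε₀ / (9 √t₁)) dz₁²
+ 2 t₁ dz₁ dz₂`. -/
def modelMetric (ε₀ : ℝ) (ψ : (Fin 2 → ℝ) → ℝ) (x : Fin 4 → ℝ) : Matrix (Fin 4) (Fin 4) ℝ :=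
  !![1 / √(x 0), 0, x 1 / x 0 ^ (3 / 2 : ℝ), 0;
     0, ε₀ / √(x 0), 0, 0;
     x 1 / x 0 ^ (3 / 2 : ℝ), 0, ψ (tProj x) * x 0 + 4 * ε₀ / (9 * √(x 0)), x 0;
     0, 0, x 0, 0]

/-- The vector field `a₁ ∂/∂z₁ + (a₂ z₁ + a₃) ∂/∂z₂`. -/
def modelField (a₁ a₂ a₃ : ℝ) (x : Fin 4 → ℝ) : Fin 4 → ℝ :=
  ![0, 0, a₁, a₂ * x 2 + a₃]

/-- The equation `ψ_{t₁t₁} + ε₀ ψ_{t₂t₂} + ψ_{t₁} / t₁ = 2 a₂ / √t₁` at `t`. -/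
def ModelEquation (ε₀ a₂ : ℝ) (ψ : (Fin 2 → ℝ) → ℝ) (t : Fin 2 → ℝ) : Prop :=
  pderiv 0 (pderiv 0 ψ) t + ε₀ * pderiv 1 (pderiv 1 ψ) t + (1 / t 0) * pderiv 0 ψ t
    = 2 * a₂ / √(t 0)

end

/-! Since `f¹_{1,t₂} = 0`, the form `f¹_1 dt₁` is locally exact. Absorbing a primitive of it into
`z₁`, and the sign of `h₁₂` into `z₂`, reduces the metric to `E (dt₁² + ε dt₂²) + k dz₁² + 2 h dz₁
(dz₂ + f dt₁)` with `h > 0` (`HasNormalizedForm.exists_isReducedChart`). All its curvature is a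
function of `(t₁, t₂)`, computed in `IsRedData.ricciCurv_redMetric`.

The distribution `Ξ^⊥` is spanned by `∂_{t₂}` and `∂_{t₁} - f ∂_{z₂}`. Brackets of the vertical
field `X` with these are vertical, and horizontal by symmetry, hence zero. So `X` also commutes with
their bracket, a multiple of `f_{,t₂} ∂_{z₂}`, and `f_{,t₂} ≠ 0` because `𝒞 ≠ 0`. The coefficients
of `X` therefore depend on `z₁` only. As the Ricci tensor depends on `t` only, the `(z₁, z₂)`
component makes the first coefficient affine, `c z₁ + a₁`, and once `c = 0` the `(z₁, z₁)` component
does the same for the second (`IsReducedChart.exists_fieldCoeff_eq`).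

The remaining equations live on the orbit surface with metric `g̃ = E (dt₁² + ε dt₂²)` and Gauss
curvature `K`. Put `w = √h`. They say that `Hess w = λ g̃` for some function `λ`, that `Δh = c h`,
that `K = c/2 - |dw|²/w²`, and that `h² f_{,t₂} / E` is constant. Since `dλ = -K dw`,
differentiating `Δh = c h` gives `4λ - 2wK = c w` where `dw ≠ 0`, while the Laplace and curvature
equations give `K = 2λ/w`; hence `c = 0` (`IsReducedSoliton.eq_zero`).

With `c = 0` one gets `|dh|² = C √h` for a constant `C`, and `h` is harmonic. If `y` is a conjugate
function, then `g̃ = (dh² + ε dy²) / (C √h)`, so suitable multiples of `h` and `y` are the new `t₁`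
and `t₂`. The constancy of `h² f_{,t₂} / E` says that `s f dt₁` and `t₂ t₁^{-5/2} dt₁` (new
coordinates) differ by an exact form for the right scale `s`, which is absorbed into `z₂`
(`IsReducedSoliton.exists_normalizing`). Only the `dz₁²` coefficient is left; its equation is
linear, the term `4ε / (9 √t₁)` is a particular solution for the source coming from `f_{,t₂}`, and
the rest is `ψ t₁`.

The converse and the Gauss curvature are direct computations with the same formulas. -/

/-! ### Partial derivatives -/

section PartialDerivatives

variable {n : ℕ} {f g : (Fin n → ℝ) → ℝ} {x : Fin n → ℝ}

theorem pderiv_congr (i : Fin n) (h : f =ᶠ[𝓝 x] g) : pderiv i f x = pderiv i g x := by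
  rw [pderiv, pderiv, h.fderiv_eq]

theorem pderiv_eventuallyEq (i : Fin n) (h : f =ᶠ[𝓝 x] g) : pderiv i f =ᶠ[𝓝 x] pderiv i g :=
  h.eventuallyEq_nhds.mono fun _ hy => pderiv_congr i hy

theorem pderiv_const (i : Fin n) (c : ℝ) : pderiv i (fun _ => c) x = 0 := by
  simp [pderiv]

theorem pderiv_add (i : Fin n) (hf : DifferentiableAt ℝ f x) (hg : DifferentiableAt ℝ g x) :
    pderiv i (fun y => f y + g y) x = pderiv i f x + pderiv i g x := by
  simp [pderiv, fderiv_fun_add hf hg]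

theorem pderiv_sub (i : Fin n) (hf : DifferentiableAt ℝ f x) (hg : DifferentiableAt ℝ g x) :
    pderiv i (fun y => f y - g y) x = pderiv i f x - pderiv i g x := by
  simp [pderiv, fderiv_fun_sub hf hg]

theorem pderiv_neg (i : Fin n) : pderiv i (fun y => -f y) x = -pderiv i f x := by
  simp [pderiv, fderiv_fun_neg]

theorem pderiv_mul (i : Fin n) (hf : DifferentiableAt ℝ f x) (hg : DifferentiableAt ℝ g x) :
    pderiv i (fun y => f y * g y) x = pderiv i f x * g x + f x * pderiv i g x := by
  simp only [pderiv, fderiv_fun_mul hf hg, add_apply,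
    smul_apply, smul_eq_mul]
  ring

theorem pderiv_pow (i : Fin n) (m : ℕ) (hf : DifferentiableAt ℝ f x) :
    pderiv i (fun y => f y ^ m) x = m * f x ^ (m - 1) * pderiv i f x := by
  simp [pderiv, fderiv_fun_pow m hf]

theorem pderiv_div (i : Fin n) (hf : DifferentiableAt ℝ f x) (hg : DifferentiableAt ℝ g x)
    (h0 : g x ≠ 0) :
    pderiv i (fun y => f y / g y) x = (pderiv i f x * g x - f x * pderiv i g x) / g x ^ 2 := by
  have h : HasFDerivAt (fun y => f y / g y)
      (f x • (-(g x ^ 2)⁻¹ • fderiv ℝ g x) + (g x)⁻¹ • fderiv ℝ f x) x := by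
    simpa only [div_eq_mul_inv, Function.comp_def] using
      hf.hasFDerivAt.fun_mul ((hasDerivAt_inv h0).comp_hasFDerivAt x hg.hasFDerivAt)
  simp only [pderiv, h.fderiv, add_apply, smul_apply, smul_eq_mul]
  field_simp
  ring

theorem pderiv_proj (i j : Fin n) :
    pderiv i (fun y : Fin n → ℝ => y j) x = if i = j then 1 else 0 := by
  have : fderiv ℝ (fun y : Fin n → ℝ => y j) x = ContinuousLinearMap.proj j :=
    (ContinuousLinearMap.proj (R := ℝ) (φ := fun _ : Fin n => ℝ) j).fderiv
  simp [pderiv, this, Pi.single_apply, eq_comm]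

theorem fderiv_eq_sum_pderiv (v : Fin n → ℝ) : fderiv ℝ f x v = ∑ i, v i * pderiv i f x := by
  conv_lhs => rw [pi_eq_sum_univ' v]
  simp only [map_sum, map_smul, smul_eq_mul, pderiv]

theorem contDiffAt_pderiv (i : Fin n) (hf : ContDiffAt ℝ ∞ f x) :
    ContDiffAt ℝ ∞ (pderiv i f) x := by
  have h : ContDiffAt ℝ ∞ (fderiv ℝ f) x := hf.fderiv_right (by simp)
  exact h.clm_apply contDiffAt_const

theorem pderiv_comm (i j : Fin n) (hf : ContDiffAt ℝ ∞ f x) :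
    pderiv i (pderiv j f) x = pderiv j (pderiv i f) x := by
  have hd : DifferentiableAt ℝ (fderiv ℝ f) x :=
    (hf.fderiv_right (m := ∞) (by simp)).differentiableAt (by simp)
  have key : ∀ a b : Fin n, pderiv a (pderiv b f) x =
      fderiv ℝ (fderiv ℝ f) x (Pi.single a 1) (Pi.single b 1) := by
    intro a b
    change fderiv ℝ (fun y => fderiv ℝ f y (Pi.single b 1)) x (Pi.single a 1) = _
    rw [fderiv_clm_apply hd (differentiableAt_const _)]
    simp
  rw [key, key]
  exact (hf.isSymmSndFDerivAt (by simp; exact WithTop.coe_le_coe.2 le_top)) _ _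

end PartialDerivatives

/-! ### Functions of `(t₁, t₂)` -/

/-- The projection `tProj` as a continuous linear map. -/
noncomputable def tProjL : (Fin 4 → ℝ) →L[ℝ] (Fin 2 → ℝ) :=
  ContinuousLinearMap.pi fun i => ContinuousLinearMap.proj (tIdx i)

theorem continuous_tProj : Continuous tProj := tProjL.continuous

section TProj

variable {u : (Fin 2 → ℝ) → ℝ} {x : Fin 4 → ℝ}

theorem pderiv_comp_tProj (i : Fin 4) (hu : DifferentiableAt ℝ u (tProj x)) :
    pderiv i (fun y => u (tProj y)) x = fderiv ℝ u (tProj x) (tProj (Pi.single i 1)) := by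
  have h : HasFDerivAt (fun y => u (tProj y)) ((fderiv ℝ u (tProj x)).comp tProjL) x :=
    HasFDerivAt.comp x (f := tProj) hu.hasFDerivAt tProjL.hasFDerivAt
  rw [pderiv, h.fderiv]
  rfl

theorem pderiv_zero_comp_tProj (hu : DifferentiableAt ℝ u (tProj x)) :
    pderiv 0 (fun y => u (tProj y)) x = pderiv 0 u (tProj x) := by
  rw [pderiv_comp_tProj 0 hu, pderiv]
  congr 1
  ext i; fin_cases i <;> simp [tProj, tIdx]

theorem pderiv_one_comp_tProj (hu : DifferentiableAt ℝ u (tProj x)) :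
    pderiv 1 (fun y => u (tProj y)) x = pderiv 1 u (tProj x) := by
  rw [pderiv_comp_tProj 1 hu, pderiv]
  congr 1
  ext i; fin_cases i <;> simp [tProj, tIdx]

theorem pderiv_two_comp_tProj (hu : DifferentiableAt ℝ u (tProj x)) :
    pderiv 2 (fun y => u (tProj y)) x = 0 := by
  rw [pderiv_comp_tProj 2 hu]
  rw [show tProj (Pi.single 2 1) = 0 from ?_, map_zero]
  ext i; fin_cases i <;> simp [tProj, tIdx]

theorem pderiv_three_comp_tProj (hu : DifferentiableAt ℝ u (tProj x)) :
    pderiv 3 (fun y => u (tProj y)) x = 0 := by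
  rw [pderiv_comp_tProj 3 hu]
  rw [show tProj (Pi.single 3 1) = 0 from ?_, map_zero]
  ext i; fin_cases i <;> simp [tProj, tIdx]

end TProj

/-! ### Curvature depends only on the germ of the metric -/

section Germ

variable {n : ℕ} {G G' : (Fin n → ℝ) → Matrix (Fin n) (Fin n) ℝ} {x : Fin n → ℝ}

theorem christoffel_eventuallyEq (h : G =ᶠ[𝓝 x] G') (k i j : Fin n) :
    christoffel G k i j =ᶠ[𝓝 x] christoffel G' k i j := by
  have hp : ∀ l a b : Fin n, pderiv l (fun y => G y a b) =ᶠ[𝓝 x] pderiv l (fun y => G' y a b) :=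
    fun l a b => pderiv_eventuallyEq l (h.mono fun y hy => by simp only [hy])
  have hp' := eventually_all.2 fun l => eventually_all.2 fun a => eventually_all.2 (hp l a)
  filter_upwards [h, hp'] with y hy hy'
  simp only [christoffel, hy, hy']

theorem ricciCurv_congr (h : G =ᶠ[𝓝 x] G') (i j : Fin n) :
    ricciCurv G i j x = ricciCurv G' i j x := by
  have hc := christoffel_eventuallyEq h
  simp only [ricciCurv, riemannCurv, (hc _ _ _).eq_of_nhds]
  simp only [fun l k i j => pderiv_congr l (hc k i j)]

theorem lieMetric_congr {X X' : (Fin n → ℝ) → (Fin n → ℝ)} (h : G =ᶠ[𝓝 x] G')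
    (hX : X =ᶠ[𝓝 x] X') (i j : Fin n) : lieMetric G X i j x = lieMetric G' X' i j x := by
  have hp : ∀ l a b : Fin n, pderiv l (fun y => G y a b) x = pderiv l (fun y => G' y a b) x :=
    fun l a b => pderiv_congr l (h.mono fun y hy => by simp only [hy])
  have hq : ∀ l a : Fin n, pderiv l (fun y => X y a) x = pderiv l (fun y => X' y a) x :=
    fun l a => pderiv_congr l (hX.mono fun y hy => by simp only [hy])
  simp only [lieMetric, hp, hq, h.eq_of_nhds, hX.eq_of_nhds]

end Germ

/-! ### The reduced metrics -/

/-- The metric `E (dt₁² + ε dt₂²) + k dz₁² + 2 h dz₁ (dz₂ + f dt₁)`, where `E, f, k, h` are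
functions of `(t₁, t₂)`. -/
noncomputable def redMetric (ε : ℝ) (E f k h : (Fin 2 → ℝ) → ℝ) (x : Fin 4 → ℝ) :
    Matrix (Fin 4) (Fin 4) ℝ :=
  !![E (tProj x), 0, h (tProj x) * f (tProj x), 0;
     0, ε * E (tProj x), 0, 0;
     h (tProj x) * f (tProj x), 0, k (tProj x), h (tProj x);
     0, 0, h (tProj x), 0]

/-- The coefficients of a reduced metric over the domain `D` are smooth, and the metric is
nondegenerate. -/
structure IsRedData (D : Set (Fin 2 → ℝ)) (ε : ℝ) (E f k h : (Fin 2 → ℝ) → ℝ) : Prop where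
  isOpen : IsOpen D
  sq_eq_one : ε ^ 2 = 1
  smooth_E : ContDiffOn ℝ ∞ E D
  smooth_f : ContDiffOn ℝ ∞ f D
  smooth_k : ContDiffOn ℝ ∞ k D
  smooth_h : ContDiffOn ℝ ∞ h D
  E_ne_zero : ∀ t ∈ D, E t ≠ 0
  h_ne_zero : ∀ t ∈ D, h t ≠ 0

/-- The Christoffel symbols of a reduced metric. -/
noncomputable def redChristoffel (ε : ℝ) (E f k h : (Fin 2 → ℝ) → ℝ) (l i j : Fin 4)
    (t : Fin 2 → ℝ) : ℝ :=
  (![!![pderiv 0 E t / (2 * E t),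
        pderiv 1 E t / (2 * E t),
        -f t * pderiv 0 h t / (2 * E t),
        0;
      pderiv 1 E t / (2 * E t),
        -pderiv 0 E t * ε / (2 * E t),
        pderiv 1 f t * h t / (2 * E t),
        0;
      -f t * pderiv 0 h t / (2 * E t),
        pderiv 1 f t * h t / (2 * E t),
        -pderiv 0 k t / (2 * E t),
        -pderiv 0 h t / (2 * E t);
      0, 0,
        -pderiv 0 h t / (2 * E t),
        0],
    !![-pderiv 1 E t * ε / (2 * E t),
        pderiv 0 E t / (2 * E t),
        -ε * f t * pderiv 1 h t / (2 * E t) - ε * pderiv 1 f t * h t / (2 * E t),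
        0;
      pderiv 0 E t / (2 * E t),
        pderiv 1 E t / (2 * E t),
        0,
        0;
      -ε * f t * pderiv 1 h t / (2 * E t) - ε * pderiv 1 f t * h t / (2 * E t),
        0,
        -ε * pderiv 1 k t / (2 * E t),
        -ε * pderiv 1 h t / (2 * E t);
      0, 0,
        -ε * pderiv 1 h t / (2 * E t),
        0],
    !![0, 0,
        pderiv 0 h t / (2 * h t),
        0;
      0, 0,
        pderiv 1 h t / (2 * h t),
        0;
      pderiv 0 h t / (2 * h t),
        pderiv 1 h t / (2 * h t),
        0,
        0;
      0, 0, 0, 0],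
    !![-pderiv 0 E t * f t / (2 * E t) + f t * pderiv 0 h t / h t + pderiv 0 f t,
        -pderiv 1 E t * f t / (2 * E t) + f t * pderiv 1 h t / (2 * h t) + pderiv 1 f t / 2,
        f t ^ 2 * pderiv 0 h t / (2 * E t) - pderiv 0 h t * k t / (2 * h t ^ 2)
          + pderiv 0 k t / (2 * h t),
        pderiv 0 h t / (2 * h t);
      -pderiv 1 E t * f t / (2 * E t) + f t * pderiv 1 h t / (2 * h t) + pderiv 1 f t / 2,
        pderiv 0 E t * ε * f t / (2 * E t),
        -f t * pderiv 1 f t * h t / (2 * E t) - pderiv 1 h t * k t / (2 * h t ^ 2)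
          + pderiv 1 k t / (2 * h t),
        pderiv 1 h t / (2 * h t);
      f t ^ 2 * pderiv 0 h t / (2 * E t) - pderiv 0 h t * k t / (2 * h t ^ 2)
          + pderiv 0 k t / (2 * h t),
        -f t * pderiv 1 f t * h t / (2 * E t) - pderiv 1 h t * k t / (2 * h t ^ 2)
          + pderiv 1 k t / (2 * h t),
        f t * pderiv 0 k t / (2 * E t),
        f t * pderiv 0 h t / (2 * E t);
      pderiv 0 h t / (2 * h t),
        pderiv 1 h t / (2 * h t),
        f t * pderiv 0 h t / (2 * E t),
        0]] :
    Fin 4 → Matrix (Fin 4) (Fin 4) ℝ) l i j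

/-- The inverse of the matrix of a reduced metric. -/
noncomputable def redInverse (ε : ℝ) (E f k h : (Fin 2 → ℝ) → ℝ) (t : Fin 2 → ℝ) :
    Matrix (Fin 4) (Fin 4) ℝ :=
  !![1 / E t, 0, 0, -f t / E t;
     0, ε / E t, 0, 0;
     0, 0, 0, 1 / h t;
     -f t / E t, 0, 1 / h t, f t ^ 2 / E t - k t / h t ^ 2]

/-- The tables of entries let `simp only` evaluate matrix coefficients at literal indices without
unfolding the matrices, which keeps the curvature computation manageable. -/
theorem redMetric_entries (ε : ℝ) (E f k h : (Fin 2 → ℝ) → ℝ) (x : Fin 4 → ℝ) :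
    redMetric ε E f k h x 0 0 = E (tProj x) ∧
    redMetric ε E f k h x 0 1 = 0 ∧
    redMetric ε E f k h x 0 2 = h (tProj x) * f (tProj x) ∧
    redMetric ε E f k h x 0 3 = 0 ∧
    redMetric ε E f k h x 1 0 = 0 ∧
    redMetric ε E f k h x 1 1 = ε * E (tProj x) ∧
    redMetric ε E f k h x 1 2 = 0 ∧
    redMetric ε E f k h x 1 3 = 0 ∧
    redMetric ε E f k h x 2 0 = h (tProj x) * f (tProj x) ∧
    redMetric ε E f k h x 2 1 = 0 ∧
    redMetric ε E f k h x 2 2 = k (tProj x) ∧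
    redMetric ε E f k h x 2 3 = h (tProj x) ∧
    redMetric ε E f k h x 3 0 = 0 ∧
    redMetric ε E f k h x 3 1 = 0 ∧
    redMetric ε E f k h x 3 2 = h (tProj x) ∧
    redMetric ε E f k h x 3 3 = 0 := by
  refine ⟨rfl, rfl, rfl, rfl, rfl, rfl, rfl, rfl, rfl, rfl, rfl, rfl, rfl, rfl, rfl, rfl⟩

theorem redInverse_entries (ε : ℝ) (E f k h : (Fin 2 → ℝ) → ℝ) (x : Fin 4 → ℝ) :
    redInverse ε E f k h (tProj x) 0 0 = 1 / E (tProj x) ∧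
    redInverse ε E f k h (tProj x) 0 1 = 0 ∧
    redInverse ε E f k h (tProj x) 0 2 = 0 ∧
    redInverse ε E f k h (tProj x) 0 3 = -f (tProj x) / E (tProj x) ∧
    redInverse ε E f k h (tProj x) 1 0 = 0 ∧
    redInverse ε E f k h (tProj x) 1 1 = ε / E (tProj x) ∧
    redInverse ε E f k h (tProj x) 1 2 = 0 ∧
    redInverse ε E f k h (tProj x) 1 3 = 0 ∧
    redInverse ε E f k h (tProj x) 2 0 = 0 ∧
    redInverse ε E f k h (tProj x) 2 1 = 0 ∧
    redInverse ε E f k h (tProj x) 2 2 = 0 ∧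
    redInverse ε E f k h (tProj x) 2 3 = 1 / h (tProj x) ∧
    redInverse ε E f k h (tProj x) 3 0 = -f (tProj x) / E (tProj x) ∧
    redInverse ε E f k h (tProj x) 3 1 = 0 ∧
    redInverse ε E f k h (tProj x) 3 2 = 1 / h (tProj x) ∧
    redInverse ε E f k h (tProj x) 3 3 =
      f (tProj x) ^ 2 / E (tProj x) - k (tProj x) / h (tProj x) ^ 2 := by
  refine ⟨rfl, rfl, rfl, rfl, rfl, rfl, rfl, rfl, rfl, rfl, rfl, rfl, rfl, rfl, rfl, rfl⟩

/-- These are equalities of functions, so that they also rewrite under `pderiv` in the curvature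
tensor. -/
theorem redChristoffel_entries (ε : ℝ) (E f k h : (Fin 2 → ℝ) → ℝ) :
    redChristoffel ε E f k h 0 0 0 = (fun t => pderiv 0 E t / (2 * E t)) ∧
    redChristoffel ε E f k h 0 0 1 = (fun t => pderiv 1 E t / (2 * E t)) ∧
    redChristoffel ε E f k h 0 0 2 = (fun t => -f t * pderiv 0 h t / (2 * E t)) ∧
    redChristoffel ε E f k h 0 0 3 = (fun _ => 0) ∧
    redChristoffel ε E f k h 0 1 0 = (fun t => pderiv 1 E t / (2 * E t)) ∧
    redChristoffel ε E f k h 0 1 1 = (fun t => -pderiv 0 E t * ε / (2 * E t)) ∧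
    redChristoffel ε E f k h 0 1 2 = (fun t => pderiv 1 f t * h t / (2 * E t)) ∧
    redChristoffel ε E f k h 0 1 3 = (fun _ => 0) ∧
    redChristoffel ε E f k h 0 2 0 = (fun t => -f t * pderiv 0 h t / (2 * E t)) ∧
    redChristoffel ε E f k h 0 2 1 = (fun t => pderiv 1 f t * h t / (2 * E t)) ∧
    redChristoffel ε E f k h 0 2 2 = (fun t => -pderiv 0 k t / (2 * E t)) ∧
    redChristoffel ε E f k h 0 2 3 = (fun t => -pderiv 0 h t / (2 * E t)) ∧
    redChristoffel ε E f k h 0 3 0 = (fun _ => 0) ∧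
    redChristoffel ε E f k h 0 3 1 = (fun _ => 0) ∧
    redChristoffel ε E f k h 0 3 2 = (fun t => -pderiv 0 h t / (2 * E t)) ∧
    redChristoffel ε E f k h 0 3 3 = (fun _ => 0) ∧
    redChristoffel ε E f k h 1 0 0 = (fun t => -pderiv 1 E t * ε / (2 * E t)) ∧
    redChristoffel ε E f k h 1 0 1 = (fun t => pderiv 0 E t / (2 * E t)) ∧
    redChristoffel ε E f k h 1 0 2 =
      (fun t => -ε * f t * pderiv 1 h t / (2 * E t) - ε * pderiv 1 f t * h t / (2 * E t)) ∧
    redChristoffel ε E f k h 1 0 3 = (fun _ => 0) ∧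
    redChristoffel ε E f k h 1 1 0 = (fun t => pderiv 0 E t / (2 * E t)) ∧
    redChristoffel ε E f k h 1 1 1 = (fun t => pderiv 1 E t / (2 * E t)) ∧
    redChristoffel ε E f k h 1 1 2 = (fun _ => 0) ∧
    redChristoffel ε E f k h 1 1 3 = (fun _ => 0) ∧
    redChristoffel ε E f k h 1 2 0 =
      (fun t => -ε * f t * pderiv 1 h t / (2 * E t) - ε * pderiv 1 f t * h t / (2 * E t)) ∧
    redChristoffel ε E f k h 1 2 1 = (fun _ => 0) ∧
    redChristoffel ε E f k h 1 2 2 = (fun t => -ε * pderiv 1 k t / (2 * E t)) ∧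
    redChristoffel ε E f k h 1 2 3 = (fun t => -ε * pderiv 1 h t / (2 * E t)) ∧
    redChristoffel ε E f k h 1 3 0 = (fun _ => 0) ∧
    redChristoffel ε E f k h 1 3 1 = (fun _ => 0) ∧
    redChristoffel ε E f k h 1 3 2 = (fun t => -ε * pderiv 1 h t / (2 * E t)) ∧
    redChristoffel ε E f k h 1 3 3 = (fun _ => 0) ∧
    redChristoffel ε E f k h 2 0 0 = (fun _ => 0) ∧
    redChristoffel ε E f k h 2 0 1 = (fun _ => 0) ∧
    redChristoffel ε E f k h 2 0 2 = (fun t => pderiv 0 h t / (2 * h t)) ∧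
    redChristoffel ε E f k h 2 0 3 = (fun _ => 0) ∧
    redChristoffel ε E f k h 2 1 0 = (fun _ => 0) ∧
    redChristoffel ε E f k h 2 1 1 = (fun _ => 0) ∧
    redChristoffel ε E f k h 2 1 2 = (fun t => pderiv 1 h t / (2 * h t)) ∧
    redChristoffel ε E f k h 2 1 3 = (fun _ => 0) ∧
    redChristoffel ε E f k h 2 2 0 = (fun t => pderiv 0 h t / (2 * h t)) ∧
    redChristoffel ε E f k h 2 2 1 = (fun t => pderiv 1 h t / (2 * h t)) ∧
    redChristoffel ε E f k h 2 2 2 = (fun _ => 0) ∧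
    redChristoffel ε E f k h 2 2 3 = (fun _ => 0) ∧
    redChristoffel ε E f k h 2 3 0 = (fun _ => 0) ∧
    redChristoffel ε E f k h 2 3 1 = (fun _ => 0) ∧
    redChristoffel ε E f k h 2 3 2 = (fun _ => 0) ∧
    redChristoffel ε E f k h 2 3 3 = (fun _ => 0) ∧
    redChristoffel ε E f k h 3 0 0 =
      (fun t => -pderiv 0 E t * f t / (2 * E t) + f t * pderiv 0 h t / h t + pderiv 0 f t) ∧
    redChristoffel ε E f k h 3 0 1 =
      (fun t => -pderiv 1 E t * f t / (2 * E t) + f t * pderiv 1 h t / (2 * h t)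
        + pderiv 1 f t / 2) ∧
    redChristoffel ε E f k h 3 0 2 =
      (fun t => f t ^ 2 * pderiv 0 h t / (2 * E t) - pderiv 0 h t * k t / (2 * h t ^ 2)
        + pderiv 0 k t / (2 * h t)) ∧
    redChristoffel ε E f k h 3 0 3 = (fun t => pderiv 0 h t / (2 * h t)) ∧
    redChristoffel ε E f k h 3 1 0 =
      (fun t => -pderiv 1 E t * f t / (2 * E t) + f t * pderiv 1 h t / (2 * h t)
        + pderiv 1 f t / 2) ∧
    redChristoffel ε E f k h 3 1 1 = (fun t => pderiv 0 E t * ε * f t / (2 * E t)) ∧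
    redChristoffel ε E f k h 3 1 2 =
      (fun t => -f t * pderiv 1 f t * h t / (2 * E t) - pderiv 1 h t * k t / (2 * h t ^ 2)
        + pderiv 1 k t / (2 * h t)) ∧
    redChristoffel ε E f k h 3 1 3 = (fun t => pderiv 1 h t / (2 * h t)) ∧
    redChristoffel ε E f k h 3 2 0 =
      (fun t => f t ^ 2 * pderiv 0 h t / (2 * E t) - pderiv 0 h t * k t / (2 * h t ^ 2)
        + pderiv 0 k t / (2 * h t)) ∧
    redChristoffel ε E f k h 3 2 1 =
      (fun t => -f t * pderiv 1 f t * h t / (2 * E t) - pderiv 1 h t * k t / (2 * h t ^ 2)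
        + pderiv 1 k t / (2 * h t)) ∧
    redChristoffel ε E f k h 3 2 2 = (fun t => f t * pderiv 0 k t / (2 * E t)) ∧
    redChristoffel ε E f k h 3 2 3 = (fun t => f t * pderiv 0 h t / (2 * E t)) ∧
    redChristoffel ε E f k h 3 3 0 = (fun t => pderiv 0 h t / (2 * h t)) ∧
    redChristoffel ε E f k h 3 3 1 = (fun t => pderiv 1 h t / (2 * h t)) ∧
    redChristoffel ε E f k h 3 3 2 = (fun t => f t * pderiv 0 h t / (2 * E t)) ∧
    redChristoffel ε E f k h 3 3 3 = (fun _ => 0) := by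
  repeat' apply And.intro
  all_goals rfl

/-- Applied by `refine` to split over indices: the goals then contain the literals `0, 1, 2, 3` that
the tables of entries match. -/
theorem forall_fin_four {p : Fin 4 → Prop} (h0 : p 0) (h1 : p 1) (h2 : p 2) (h3 : p 3) :
    ∀ i, p i := by
  intro i
  fin_cases i
  exacts [h0, h1, h2, h3]

theorem inv_redMetric {ε : ℝ} {E f k h : (Fin 2 → ℝ) → ℝ} {x : Fin 4 → ℝ} (hε : ε ^ 2 = 1)
    (hE : E (tProj x) ≠ 0) (hh : h (tProj x) ≠ 0) :
    (redMetric ε E f k h x)⁻¹ = redInverse ε E f k h (tProj x) := by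
  apply Matrix.inv_eq_right_inv
  ext i j
  revert i j
  refine forall_fin_four ?_ ?_ ?_ ?_ <;> refine forall_fin_four ?_ ?_ ?_ ?_ <;>
    simp only [Matrix.mul_apply, Fin.sum_univ_four, redMetric_entries, redInverse_entries,
      mul_zero, zero_mul, add_zero, zero_add, Matrix.one_apply_eq] <;>
    first
    | rfl
    | (field_simp; done)
    | (field_simp; exact hε)
    | (rw [Matrix.one_apply_ne (by decide)]; first | done | (field_simp; done) | (field_simp; ring1))

namespace IsRedData

variable {D : Set (Fin 2 → ℝ)} {ε : ℝ} {E f k h : (Fin 2 → ℝ) → ℝ}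

theorem contDiffAt_E (H : IsRedData D ε E f k h) {t : Fin 2 → ℝ} (ht : t ∈ D) :
    ContDiffAt ℝ ∞ E t :=
  H.smooth_E.contDiffAt (H.isOpen.mem_nhds ht)

theorem contDiffAt_f (H : IsRedData D ε E f k h) {t : Fin 2 → ℝ} (ht : t ∈ D) :
    ContDiffAt ℝ ∞ f t :=
  H.smooth_f.contDiffAt (H.isOpen.mem_nhds ht)

theorem contDiffAt_k (H : IsRedData D ε E f k h) {t : Fin 2 → ℝ} (ht : t ∈ D) :
    ContDiffAt ℝ ∞ k t :=
  H.smooth_k.contDiffAt (H.isOpen.mem_nhds ht)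

theorem contDiffAt_h (H : IsRedData D ε E f k h) {t : Fin 2 → ℝ} (ht : t ∈ D) :
    ContDiffAt ℝ ∞ h t :=
  H.smooth_h.contDiffAt (H.isOpen.mem_nhds ht)

/-- The differentiability facts used in computations with reduced metrics. -/
theorem differentiableAt (H : IsRedData D ε E f k h) {t : Fin 2 → ℝ} (ht : t ∈ D) :
    DifferentiableAt ℝ E t ∧ DifferentiableAt ℝ f t ∧ DifferentiableAt ℝ k t ∧
      DifferentiableAt ℝ h t ∧ ∀ a : Fin 2, DifferentiableAt ℝ (pderiv a E) t ∧
        DifferentiableAt ℝ (pderiv a f) t ∧ DifferentiableAt ℝ (pderiv a k) t ∧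
          DifferentiableAt ℝ (pderiv a h) t :=
  have h0 : (∞ : WithTop ℕ∞) ≠ 0 := by simp
  ⟨(H.contDiffAt_E ht).differentiableAt h0, (H.contDiffAt_f ht).differentiableAt h0,
    (H.contDiffAt_k ht).differentiableAt h0, (H.contDiffAt_h ht).differentiableAt h0, fun a =>
    ⟨(contDiffAt_pderiv a (H.contDiffAt_E ht)).differentiableAt h0,
      (contDiffAt_pderiv a (H.contDiffAt_f ht)).differentiableAt h0,
      (contDiffAt_pderiv a (H.contDiffAt_k ht)).differentiableAt h0,
      (contDiffAt_pderiv a (H.contDiffAt_h ht)).differentiableAt h0⟩⟩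

theorem pderiv_redMetric_entries (H : IsRedData D ε E f k h) {x : Fin 4 → ℝ} (hx : tProj x ∈ D) :
    pderiv 0 (fun y => E (tProj y)) x = pderiv 0 E (tProj x) ∧
    pderiv 0 (fun y => k (tProj y)) x = pderiv 0 k (tProj x) ∧
    pderiv 0 (fun y => h (tProj y)) x = pderiv 0 h (tProj x) ∧
    pderiv 0 (fun y => ε * E (tProj y)) x = ε * pderiv 0 E (tProj x) ∧
    pderiv 0 (fun y => h (tProj y) * f (tProj y)) x =
      pderiv 0 h (tProj x) * f (tProj x) + h (tProj x) * pderiv 0 f (tProj x) ∧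
    pderiv 1 (fun y => E (tProj y)) x = pderiv 1 E (tProj x) ∧
    pderiv 1 (fun y => k (tProj y)) x = pderiv 1 k (tProj x) ∧
    pderiv 1 (fun y => h (tProj y)) x = pderiv 1 h (tProj x) ∧
    pderiv 1 (fun y => ε * E (tProj y)) x = ε * pderiv 1 E (tProj x) ∧
    pderiv 1 (fun y => h (tProj y) * f (tProj y)) x =
      pderiv 1 h (tProj x) * f (tProj x) + h (tProj x) * pderiv 1 f (tProj x) ∧
    pderiv 2 (fun y => E (tProj y)) x = 0 ∧
    pderiv 2 (fun y => k (tProj y)) x = 0 ∧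
    pderiv 2 (fun y => h (tProj y)) x = 0 ∧
    pderiv 2 (fun y => ε * E (tProj y)) x = 0 ∧
    pderiv 2 (fun y => h (tProj y) * f (tProj y)) x = 0 ∧
    pderiv 3 (fun y => E (tProj y)) x = 0 ∧
    pderiv 3 (fun y => k (tProj y)) x = 0 ∧
    pderiv 3 (fun y => h (tProj y)) x = 0 ∧
    pderiv 3 (fun y => ε * E (tProj y)) x = 0 ∧
    pderiv 3 (fun y => h (tProj y) * f (tProj y)) x = 0 := by
  obtain ⟨hE, hf, hk, hh, -⟩ := H.differentiableAt hx
  have hEc : DifferentiableAt ℝ (fun t => ε * E t) (tProj x) := hE.const_mul ε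
  have hEc' : ∀ a, pderiv a (fun t => ε * E t) (tProj x) = ε * pderiv a E (tProj x) := fun a => by
    rw [pderiv_mul a (differentiableAt_const _) hE, pderiv_const]; ring
  have hhf : DifferentiableAt ℝ (fun t => h t * f t) (tProj x) := hh.fun_mul hf
  exact ⟨pderiv_zero_comp_tProj hE,
    pderiv_zero_comp_tProj hk,
    pderiv_zero_comp_tProj hh,
    (pderiv_zero_comp_tProj hEc).trans (hEc' 0),
    (pderiv_zero_comp_tProj hhf).trans (pderiv_mul 0 hh hf),
    pderiv_one_comp_tProj hE,
    pderiv_one_comp_tProj hk,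
    pderiv_one_comp_tProj hh,
    (pderiv_one_comp_tProj hEc).trans (hEc' 1),
    (pderiv_one_comp_tProj hhf).trans (pderiv_mul 1 hh hf),
    pderiv_two_comp_tProj hE,
    pderiv_two_comp_tProj hk,
    pderiv_two_comp_tProj hh,
    pderiv_two_comp_tProj hEc,
    pderiv_two_comp_tProj hhf,
    pderiv_three_comp_tProj hE,
    pderiv_three_comp_tProj hk,
    pderiv_three_comp_tProj hh,
    pderiv_three_comp_tProj hEc,
    pderiv_three_comp_tProj hhf⟩

theorem christoffel_redMetric (H : IsRedData D ε E f k h) {x : Fin 4 → ℝ} (hx : tProj x ∈ D)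
    (l i j : Fin 4) :
    christoffel (redMetric ε E f k h) l i j x = redChristoffel ε E f k h l i j (tProj x) := by
  have hE := H.E_ne_zero _ hx
  have hh := H.h_ne_zero _ hx
  have hε := H.sq_eq_one
  have hp := H.pderiv_redMetric_entries hx
  revert l i j
  refine forall_fin_four ?_ ?_ ?_ ?_ <;> refine forall_fin_four ?_ ?_ ?_ ?_ <;>
    refine forall_fin_four ?_ ?_ ?_ ?_ <;>
    simp only [christoffel, inv_redMetric hε hE hh, Fin.sum_univ_four, redMetric_entries,
      redInverse_entries, redChristoffel_entries, hp, pderiv_const, mul_zero, zero_mul, add_zero,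
      zero_add, sub_zero, sub_self, zero_sub] <;>
    first
    | done
    | (field_simp; done)
    | (field_simp; ring1)
    | (field_simp; rw [hε]; ring1)

end IsRedData

namespace IsRedData

variable {D : Set (Fin 2 → ℝ)} {ε : ℝ} {E f k h : (Fin 2 → ℝ) → ℝ}

theorem differentiableAt_redChristoffel (H : IsRedData D ε E f k h) {t : Fin 2 → ℝ} (ht : t ∈ D)
    (l i j : Fin 4) : DifferentiableAt ℝ (redChristoffel ε E f k h l i j) t := by
  have hE := H.E_ne_zero _ ht
  have hh := H.h_ne_zero _ ht
  obtain ⟨dE, df, dk, dh, d⟩ := H.differentiableAt ht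
  have dE' := fun a => (d a).1
  have df' := fun a => (d a).2.1
  have dk' := fun a => (d a).2.2.1
  have dh' := fun a => (d a).2.2.2
  have hE2 : 2 * E t ≠ 0 := by positivity
  have hh2 : 2 * h t ≠ 0 := by positivity
  have hh3 : 2 * h t ^ 2 ≠ 0 := by positivity
  revert l i j
  refine forall_fin_four ?_ ?_ ?_ ?_ <;> refine forall_fin_four ?_ ?_ ?_ ?_ <;>
    refine forall_fin_four ?_ ?_ ?_ ?_ <;>
    simp only [redChristoffel_entries] <;>
    fun_prop (disch := assumption)

/-- The formula for the Christoffel symbols holds on a neighbourhood, so it may be differentiated;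
nothing depends on `z`, hence the two zeros. -/
theorem pderiv_christoffel_redMetric (H : IsRedData D ε E f k h) {x : Fin 4 → ℝ}
    (hx : tProj x ∈ D) (l i j : Fin 4) :
    pderiv 0 (christoffel (redMetric ε E f k h) l i j) x =
      pderiv 0 (redChristoffel ε E f k h l i j) (tProj x) ∧
    pderiv 1 (christoffel (redMetric ε E f k h) l i j) x =
      pderiv 1 (redChristoffel ε E f k h l i j) (tProj x) ∧
    pderiv 2 (christoffel (redMetric ε E f k h) l i j) x = 0 ∧
    pderiv 3 (christoffel (redMetric ε E f k h) l i j) x = 0 := by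
  have h0 : christoffel (redMetric ε E f k h) l i j =ᶠ[𝓝 x]
      fun y => redChristoffel ε E f k h l i j (tProj y) := by
    filter_upwards [(H.isOpen.preimage continuous_tProj).mem_nhds hx] with y hy
    exact H.christoffel_redMetric hy l i j
  have hd := H.differentiableAt_redChristoffel hx l i j
  exact ⟨(pderiv_congr 0 h0).trans (pderiv_zero_comp_tProj hd),
    (pderiv_congr 1 h0).trans (pderiv_one_comp_tProj hd),
    (pderiv_congr 2 h0).trans (pderiv_two_comp_tProj hd),
    (pderiv_congr 3 h0).trans (pderiv_three_comp_tProj hd)⟩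

/-- The Ricci tensor of a reduced metric. -/
theorem ricciCurv_redMetric (H : IsRedData D ε E f k h) {x : Fin 4 → ℝ} {t : Fin 2 → ℝ}
    (hx : tProj x = t) (ht : t ∈ D) :
    ricciCurv (redMetric ε E f k h) 0 0 x =
        pderiv 0 E t ^ 2 / (2 * E t ^ 2) + pderiv 1 E t ^ 2 * ε / (2 * E t ^ 2)
        + pderiv 0 E t * pderiv 0 h t / (2 * E t * h t) - pderiv 0 (pderiv 0 E) t / (2 * E t)
        - pderiv 1 E t * ε * pderiv 1 h t / (2 * E t * h t)
        - pderiv 1 (pderiv 1 E) t * ε / (2 * E t) + pderiv 0 h t ^ 2 / (2 * h t ^ 2)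
        - pderiv 0 (pderiv 0 h) t / h t ∧
    ricciCurv (redMetric ε E f k h) 0 1 x =
        pderiv 0 E t * pderiv 1 h t / (2 * E t * h t)
        + pderiv 1 E t * pderiv 0 h t / (2 * E t * h t)
        + pderiv 0 h t * pderiv 1 h t / (2 * h t ^ 2) - pderiv 0 (pderiv 1 h) t / h t ∧
    ricciCurv (redMetric ε E f k h) 0 2 x =
        pderiv 1 E t * ε * pderiv 1 f t * h t / (2 * E t ^ 2)
        - ε * f t * pderiv 1 (pderiv 1 h) t / (2 * E t) - ε * pderiv 1 f t * pderiv 1 h t / (E t)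
        - ε * pderiv 1 (pderiv 1 f) t * h t / (2 * E t)
        - f t * pderiv 0 (pderiv 0 h) t / (2 * E t) ∧
    ricciCurv (redMetric ε E f k h) 0 3 x =
        0 ∧
    ricciCurv (redMetric ε E f k h) 1 0 x =
        pderiv 0 E t * pderiv 1 h t / (2 * E t * h t)
        + pderiv 1 E t * pderiv 0 h t / (2 * E t * h t)
        + pderiv 0 h t * pderiv 1 h t / (2 * h t ^ 2) - pderiv 0 (pderiv 1 h) t / h t ∧
    ricciCurv (redMetric ε E f k h) 1 1 x =
        pderiv 0 E t ^ 2 * ε / (2 * E t ^ 2) + pderiv 1 E t ^ 2 / (2 * E t ^ 2)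
        - pderiv 0 E t * ε * pderiv 0 h t / (2 * E t * h t)
        - pderiv 0 (pderiv 0 E) t * ε / (2 * E t) + pderiv 1 E t * pderiv 1 h t / (2 * E t * h t)
        - pderiv 1 (pderiv 1 E) t / (2 * E t) + pderiv 1 h t ^ 2 / (2 * h t ^ 2)
        - pderiv 1 (pderiv 1 h) t / h t ∧
    ricciCurv (redMetric ε E f k h) 1 2 x =
        -pderiv 0 E t * pderiv 1 f t * h t / (2 * E t ^ 2)
        + pderiv 0 (pderiv 1 f) t * h t / (2 * E t) + pderiv 1 f t * pderiv 0 h t / (E t) ∧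
    ricciCurv (redMetric ε E f k h) 1 3 x =
        0 ∧
    ricciCurv (redMetric ε E f k h) 2 0 x =
        pderiv 1 E t * ε * pderiv 1 f t * h t / (2 * E t ^ 2)
        - ε * f t * pderiv 1 (pderiv 1 h) t / (2 * E t) - ε * pderiv 1 f t * pderiv 1 h t / (E t)
        - ε * pderiv 1 (pderiv 1 f) t * h t / (2 * E t)
        - f t * pderiv 0 (pderiv 0 h) t / (2 * E t) ∧
    ricciCurv (redMetric ε E f k h) 2 1 x =
        -pderiv 0 E t * pderiv 1 f t * h t / (2 * E t ^ 2)
        + pderiv 0 (pderiv 1 f) t * h t / (2 * E t) + pderiv 1 f t * pderiv 0 h t / (E t) ∧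
    ricciCurv (redMetric ε E f k h) 2 2 x =
        ε * pderiv 1 f t ^ 2 * h t ^ 2 / (2 * E t ^ 2)
        - ε * pderiv 1 h t ^ 2 * k t / (2 * E t * h t ^ 2)
        + ε * pderiv 1 h t * pderiv 1 k t / (2 * E t * h t)
        - ε * pderiv 1 (pderiv 1 k) t / (2 * E t) - pderiv 0 h t ^ 2 * k t / (2 * E t * h t ^ 2)
        + pderiv 0 h t * pderiv 0 k t / (2 * E t * h t) - pderiv 0 (pderiv 0 k) t / (2 * E t) ∧
    ricciCurv (redMetric ε E f k h) 2 3 x =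
        -ε * pderiv 1 (pderiv 1 h) t / (2 * E t) - pderiv 0 (pderiv 0 h) t / (2 * E t) ∧
    ricciCurv (redMetric ε E f k h) 3 0 x =
        0 ∧
    ricciCurv (redMetric ε E f k h) 3 1 x =
        0 ∧
    ricciCurv (redMetric ε E f k h) 3 2 x =
        -ε * pderiv 1 (pderiv 1 h) t / (2 * E t) - pderiv 0 (pderiv 0 h) t / (2 * E t) ∧
    ricciCurv (redMetric ε E f k h) 3 3 x =
        0 := by
  subst hx
  have hε := H.sq_eq_one
  have hE := H.E_ne_zero _ ht
  have hh := H.h_ne_zero _ ht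
  obtain ⟨dE, df, dk, dh, d⟩ := H.differentiableAt ht
  have dE' := fun a => (d a).1
  have df' := fun a => (d a).2.1
  have dk' := fun a => (d a).2.2.1
  have dh' := fun a => (d a).2.2.2
  have hE2 : 2 * E (tProj x) ≠ 0 := by positivity
  have hh2 : 2 * h (tProj x) ≠ 0 := by positivity
  have hh3 : 2 * h (tProj x) ^ 2 ≠ 0 := by positivity
  -- Mixed second derivatives are brought to one order, since `ring1` would treat the two orders as
  -- unrelated atoms.
  have cE := pderiv_comm 1 0 (H.contDiffAt_E ht)
  have cf := pderiv_comm 1 0 (H.contDiffAt_f ht)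
  have ck := pderiv_comm 1 0 (H.contDiffAt_k ht)
  have ch := pderiv_comm 1 0 (H.contDiffAt_h ht)
  refine ⟨?_, ?_, ?_, ?_, ?_, ?_, ?_, ?_, ?_, ?_, ?_, ?_, ?_, ?_, ?_, ?_⟩ <;>
    simp only [ricciCurv, riemannCurv, Fin.sum_univ_four, H.pderiv_christoffel_redMetric ht,
      H.christoffel_redMetric ht, redChristoffel_entries, pderiv_const, mul_zero, zero_mul,
      add_zero, zero_add, sub_zero, sub_self, zero_sub, neg_zero] <;>
    simp (disch := first | assumption | fun_prop (disch := assumption)) only [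
      pderiv_sub, pderiv_neg, pderiv_mul, pderiv_div, pderiv_const, cE, ch] <;>
    first
    | done
    | (field_simp; ring1)
    | (field_simp; simp only [hε]; ring1)

end IsRedData

/-! ### The Lie derivative of a reduced metric along a vertical field -/

theorem IsRedData.lieMetric_redMetric {D : Set (Fin 2 → ℝ)} {ε : ℝ} {E f k h : (Fin 2 → ℝ) → ℝ}
    (H : IsRedData D ε E f k h) {x : Fin 4 → ℝ} (hx : tProj x ∈ D)
    {X : (Fin 4 → ℝ) → (Fin 4 → ℝ)} (h0 : ∀ᶠ y in 𝓝 x, X y 0 = 0) (h1 : ∀ᶠ y in 𝓝 x, X y 1 = 0)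
    (i j : Fin 4) :
    lieMetric (redMetric ε E f k h) X i j x =
      redMetric ε E f k h x 2 j * pderiv i (fun y => X y 2) x
      + redMetric ε E f k h x i 2 * pderiv j (fun y => X y 2) x
      + redMetric ε E f k h x 3 j * pderiv i (fun y => X y 3) x
      + redMetric ε E f k h x i 3 * pderiv j (fun y => X y 3) x := by
  have hp := H.pderiv_redMetric_entries hx
  have hX0 : ∀ l, pderiv l (fun y => X y 0) x = 0 := fun l =>
    (pderiv_congr l h0).trans (pderiv_const l 0)
  have hX1 : ∀ l, pderiv l (fun y => X y 1) x = 0 := fun l =>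
    (pderiv_congr l h1).trans (pderiv_const l 0)
  have hz : ∀ a b : Fin 4, pderiv 2 (fun y => redMetric ε E f k h y a b) x = 0 ∧
      pderiv 3 (fun y => redMetric ε E f k h y a b) x = 0 := by
    refine forall_fin_four ?_ ?_ ?_ ?_ <;> refine forall_fin_four ?_ ?_ ?_ ?_ <;>
      simp only [redMetric_entries, hp, pderiv_const, and_self]
  simp only [lieMetric, Fin.sum_univ_four, hX0, hX1, h0.self_of_nhds, h1.self_of_nhds, hz]
  ring

/-! ### The model -/

/-- The function `t₁^{-n - 1/2}` of `t = (t₁, t₂)`. -/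
noncomputable def radial (n : ℕ) (t : Fin 2 → ℝ) : ℝ := 1 / (t 0 ^ n * √(t 0))

section Radial

variable {t : Fin 2 → ℝ}

theorem isOpen_rightHalf : IsOpen {t : Fin 2 → ℝ | 0 < t 0} :=
  isOpen_lt continuous_const (continuous_apply 0)

theorem radial_pos (n : ℕ) (ht : 0 < t 0) : 0 < radial n t := by
  have := Real.sqrt_pos.2 ht
  rw [radial]
  positivity

theorem contDiffAt_radial (n : ℕ) (ht : 0 < t 0) : ContDiffAt ℝ ∞ (radial n) t := by
  have hs := Real.sqrt_pos.2 ht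
  have h0 : ContDiffAt ℝ ∞ (fun t : Fin 2 → ℝ => t 0) t := contDiffAt_apply ..
  exact contDiffAt_const.div ((h0.pow n).mul (h0.sqrt ht.ne')) (by positivity)

theorem pderiv_radial (i : Fin 2) (n : ℕ) (ht : 0 < t 0) :
    pderiv i (radial n) t = if i = 0 then -(n + 1 / 2) * radial (n + 1) t else 0 := by
  have hs := Real.sqrt_pos.2 ht
  have h0 : DifferentiableAt ℝ (fun t : Fin 2 → ℝ => t 0) t := by fun_prop
  have hq : DifferentiableAt ℝ (fun t : Fin 2 → ℝ => √(t 0)) t := h0.sqrt ht.ne'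
  have hqd : pderiv i (fun t : Fin 2 → ℝ => √(t 0)) t = 1 / (2 * √(t 0)) * if i = 0 then 1 else 0 := by
    rw [← pderiv_proj (x := t) i 0, pderiv, fderiv_sqrt h0 ht.ne']
    rfl
  have hd := pderiv_div i (differentiableAt_const (1 : ℝ)) ((h0.fun_pow n).fun_mul hq) (by positivity)
  change pderiv i (fun t => 1 / (t 0 ^ n * √(t 0))) t = _
  rw [hd, pderiv_const, pderiv_mul i (h0.fun_pow n) hq, pderiv_pow i n h0, hqd, pderiv_proj, radial]
  have hw : t 0 = √(t 0) ^ 2 := (Real.sq_sqrt ht.le).symm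
  split_ifs
  · set w := √(t 0)
    rw [hw]
    -- The derivative of `t₀ ^ n` contains the truncated exponent `n - 1`, so `n = 0` is treated
    -- apart.
    rcases n with _ | n
    · field_simp
      ring
    · push_cast
      field_simp
      ring
  · simp

theorem pderiv_radial_eventuallyEq (n : ℕ) (ht : 0 < t 0) :
    pderiv 0 (radial n) =ᶠ[𝓝 t] fun t => -(n + 1 / 2) * radial (n + 1) t := by
  filter_upwards [isOpen_rightHalf.mem_nhds ht] with s hs
  rw [pderiv_radial 0 n hs, if_pos rfl]

theorem pderiv_radial_eventuallyEq_zero (n : ℕ) (ht : 0 < t 0) :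
    pderiv 1 (radial n) =ᶠ[𝓝 t] fun _ => 0 := by
  filter_upwards [isOpen_rightHalf.mem_nhds ht] with s hs
  rw [pderiv_radial 1 n hs, if_neg (by decide)]

end Radial

/-- The function `h₁₁` of the model. -/
noncomputable def modelLeaf (ε : ℝ) (ψ : (Fin 2 → ℝ) → ℝ) (t : Fin 2 → ℝ) : ℝ :=
  ψ t * t 0 + 4 * ε / 9 * radial 0 t

/-- The model as a reduced metric. -/
noncomputable abbrev modelRed (ε : ℝ) (ψ : (Fin 2 → ℝ) → ℝ) :
    (Fin 4 → ℝ) → Matrix (Fin 4) (Fin 4) ℝ :=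
  redMetric ε (radial 0) (fun t => t 1 * radial 2 t) (modelLeaf ε ψ) fun t => t 0

theorem rpow_three_halves {a : ℝ} (ha : 0 < a) : a ^ (3 / 2 : ℝ) = a * √a := by
  rw [show (3 / 2 : ℝ) = 1 + 1 / 2 by norm_num, Real.rpow_add ha, Real.rpow_one,
    ← Real.sqrt_eq_rpow]

theorem modelMetric_eq_modelRed (ε : ℝ) (ψ : (Fin 2 → ℝ) → ℝ) {x : Fin 4 → ℝ} (hx : 0 < x 0) :
    modelMetric ε ψ x = modelRed ε ψ x := by
  have hs := Real.sqrt_pos.2 hx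
  have e0 : tProj x 0 = x 0 := rfl
  have e1 : tProj x 1 = x 1 := rfl
  have a1 : 1 / √(x 0) = radial 0 (tProj x) := by simp [radial, e0]
  have a2 : x 1 / x 0 ^ (3 / 2 : ℝ) = x 0 * (x 1 * radial 2 (tProj x)) := by
    rw [rpow_three_halves hx, radial, e0]
    field_simp
  have a3 : ψ (tProj x) * x 0 + 4 * ε / (9 * √(x 0)) = modelLeaf ε ψ (tProj x) := by
    rw [modelLeaf, radial, e0]
    field_simp
  have a4 : ε / √(x 0) = ε * radial 0 (tProj x) := by rw [← a1]; ring
  rw [modelMetric, modelRed, redMetric, a2, a3, a4, a1, e0, e1]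

theorem isRedData_model {D : Set (Fin 2 → ℝ)} {ε : ℝ} {ψ : (Fin 2 → ℝ) → ℝ} (hD : IsOpen D)
    (hε : ε ^ 2 = 1) (hψ : ContDiffOn ℝ ∞ ψ D) (h0 : ∀ t ∈ D, 0 < t 0) :
    IsRedData D ε (radial 0) (fun t => t 1 * radial 2 t) (modelLeaf ε ψ) fun t => t 0 where
  isOpen := hD
  sq_eq_one := hε
  smooth_E := fun t ht => (contDiffAt_radial 0 (h0 t ht)).contDiffWithinAt
  smooth_f := fun t ht =>
    ((contDiffAt_apply ..).mul (contDiffAt_radial 2 (h0 t ht))).contDiffWithinAt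
  smooth_k := fun t ht => ((hψ t ht).mul (contDiffAt_apply ..).contDiffWithinAt).add
    (contDiffAt_const.mul (contDiffAt_radial 0 (h0 t ht))).contDiffWithinAt
  smooth_h := (contDiff_apply ..).contDiffOn
  E_ne_zero := fun t ht => (radial_pos 0 (h0 t ht)).ne'
  h_ne_zero := fun t ht => (h0 t ht).ne'

section ModelRicci

variable {D : Set (Fin 2 → ℝ)} {ε : ℝ} {ψ : (Fin 2 → ℝ) → ℝ} {t : Fin 2 → ℝ}

theorem pderiv_snd_mul_radial (n : ℕ) (i : Fin 2) (ht : 0 < t 0) :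
    pderiv i (fun t => t 1 * radial n t) t =
      if i = 0 then -(n + 1 / 2) * (t 1 * radial (n + 1) t) else radial n t := by
  rw [pderiv_mul i (by fun_prop) ((contDiffAt_radial n ht).differentiableAt (by simp)),
    pderiv_proj, pderiv_radial i n ht]
  fin_cases i <;> simp
  ring

/-- Negative half-integral powers of `t₁` are kept in the form `radial n`, a family closed under
differentiation. -/
theorem pderiv_modelLeaf (i : Fin 2) (hψ : DifferentiableAt ℝ ψ t) (ht : 0 < t 0) :
    pderiv i (modelLeaf ε ψ) t =
      pderiv i ψ t * t 0 + (if i = 0 then ψ t - 2 * ε / 9 * radial 1 t else 0) := by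
  have hr := (contDiffAt_radial 0 ht).differentiableAt (by simp)
  change pderiv i (fun t => ψ t * t 0 + 4 * ε / 9 * radial 0 t) t = _
  rw [pderiv_add i (by fun_prop) (hr.const_mul _), pderiv_mul i hψ (by fun_prop), pderiv_proj,
    pderiv_mul i (differentiableAt_const _) hr, pderiv_const, pderiv_radial i 0 ht]
  split_ifs <;> push_cast <;> ring

/-- The Ricci tensor of the model. -/
theorem ricciCurv_modelRed (hD : IsOpen D) (hε : ε ^ 2 = 1) (hψ : ContDiffOn ℝ ∞ ψ D)
    (h0 : ∀ t ∈ D, 0 < t 0) {x : Fin 4 → ℝ} (hx : tProj x = t) (ht : t ∈ D) (i j : Fin 4) :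
    ricciCurv (modelRed ε ψ) i j x = if i = 2 ∧ j = 2 then
      -(1 / 2) * (t 0 * √(t 0)) *
        (pderiv 0 (pderiv 0 ψ) t + ε * pderiv 1 (pderiv 1 ψ) t + 1 / t 0 * pderiv 0 ψ t) else 0 := by
  have H := isRedData_model hD hε hψ h0
  have t0 := h0 t ht
  have hψt : ContDiffAt ℝ ∞ ψ t := hψ.contDiffAt (hD.mem_nhds ht)
  have hnz : (∞ : WithTop ℕ∞) ≠ 0 := by simp
  have dψ := hψt.differentiableAt hnz
  have dψ' := fun a => (contDiffAt_pderiv a hψt).differentiableAt hnz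
  have dr := fun n => (contDiffAt_radial n t0).differentiableAt hnz
  have dp : ∀ a : Fin 2, DifferentiableAt ℝ (fun t : Fin 2 → ℝ => t a) t := fun a => by fun_prop
  have hD' := hD.mem_nhds ht
  have E0 := pderiv_radial 0 0 t0
  have E1 := pderiv_radial 1 0 t0
  have E00 := (pderiv_congr 0 (pderiv_radial_eventuallyEq 0 t0)).trans
    (pderiv_mul 0 (differentiableAt_const _) (dr 1))
  have E11 := (pderiv_congr 1 (pderiv_radial_eventuallyEq_zero 0 t0)).trans (pderiv_const 1 0)
  -- The shift of the model is linear in `t₂`, so its `t₂`-derivative is a pure power of `t₁`.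
  have ef1 : pderiv 1 (fun t => t 1 * radial 2 t) =ᶠ[𝓝 t] radial 2 := by
    filter_upwards [hD'] with s hs
    rw [pderiv_snd_mul_radial 2 1 (h0 s hs), if_neg (by decide)]
  have f1 := ef1.self_of_nhds
  have f01 := pderiv_congr 0 ef1
  have f11 := pderiv_congr 1 ef1
  have ek : ∀ a, pderiv a (modelLeaf ε ψ) =ᶠ[𝓝 t] fun t =>
      pderiv a ψ t * t 0 + (if a = 0 then ψ t - 2 * ε / 9 * radial 1 t else 0) := by
    intro a
    filter_upwards [hD'] with s hs
    exact pderiv_modelLeaf a ((hψ.contDiffAt (hD.mem_nhds hs)).differentiableAt hnz) (h0 s hs)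
  have k0 := (ek 0).self_of_nhds
  have k1 := (ek 1).self_of_nhds
  have k00 : pderiv 0 (pderiv 0 (modelLeaf ε ψ)) t =
      pderiv 0 (pderiv 0 ψ) t * t 0 + 2 * pderiv 0 ψ t + ε / 3 * radial 2 t := by
    rw [pderiv_congr 0 (ek 0)]
    simp only [if_true]
    rw [pderiv_add 0 ((dψ' 0).fun_mul (dp 0)) (dψ.fun_sub ((dr 1).const_mul _)),
      pderiv_mul 0 (dψ' 0) (dp 0), pderiv_sub 0 dψ ((dr 1).const_mul _),
      pderiv_mul 0 (differentiableAt_const _) (dr 1), pderiv_const, pderiv_proj,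
      pderiv_radial 0 1 t0]
    simp only [if_true]
    push_cast
    ring
  have k11 : pderiv 1 (pderiv 1 (modelLeaf ε ψ)) t = pderiv 1 (pderiv 1 ψ) t * t 0 := by
    rw [pderiv_congr 1 (ek 1)]
    simp only [Fin.reduceEq, if_false, add_zero]
    rw [pderiv_mul 1 (dψ' 1) (dp 0), pderiv_proj]
    simp
  have hh : ∀ a, pderiv a (fun t : Fin 2 → ℝ => t 0) = fun _ => if a = 0 then 1 else 0 :=
    fun a => funext fun s => pderiv_proj a 0
  have r1 := pderiv_radial 0 1 t0
  have r2 := fun a => pderiv_radial a 2 t0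
  have hw : t 0 = √(t 0) ^ 2 := (Real.sq_sqrt t0.le).symm
  have hs := Real.sqrt_pos.2 t0
  have key := H.ricciCurv_redMetric hx ht
  revert i j
  refine forall_fin_four ?_ ?_ ?_ ?_ <;> refine forall_fin_four ?_ ?_ ?_ ?_ <;>
    simp only [modelRed, key, E0, E1, E00, E11, f1, f01, f11, k0, k1, k00, k11, hh, r1, r2,
      pderiv_const, Fin.reduceEq, if_true, if_false, and_true, and_false, and_self] <;>
    first
    | done
    | (simp; done)
    | skip
  all_goals
    simp only [radial, modelLeaf]
    -- With `w = √t₁` and `t₁ = w²` every remaining component becomes a rational identity in `w`.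
    generalize √(t 0) = w at *
    simp only [hw]
    push_cast
    field_simp
    try simp only [hε]
    ring

end ModelRicci

/-! ### Leaf metric, orbit metric and curvature of a reduced metric -/

section Submersion

variable {ε : ℝ} {E f k h : (Fin 2 → ℝ) → ℝ} {G G' : (Fin 4 → ℝ) → Matrix (Fin 4) (Fin 4) ℝ}
  {x : Fin 4 → ℝ}

theorem inv_leafMetric_redMetric (hh : h (tProj x) ≠ 0) :
    (leafMetric (redMetric ε E f k h) x)⁻¹ =
      !![0, 1 / h (tProj x); 1 / h (tProj x), -k (tProj x) / h (tProj x) ^ 2] := by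
  apply Matrix.inv_eq_right_inv
  have e : leafMetric (redMetric ε E f k h) x = !![k (tProj x), h (tProj x); h (tProj x), 0] := by
    ext i j
    fin_cases i <;> fin_cases j <;> rfl
  rw [e, Matrix.mul_fin_two]
  ext i j
  fin_cases i <;> fin_cases j <;> simp [hh]
  field_simp
  ring

theorem shiftCoeff_redMetric (hh : h (tProj x) ≠ 0) :
    shiftCoeff (redMetric ε E f k h) 0 0 x = 0 ∧
    shiftCoeff (redMetric ε E f k h) 0 1 x = f (tProj x) ∧
    shiftCoeff (redMetric ε E f k h) 1 0 x = 0 ∧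
    shiftCoeff (redMetric ε E f k h) 1 1 x = 0 := by
  have e : ∀ i j, redMetric ε E f k h x (tIdx i) (zIdx j) =
      !![h (tProj x) * f (tProj x), 0; 0, 0] i j := by
    intro i j
    fin_cases i <;> fin_cases j <;> rfl
  simp only [shiftCoeff, inv_leafMetric_redMetric hh, Fin.sum_univ_two, e]
  refine ⟨?_, ?_, ?_, ?_⟩ <;> simp
  field_simp

theorem orbitMetric_redMetric (hh : h (tProj x) ≠ 0) :
    orbitMetric (redMetric ε E f k h) x = !![E (tProj x), 0; 0, ε * E (tProj x)] := by
  have e : ∀ i j, redMetric ε E f k h x (tIdx i) (zIdx j) =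
      !![h (tProj x) * f (tProj x), 0; 0, 0] i j := by
    intro i j
    fin_cases i <;> fin_cases j <;> rfl
  have e' : ∀ i j, redMetric ε E f k h x (tIdx i) (tIdx j) =
      !![E (tProj x), 0; 0, ε * E (tProj x)] i j := by
    intro i j
    fin_cases i <;> fin_cases j <;> rfl
  ext i j
  simp only [orbitMetric, Matrix.of_apply, inv_leafMetric_redMetric hh, Fin.sum_univ_two, e, e']
  fin_cases i <;> fin_cases j <;> simp

/-- The only nonzero shift coefficient is `f_1² = f`, so `𝒞` is a multiple of `∂_{z₂}`. That field
is null, whence `g(𝒞, 𝒞) = 0`, and `𝒞 ≠ 0` amounts to `f_{,t₂} ≠ 0`. -/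
theorem IsRedData.curvatureVec_redMetric {D : Set (Fin 2 → ℝ)} (H : IsRedData D ε E f k h)
    (hx : tProj x ∈ D) :
    curvatureVec (redMetric ε E f k h) x =
      ![0, pderiv 1 f (tProj x) / √|ε * E (tProj x) ^ 2|] := by
  have hev : ∀ᶠ y in 𝓝 x, h (tProj y) ≠ 0 := by
    filter_upwards [(H.isOpen.preimage continuous_tProj).mem_nhds hx] with y hy
    exact H.h_ne_zero _ hy
  have hdet : (orbitMetric (redMetric ε E f k h) x).det = ε * E (tProj x) ^ 2 := by
    rw [orbitMetric_redMetric hev.self_of_nhds, Matrix.det_fin_two_of]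
    ring
  have h00 := (pderiv_congr 1 (hev.mono fun y hy => (shiftCoeff_redMetric (ε := ε) (E := E)
    (f := f) (k := k) hy).1)).trans (pderiv_const 1 0)
  have h01 := (pderiv_congr 1 (hev.mono fun y hy => (shiftCoeff_redMetric (ε := ε) (E := E)
    (f := f) (k := k) hy).2.1)).trans
      (pderiv_one_comp_tProj ((H.contDiffAt_f hx).differentiableAt (by simp)))
  have h10 := (pderiv_congr 0 (hev.mono fun y hy => (shiftCoeff_redMetric (ε := ε) (E := E)
    (f := f) (k := k) hy).2.2.1)).trans (pderiv_const 0 0)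
  have h11 := (pderiv_congr 0 (hev.mono fun y hy => (shiftCoeff_redMetric (ε := ε) (E := E)
    (f := f) (k := k) hy).2.2.2)).trans (pderiv_const 0 0)
  have i0 : tIdx 0 = 0 := rfl
  have i1 : tIdx 1 = 1 := rfl
  ext a
  fin_cases a
  · simp only [curvatureVec, hdet, i0, i1]
    erw [h00, h10]
    simp
  · simp only [curvatureVec, hdet, i0, i1]
    erw [h01, h11]
    simp

theorem shiftCoeff_eventuallyEq (hG : G =ᶠ[𝓝 x] G') (j k : Fin 2) :
    shiftCoeff G j k =ᶠ[𝓝 x] shiftCoeff G' j k := by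
  filter_upwards [hG] with y hy
  simp only [shiftCoeff, leafMetric, hy]

theorem orbitMetric_congr (hG : G x = G' x) : orbitMetric G x = orbitMetric G' x := by
  simp only [orbitMetric, leafMetric, hG]

theorem curvatureVec_congr (hG : G =ᶠ[𝓝 x] G') : curvatureVec G x = curvatureVec G' x := by
  have hs := shiftCoeff_eventuallyEq hG
  ext a
  simp only [curvatureVec, orbitMetric_congr hG.self_of_nhds, pderiv_congr _ (hs _ _)]

end Submersion

/-! ### The model is a soliton -/

section Model

variable {D : Set (Fin 2 → ℝ)} {ε : ℝ} {ψ : (Fin 2 → ℝ) → ℝ}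

theorem modelMetric_eventuallyEq (ε : ℝ) (ψ : (Fin 2 → ℝ) → ℝ) {x : Fin 4 → ℝ} (hx : 0 < x 0) :
    modelMetric ε ψ =ᶠ[𝓝 x] modelRed ε ψ := by
  filter_upwards [(isOpen_lt continuous_const (continuous_apply 0)).mem_nhds hx] with y hy
  exact modelMetric_eq_modelRed ε ψ hy

theorem lieMetric_modelRed (hD : IsOpen D) (hε : ε ^ 2 = 1) (hψ : ContDiffOn ℝ ∞ ψ D)
    (h0 : ∀ t ∈ D, 0 < t 0) {x : Fin 4 → ℝ} (hx : tProj x ∈ D) (a₁ a₂ a₃ : ℝ) (i j : Fin 4) :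
    lieMetric (modelRed ε ψ) (modelField a₁ a₂ a₃) i j x =
      if i = 2 ∧ j = 2 then 2 * x 0 * a₂ else 0 := by
  rw [modelRed, (isRedData_model hD hε hψ h0).lieMetric_redMetric hx
    (Eventually.of_forall fun _ => rfl) (Eventually.of_forall fun _ => rfl)]
  have e2 : (fun y => modelField a₁ a₂ a₃ y 2) = fun _ => a₁ := rfl
  have e3 : (fun y => modelField a₁ a₂ a₃ y 3) = fun y => a₂ * y 2 + a₃ := rfl
  have d3 : ∀ l, pderiv l (fun y : Fin 4 → ℝ => a₂ * y 2 + a₃) x = if l = 2 then a₂ else 0 := by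
    intro l
    rw [pderiv_add l (by fun_prop) (by fun_prop), pderiv_mul l (by fun_prop) (by fun_prop),
      pderiv_const, pderiv_const, pderiv_proj]
    split_ifs <;> ring
  have ht0 : tProj x 0 = x 0 := rfl
  simp only [e2, e3, pderiv_const, d3]
  revert i j
  refine forall_fin_four ?_ ?_ ?_ ?_ <;> refine forall_fin_four ?_ ?_ ?_ ?_ <;>
    simp [redMetric_entries]
  rw [ht0]
  ring

/-- The right-hand side is the `(z₁, z₁)` component of the soliton equation of the model; every
other component holds identically. The two sides differ by the nonzero factor `-t₁ √t₁ / 2`. -/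
theorem modelEquation_iff {a₂ : ℝ} {t : Fin 2 → ℝ} (ht : 0 < t 0) :
    ModelEquation ε a₂ ψ t ↔ -(1 / 2) * (t 0 * √(t 0)) * (pderiv 0 (pderiv 0 ψ) t +
      ε * pderiv 1 (pderiv 1 ψ) t + 1 / t 0 * pderiv 0 ψ t) + 1 / 2 * (2 * t 0 * a₂) = 0 := by
  have hs := Real.sqrt_pos.2 ht
  rw [ModelEquation, eq_div_iff hs.ne']
  constructor
  · intro h
    linear_combination -(1 / 2) * t 0 * h
  · intro h
    have : t 0 * ((pderiv 0 (pderiv 0 ψ) t + ε * pderiv 1 (pderiv 1 ψ) t + 1 / t 0 * pderiv 0 ψ t)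
        * √(t 0) - 2 * a₂) = 0 := by linear_combination (-2) * h
    linarith [(mul_eq_zero.1 this).resolve_left ht.ne']

theorem model_isSoliton (hε : ε = 1 ∨ ε = -1) (a₁ a₂ a₃ : ℝ) (hD : IsOpen D)
    (hψ : ContDiffOn ℝ ∞ ψ D) (hm : ∀ t ∈ D, 0 < t 0 ∧ ModelEquation ε a₂ ψ t)
    {x : Fin 4 → ℝ} (hx : tProj x ∈ D) :
    (modelMetric ε ψ x).det ≠ 0 ∧
      (leafMetric (modelMetric ε ψ) x).det ≠ 0 ∧
      curvatureVec (modelMetric ε ψ) x ≠ 0 ∧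
      curvatureNormSq (modelMetric ε ψ) x = 0 ∧
      ∀ i j, ricciCurv (modelMetric ε ψ) i j x
        + (1 / 2) * lieMetric (modelMetric ε ψ) (modelField a₁ a₂ a₃) i j x = 0 := by
  have hε2 : ε ^ 2 = 1 := by rcases hε with rfl | rfl <;> norm_num
  have hε0 : ε ≠ 0 := by rcases hε with rfl | rfl <;> norm_num
  have h0 : ∀ t ∈ D, 0 < t 0 := fun t ht => (hm t ht).1
  have hx0 : 0 < x 0 := h0 _ hx
  have H := isRedData_model hD hε2 hψ h0
  have hev := modelMetric_eventuallyEq ε ψ hx0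
  have hr := radial_pos 0 (h0 _ hx)
  have hr2 := radial_pos 2 (h0 _ hx)
  have hr' : 0 < √|ε * radial 0 (tProj x) ^ 2| := Real.sqrt_pos.2 (by positivity)
  have hcv : curvatureVec (modelMetric ε ψ) x =
      ![0, radial 2 (tProj x) / √|ε * radial 0 (tProj x) ^ 2|] := by
    rw [curvatureVec_congr hev, H.curvatureVec_redMetric hx,
      pderiv_snd_mul_radial 2 1 (h0 _ hx), if_neg (by decide)]
  refine ⟨?_, ?_, ?_, ?_, ?_⟩
  · rw [hev.self_of_nhds]
    intro hdet
    have hinv := inv_redMetric (f := fun t => t 1 * radial 2 t) (k := modelLeaf ε ψ) hε2 hr.ne'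
      (h := fun t => t 0) hx0.ne'
    -- A matrix of zero determinant has `⁻¹` equal to `0` by convention, whereas the explicit
    -- inverse has the nonzero entry `1 / t₁`.
    rw [Matrix.inv_def, hdet, Ring.inverse_zero, zero_smul] at hinv
    have := congrFun (congrFun hinv 2) 3
    rw [(redInverse_entries ..).2.2.2.2.2.2.2.2.2.2.2.1] at this
    exact (one_div_ne_zero hx0.ne') this.symm
  · have : leafMetric (modelMetric ε ψ) x = !![modelMetric ε ψ x 2 2, x 0; x 0, 0] := by
      ext i j
      fin_cases i <;> fin_cases j <;> rfl
    rw [this, Matrix.det_fin_two_of]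
    simp [hx0.ne']
  · rw [hcv]
    intro h
    exact (div_pos hr2 hr').ne' (congrFun h 1)
  · have : leafMetric (modelMetric ε ψ) x 1 1 = 0 := rfl
    simp [curvatureNormSq, hcv, Fin.sum_univ_two, this]
  · intro i j
    rw [ricciCurv_congr hev, lieMetric_congr hev (EventuallyEq.refl _ _),
      ricciCurv_modelRed hD hε2 hψ h0 rfl hx, lieMetric_modelRed hD hε2 hψ h0 hx]
    split_ifs
    · exact (modelEquation_iff hx0).1 (hm _ hx).2
    · simp

end Model

/-! ### The Gauss curvature of the orbit metric -/

section Gauss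

variable {ε : ℝ} {t : Fin 2 → ℝ}

/-- The conformal factor is a power of `t₁`, so its logarithmic derivative, and with it each
Christoffel symbol, is a constant multiple of `1 / t₁`. -/
theorem christoffel_orbitModel (hε : ε ^ 2 = 1) (ht : 0 < t 0) (l i j : Fin 2) :
    christoffel (orbitModel ε) l i j t =
      (![!![-1, 0; 0, ε], !![0, -1; -1, 0]] : Fin 2 → Matrix (Fin 2) (Fin 2) ℝ) l i j
        / (4 * t 0) := by
  have e : ∀ s, orbitModel ε s = !![radial 0 s, 0; 0, ε * radial 0 s] := by
    intro s
    simp [orbitModel, radial, div_eq_mul_inv]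
  have hr := radial_pos 0 ht
  have hinv : (orbitModel ε t)⁻¹ = !![1 / radial 0 t, 0; 0, ε / radial 0 t] := by
    apply Matrix.inv_eq_right_inv
    rw [e, Matrix.mul_fin_two]
    ext i j
    fin_cases i <;> fin_cases j <;> simp [hr.ne']
    field_simp
    exact hε
  rw [e] at hinv
  have hd := (contDiffAt_radial 0 ht).differentiableAt (by simp)
  have hp : ∀ l, pderiv l (radial 0) t = if l = 0 then -(1 / 2) * (radial 0 t / t 0) else 0 := by
    intro l
    rw [pderiv_radial l 0 ht]
    have : radial 1 t = radial 0 t / t 0 := by simp only [radial]; field_simp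
    simp [this]
  have hp' : ∀ l, pderiv l (fun s => ε * radial 0 s) t =
      if l = 0 then ε * (-(1 / 2) * (radial 0 t / t 0)) else 0 := by
    intro l
    rw [pderiv_mul l (differentiableAt_const _) hd, pderiv_const, hp]
    split_ifs <;> ring
  simp only [christoffel, hinv, Fin.sum_univ_two, e]
  fin_cases l <;> fin_cases i <;> fin_cases j <;> simp [hp, hp', pderiv_const] <;>
    field_simp <;> first | done | ring1 | (rw [hε]; ring1)

theorem gaussCurv_orbitModel (hε : ε ^ 2 = 1) (ht : 0 < t 0) :
    gaussCurv (orbitModel ε) t = -(t 0) ^ (-(3 / 2) : ℝ) / 4 := by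
  have hs := Real.sqrt_pos.2 ht
  have hev : ∀ l i j, christoffel (orbitModel ε) l i j =ᶠ[𝓝 t] fun t =>
      (![!![-1, 0; 0, ε], !![0, -1; -1, 0]] : Fin 2 → Matrix (Fin 2) (Fin 2) ℝ) l i j
        / (4 * t 0) := by
    intro l i j
    filter_upwards [isOpen_rightHalf.mem_nhds ht] with s hs
    exact christoffel_orbitModel hε hs l i j
  have hp : ∀ (a : Fin 2) (c : ℝ), pderiv a (fun t : Fin 2 → ℝ => c / (4 * t 0)) t =
      if a = 0 then -c / (4 * t 0 ^ 2) else 0 := by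
    intro a c
    rw [pderiv_div a (differentiableAt_const _) (by fun_prop) (by positivity), pderiv_const,
      pderiv_mul a (by fun_prop) (by fun_prop), pderiv_const, pderiv_proj]
    split_ifs
    · field_simp
      ring
    · simp
  have e01 : orbitModel ε t 0 1 = 0 := rfl
  have e00 : orbitModel ε t 0 0 = 1 / √(t 0) := rfl
  have hdet : (orbitModel ε t).det = ε / t 0 := by
    rw [orbitModel, Matrix.det_fin_two_of]
    field_simp
    rw [Real.sq_sqrt ht.le]
    ring
  have hε0 : ε ≠ 0 := by rintro rfl; norm_num at hε
  have hR : riemannCurv (orbitModel ε) 0 1 0 1 t = -ε / (4 * t 0 ^ 2) := by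
    simp only [riemannCurv, Fin.sum_univ_two, pderiv_congr _ (hev _ _ _), hp,
      (hev _ _ _).self_of_nhds]
    simp
    field_simp
    ring
  rw [gaussCurv, Fin.sum_univ_two, e01, e00, hdet, hR, Real.rpow_neg ht.le, rpow_three_halves ht]
  field_simp
  try ring

end Gauss

/-- Turns the first integrals found by differentiation into actual constants; this is one reason for
working over balls. -/
theorem eq_of_pderiv_eq_zero {n : ℕ} {B : Set (Fin n → ℝ)} (hB : IsOpen B) (hc : Convex ℝ B)
    {u : (Fin n → ℝ) → ℝ} (hu : ∀ x ∈ B, DifferentiableAt ℝ u x)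
    (h : ∀ x ∈ B, ∀ i, pderiv i u x = 0) {x y : Fin n → ℝ} (hx : x ∈ B) (hy : y ∈ B) :
    u x = u y := by
  refine hB.is_const_of_fderiv_eq_zero hc.isPreconnected
    (fun z hz => (hu z hz).differentiableWithinAt) (fun z hz => ?_) hx hy
  ext v
  simp [fderiv_eq_sum_pderiv, h z hz]

/-! ### The reduced soliton equations -/

/-- The equations satisfied over `B` by a reduced metric that is a steady soliton along a vertical
field `X` with `∂X³/∂z₁ = c`. -/
structure IsReducedSoliton (B : Set (Fin 2 → ℝ)) (ε c : ℝ) (E f h : (Fin 2 → ℝ) → ℝ) : Prop where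
  mixed : ∀ t ∈ B, pderiv 0 (pderiv 1 h) t =
    (pderiv 0 E t * pderiv 1 h t + pderiv 1 E t * pderiv 0 h t) / (2 * E t)
      + pderiv 0 h t * pderiv 1 h t / (2 * h t)
  diff : ∀ t ∈ B, pderiv 0 (pderiv 0 h) t - ε * pderiv 1 (pderiv 1 h) t =
    (pderiv 0 E t * pderiv 0 h t - ε * (pderiv 1 E t * pderiv 1 h t)) / E t
      + (pderiv 0 h t ^ 2 - ε * pderiv 1 h t ^ 2) / (2 * h t)
  laplacian : ∀ t ∈ B, pderiv 0 (pderiv 0 h) t + ε * pderiv 1 (pderiv 1 h) t = c * h t * E t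
  curvature : ∀ t ∈ B, pderiv 0 (pderiv 0 E) t + ε * pderiv 1 (pderiv 1 E) t =
    (pderiv 0 E t ^ 2 + ε * pderiv 1 E t ^ 2) / E t
      + E t * (pderiv 0 h t ^ 2 + ε * pderiv 1 h t ^ 2) / (2 * h t ^ 2) - c * E t ^ 2
  shift_fst : ∀ t ∈ B, pderiv 0 (pderiv 1 f) t * h t * E t + 2 * pderiv 1 f t * pderiv 0 h t * E t
    - pderiv 0 E t * pderiv 1 f t * h t = 0
  shift_snd : ∀ t ∈ B, pderiv 1 (pderiv 1 f) t * h t * E t + 2 * pderiv 1 f t * pderiv 1 h t * E t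
    - pderiv 1 E t * pderiv 1 f t * h t = 0

section Reduced

variable {B : Set (Fin 2 → ℝ)} {ε c : ℝ} {E f k h : (Fin 2 → ℝ) → ℝ}

theorem IsRedData.eq_one_or (H : IsRedData B ε E f k h) : ε = 1 ∨ ε = -1 :=
  mul_self_eq_one_iff.1 (by rw [← sq, H.sq_eq_one])

/-- The component `23` is the Laplace equation. The components `01` and `00 - ε 11` form the
trace-free part of the orbit block, `00 + ε 11` is its trace, which contains the Gauss curvature,
and `12` and `02` govern `f_{,t₂}`. The Laplace equation removes the second derivatives of `h` from
the trace and from `02`. -/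
theorem IsRedData.isReducedSoliton (H : IsRedData B ε E f k h)
    (hR : ∀ t ∈ B, ∃ x, tProj x = t ∧
      ricciCurv (redMetric ε E f k h) 0 0 x = 0 ∧ ricciCurv (redMetric ε E f k h) 0 1 x = 0 ∧
      ricciCurv (redMetric ε E f k h) 1 1 x = 0 ∧ ricciCurv (redMetric ε E f k h) 1 2 x = 0 ∧
      ricciCurv (redMetric ε E f k h) 0 2 x = -(1 / 2) * (c * h t * f t) ∧
      ricciCurv (redMetric ε E f k h) 2 3 x = -(1 / 2) * (c * h t)) :
    IsReducedSoliton B ε c E f h := by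
  have hε := H.sq_eq_one
  have lap : ∀ t ∈ B, pderiv 0 (pderiv 0 h) t + ε * pderiv 1 (pderiv 1 h) t = c * h t * E t := by
    intro t ht
    obtain ⟨x, hx, -, -, -, -, -, h23⟩ := hR t ht
    have hr := H.ricciCurv_redMetric hx ht
    have hE := H.E_ne_zero t ht
    rw [hr.2.2.2.2.2.2.2.2.2.2.2.1] at h23
    field_simp at h23
    linear_combination -h23
  refine ⟨?_, ?_, lap, ?_, ?_, ?_⟩ <;> intro t ht <;>
    obtain ⟨x, hx, h00, h01, h11, h12, h02, -⟩ := hR t ht <;>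
    have hr := H.ricciCurv_redMetric hx ht <;>
    have hE := H.E_ne_zero t ht <;> have hh := H.h_ne_zero t ht <;> have hl := lap t ht <;>
    rw [hr.1] at h00 <;> rw [hr.2.1] at h01 <;> rw [hr.2.2.2.2.2.1] at h11 <;>
    rw [hr.2.2.2.2.2.2.1] at h12 <;> rw [hr.2.2.1] at h02
  · linear_combination (norm := (field_simp; ring1)) (-h t) * h01
  · rcases H.eq_one_or with rfl | rfl
    · linear_combination (norm := (field_simp; ring1)) (-h t) * (h00 - h11)
    · linear_combination (norm := (field_simp; ring1)) (-h t) * (h00 + h11)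
  · rcases H.eq_one_or with rfl | rfl
    · linear_combination (norm := (field_simp; ring1)) (-E t) * (h00 + h11) - E t / h t * hl
    · linear_combination (norm := (field_simp; ring1)) (-E t) * (h00 - h11) - E t / h t * hl
  · linear_combination (norm := (field_simp; ring1)) 2 * E t ^ 2 * h12
  · rcases H.eq_one_or with rfl | rfl
    · linear_combination (norm := (field_simp; ring1)) (-2 * E t ^ 2) * h02 - E t * f t * hl
    · linear_combination (norm := (field_simp; ring1)) 2 * E t ^ 2 * h02 + E t * f t * hl

/-- The constant `c` vanishes. -/
theorem IsReducedSoliton.eq_zero (S : IsReducedSoliton B ε c E f h) (H : IsRedData B ε E f k h)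
    {t : Fin 2 → ℝ} (ht : t ∈ B) (ha : pderiv 0 h t ≠ 0) : c = 0 := by
  have hε := H.sq_eq_one
  have hE := H.E_ne_zero t ht
  have hh := H.h_ne_zero t ht
  obtain ⟨dE, -, -, dh, d⟩ := H.differentiableAt ht
  have dE' := fun a => (d a).1
  have dh' := fun a => (d a).2.2.2
  have hB := H.isOpen.mem_nhds ht
  have hE2 : 2 * E t ≠ 0 := by positivity
  have hh2 : 2 * h t ≠ 0 := by positivity
  have e01 : pderiv 0 (pderiv 1 h) =ᶠ[𝓝 t] _ := eventually_of_mem hB S.mixed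
  have e11 : pderiv 1 (pderiv 1 h) =ᶠ[𝓝 t] fun t => ε / 2 * (c * h t * E t -
      ((pderiv 0 E t * pderiv 0 h t - ε * (pderiv 1 E t * pderiv 1 h t)) / E t
      + (pderiv 0 h t ^ 2 - ε * pderiv 1 h t ^ 2) / (2 * h t))) := by
    filter_upwards [hB] with s hs
    -- The sum and difference equations are solved for the second derivative in `t₂`, using `ε² =
    -- 1`.
    linear_combination (-(1 / 2) * ε) * S.diff s hs + (1 / 2) * ε * S.laplacian s hs -
      pderiv 1 (pderiv 1 h) s * hε
  have L := pderiv_congr 1 e01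
  have R := pderiv_congr 0 e11
  -- All second derivatives of `h` are prescribed, so equality of mixed third derivatives is a
  -- compatibility condition. After elimination of second derivatives and use of the curvature
  -- equation it reads `c h_{,t₁} E = 0`.
  have comm : pderiv 1 (pderiv 0 (pderiv 1 h)) t = pderiv 0 (pderiv 1 (pderiv 1 h)) t :=
    pderiv_comm 1 0 (contDiffAt_pderiv 1 (H.contDiffAt_h ht))
  rw [comm, R] at L
  have cE := pderiv_comm 1 0 (H.contDiffAt_E ht)
  have ch := pderiv_comm 1 0 (H.contDiffAt_h ht)
  have h01 := S.mixed t ht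
  have h11 := e11.self_of_nhds
  have h00 : pderiv 0 (pderiv 0 h) t = 1 / 2 * (c * h t * E t +
      ((pderiv 0 E t * pderiv 0 h t - ε * (pderiv 1 E t * pderiv 1 h t)) / E t
      + (pderiv 0 h t ^ 2 - ε * pderiv 1 h t ^ 2) / (2 * h t))) := by
    linear_combination (1 / 2) * S.diff t ht + (1 / 2) * S.laplacian t ht
  have hK : pderiv 0 (pderiv 0 E) t = (pderiv 0 E t ^ 2 + ε * pderiv 1 E t ^ 2) / E t
      + E t * (pderiv 0 h t ^ 2 + ε * pderiv 1 h t ^ 2) / (2 * h t ^ 2) - c * E t ^ 2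
      - ε * pderiv 1 (pderiv 1 E) t := by
    linear_combination S.curvature t ht
  simp (disch := first | assumption | fun_prop (disch := assumption)) only [pderiv_add,
      pderiv_sub, pderiv_mul, pderiv_div, pderiv_pow, pderiv_const, cE, ch] at L
  rw [h01, h11, h00, hK] at L
  have key : c * (pderiv 0 h t * E t) = 0 := by
    rcases H.eq_one_or with rfl | rfl
    · linear_combination (norm := (field_simp; ring1)) 2 * L
    · linear_combination (norm := (field_simp; ring1)) (-2) * L
  exact (mul_eq_zero.1 key).resolve_right (mul_ne_zero ha hE)

/-- `(h₁² + ε h₂²)² / (E² h)` is constant. -/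
theorem IsReducedSoliton.exists_gradient_const (S : IsReducedSoliton B ε 0 E f h)
    (H : IsRedData B ε E f k h) (hc : Convex ℝ B) {t s : Fin 2 → ℝ} (ht : t ∈ B) (hs : s ∈ B) :
    ((pderiv 0 h t ^ 2 + ε * pderiv 1 h t ^ 2) / E t) ^ 2 / h t =
      ((pderiv 0 h s ^ 2 + ε * pderiv 1 h s ^ 2) / E s) ^ 2 / h s := by
  have hd : ∀ t ∈ B, DifferentiableAt ℝ
      (fun t => ((pderiv 0 h t ^ 2 + ε * pderiv 1 h t ^ 2) / E t) ^ 2 / h t) t := by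
    intro t ht
    obtain ⟨dE, -, -, dh, d⟩ := H.differentiableAt ht
    have dh' := fun a => (d a).2.2.2
    have hE := H.E_ne_zero t ht
    have hh := H.h_ne_zero t ht
    fun_prop (disch := assumption)
  -- For the orbit metric, `Hess h = (dh ⊗ dh - ½ |dh|² g̃) / (2h)`; contraction with the gradient
  -- gives `d|dh|² = |dh|² dh / (2h)`, so `|dh|⁴ / h` is constant.
  refine eq_of_pderiv_eq_zero H.isOpen hc hd ?_ ht hs
  intro t ht
  obtain ⟨dE, -, -, dh, d⟩ := H.differentiableAt ht
  have dh' := fun a => (d a).2.2.2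
  have hE := H.E_ne_zero t ht
  have hh := H.h_ne_zero t ht
  have h01 := S.mixed t ht
  have h10 := (pderiv_comm 1 0 (H.contDiffAt_h ht)).trans h01
  have hε := H.sq_eq_one
  have h11 : pderiv 1 (pderiv 1 h) t = ε / 2 * (-
      ((pderiv 0 E t * pderiv 0 h t - ε * (pderiv 1 E t * pderiv 1 h t)) / E t
      + (pderiv 0 h t ^ 2 - ε * pderiv 1 h t ^ 2) / (2 * h t))) := by
    linear_combination (-(1 / 2) * ε) * S.diff t ht + (1 / 2) * ε * S.laplacian t ht -
      pderiv 1 (pderiv 1 h) t * hε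
  have h00 : pderiv 0 (pderiv 0 h) t = 1 / 2 * (
      ((pderiv 0 E t * pderiv 0 h t - ε * (pderiv 1 E t * pderiv 1 h t)) / E t
      + (pderiv 0 h t ^ 2 - ε * pderiv 1 h t ^ 2) / (2 * h t))) := by
    linear_combination (1 / 2) * S.diff t ht + (1 / 2) * S.laplacian t ht
  refine Fin.forall_fin_two.2 ⟨?_, ?_⟩ <;>
    simp (disch := first | assumption | fun_prop (disch := assumption)) only [pderiv_add,
      pderiv_mul, pderiv_div, pderiv_pow, pderiv_const, h00, h01, h10, h11]
  all_goals
    push_cast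
    rcases H.eq_one_or with rfl | rfl <;> field_simp <;> ring

/-- `h² f₂ / E` is constant. -/
theorem IsReducedSoliton.exists_shift_const (S : IsReducedSoliton B ε c E f h)
    (H : IsRedData B ε E f k h) (hc : Convex ℝ B) {t s : Fin 2 → ℝ} (ht : t ∈ B) (hs : s ∈ B) :
    h t ^ 2 * pderiv 1 f t / E t = h s ^ 2 * pderiv 1 f s / E s := by
  have hd : ∀ t ∈ B, DifferentiableAt ℝ (fun t => h t ^ 2 * pderiv 1 f t / E t) t := by
    intro t ht
    obtain ⟨dE, -, -, dh, d⟩ := H.differentiableAt ht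
    have df' := fun a => (d a).2.1
    have hE := H.E_ne_zero t ht
    fun_prop (disch := assumption)
  -- The two shift equations are the partial derivatives of this quantity with denominators cleared.
  refine eq_of_pderiv_eq_zero H.isOpen hc hd ?_ ht hs
  intro t ht
  obtain ⟨dE, -, -, dh, d⟩ := H.differentiableAt ht
  have df' := fun a => (d a).2.1
  have hE := H.E_ne_zero t ht
  refine Fin.forall_fin_two.2 ⟨?_, ?_⟩ <;>
    simp (disch := first | assumption | fun_prop (disch := assumption)) only [
      pderiv_mul, pderiv_div, pderiv_pow]
  · linear_combination (norm := (field_simp; push_cast; ring1)) h t / E t ^ 2 * S.shift_fst t ht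
  · linear_combination (norm := (field_simp; push_cast; ring1)) h t / E t ^ 2 * S.shift_snd t ht

end Reduced

/-! ### Components in a chart -/

section Composition

variable {M N K : Type*} [TopologicalSpace M] [TopologicalSpace N] [TopologicalSpace K]
  {e : OpenPartialHomeomorph M N} {φ : OpenPartialHomeomorph N K}

theorem trans_symm_apply {x : N} (hx : x ∈ φ.source) : (e ≫ₕ φ).symm (φ x) = e.symm x := by
  simp [φ.left_inv hx]

theorem mem_trans_target {x : N} (hx : x ∈ e.target) (hx' : x ∈ φ.source) :
    φ x ∈ (e ≫ₕ φ).target := by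
  rw [OpenPartialHomeomorph.trans_target]
  exact ⟨φ.map_source hx', by simpa [φ.left_inv hx'] using hx⟩

theorem exists_eq_of_mem_trans_target {y : K} (hy : y ∈ (e ≫ₕ φ).target) :
    ∃ x ∈ e.target, x ∈ φ.source ∧ φ x = y := by
  rw [OpenPartialHomeomorph.trans_target] at hy
  exact ⟨φ.symm y, hy.2, φ.map_target hy.1, φ.right_inv hy.1⟩

end Composition

section Charts

variable {n : ℕ} {M : Type*} [TopologicalSpace M] [ChartedSpace (Fin n → ℝ) M]
  {e : OpenPartialHomeomorph M (Fin n → ℝ)} {x : Fin n → ℝ}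

theorem mdifferentiable_of_mem_maximalAtlas
    (he : e ∈ IsManifold.maximalAtlas 𝓘(ℝ, Fin n → ℝ) ∞ M) :
    e.MDifferentiable 𝓘(ℝ, Fin n → ℝ) 𝓘(ℝ, Fin n → ℝ) :=
  ⟨(contMDiffOn_of_mem_maximalAtlas he).mdifferentiableOn (by simp),
    (contMDiffOn_symm_of_mem_maximalAtlas he).mdifferentiableOn (by simp)⟩

/-- The derivative of the inverse of a chart sends components to tangent vectors. -/
noncomputable def ofCoeff (e : OpenPartialHomeomorph M (Fin n → ℝ)) (x : Fin n → ℝ) :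
    (Fin n → ℝ) →L[ℝ] TangentSpace 𝓘(ℝ, Fin n → ℝ) (e.symm x) :=
  mfderiv 𝓘(ℝ, Fin n → ℝ) 𝓘(ℝ, Fin n → ℝ) e.symm x

/-- The derivative of a chart sends tangent vectors to components. -/
noncomputable def toCoeff (e : OpenPartialHomeomorph M (Fin n → ℝ)) (x : Fin n → ℝ) :
    TangentSpace 𝓘(ℝ, Fin n → ℝ) (e.symm x) →L[ℝ] (Fin n → ℝ) :=
  mfderiv 𝓘(ℝ, Fin n → ℝ) 𝓘(ℝ, Fin n → ℝ) e (e.symm x)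

theorem fieldCoeff_eq (X : VField n M) : fieldCoeff X e x = toCoeff e x (X (e.symm x)) := rfl

theorem toCoeff_ofCoeff (he : e ∈ IsManifold.maximalAtlas 𝓘(ℝ, Fin n → ℝ) ∞ M)
    (hx : x ∈ e.target) (v : Fin n → ℝ) : toCoeff e x (ofCoeff e x v) = v :=
  DFunLike.congr_fun ((mdifferentiable_of_mem_maximalAtlas he).comp_symm_deriv hx) v

/-- The derivative of a chart is injective, so its right inverse is also a left inverse. -/
theorem ofCoeff_toCoeff (he : e ∈ IsManifold.maximalAtlas 𝓘(ℝ, Fin n → ℝ) ∞ M)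
    (hx : x ∈ e.target) (v : TangentSpace 𝓘(ℝ, Fin n → ℝ) (e.symm x)) :
    ofCoeff e x (toCoeff e x v) = v :=
  (mdifferentiable_of_mem_maximalAtlas he).mfderiv_injective (e.map_target hx)
    (toCoeff_ofCoeff he hx (toCoeff e x v))

theorem ofCoeff_fieldCoeff (he : e ∈ IsManifold.maximalAtlas 𝓘(ℝ, Fin n → ℝ) ∞ M)
    (hx : x ∈ e.target) (X : VField n M) : ofCoeff e x (fieldCoeff X e x) = X (e.symm x) :=
  ofCoeff_toCoeff he hx _

variable [IsManifold 𝓘(ℝ, Fin n → ℝ) ∞ M]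

/-- The metric in terms of components. -/
theorem val_ofCoeff (g : PseudoRiemannianMetric n M) (v w : Fin n → ℝ) :
    g.val (e.symm x) (ofCoeff e x v) (ofCoeff e x w) =
      ∑ a, ∑ b, v a * w b * metricCoeff g e x a b := by
  have hv : ∀ v : Fin n → ℝ, ofCoeff e x v = ∑ a, v a • coordField e a x := by
    intro v
    conv_lhs => rw [pi_eq_sum_univ' v]
    simp only [map_sum, map_smul]
    rfl
  rw [hv v, hv w]
  simp only [map_sum, map_smul, sum_apply, smul_apply, smul_eq_mul, metricCoeff, Matrix.of_apply,
    Finset.mul_sum]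
  rw [Finset.sum_comm]
  refine Finset.sum_congr rfl fun a _ => Finset.sum_congr rfl fun b _ => ?_
  ring

/-- Viewing components as a pullback along `e.symm` makes smoothness of pullbacks and naturality of
the Lie bracket available for them. -/
theorem mpullback_symm_eq (he : e ∈ IsManifold.maximalAtlas 𝓘(ℝ, Fin n → ℝ) ∞ M)
    (hx : x ∈ e.target) (X : VField n M) :
    VectorField.mpullback 𝓘(ℝ, Fin n → ℝ) 𝓘(ℝ, Fin n → ℝ) e.symm X x = fieldCoeff X e x := by
  have : (ofCoeff e x).inverse = toCoeff e x :=
    ContinuousLinearMap.inverse_eq (ContinuousLinearMap.ext (ofCoeff_toCoeff he hx))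
      (ContinuousLinearMap.ext (toCoeff_ofCoeff he hx))
  exact DFunLike.congr_fun this (X (e.symm x))

theorem isInvertible_ofCoeff (he : e ∈ IsManifold.maximalAtlas 𝓘(ℝ, Fin n → ℝ) ∞ M)
    (hx : x ∈ e.target) : (ofCoeff e x).IsInvertible :=
  ContinuousLinearMap.IsInvertible.of_inverse
    (ContinuousLinearMap.ext (ofCoeff_toCoeff he hx))
    (ContinuousLinearMap.ext (toCoeff_ofCoeff he hx))

theorem contDiffAt_fieldCoeff (he : e ∈ IsManifold.maximalAtlas 𝓘(ℝ, Fin n → ℝ) ∞ M)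
    (hx : x ∈ e.target) {X : VField n M} (hX : SmoothFieldAt X (e.symm x)) :
    ContDiffAt ℝ ∞ (fieldCoeff X e) x := by
  have h := ContMDiffAt.mpullback_vectorField_preimage (m := ∞) (n := ∞) hX
    (contMDiffAt_symm_of_mem_maximalAtlas he hx) (isInvertible_ofCoeff he hx) (by simp)
  refine (contMDiffAt_vectorSpace_iff_contDiffAt.1 h).congr_of_eventuallyEq ?_
  filter_upwards [e.open_target.mem_nhds hx] with y hy
  exact (mpullback_symm_eq he hy X).symm

/-- The Lie bracket in a chart. -/
theorem fieldCoeff_mlieBracket (he : e ∈ IsManifold.maximalAtlas 𝓘(ℝ, Fin n → ℝ) ∞ M)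
    (hx : x ∈ e.target) {X Y : VField n M} (hX : SmoothFieldAt X (e.symm x))
    (hY : SmoothFieldAt Y (e.symm x)) :
    fieldCoeff (VectorField.mlieBracket 𝓘(ℝ, Fin n → ℝ) X Y) e x =
      VectorField.lieBracket ℝ (fieldCoeff X e) (fieldCoeff Y e) x := by
  have hle : minSmoothness ℝ 2 ≤ (∞ : WithTop ℕ∞) := by
    rw [minSmoothness_of_isRCLikeNormedField]
    exact WithTop.coe_le_coe.2 le_top
  have : IsManifold 𝓘(ℝ, Fin n → ℝ) (minSmoothness ℝ 2) M := IsManifold.of_le hle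
  have : IsManifold 𝓘(ℝ, Fin n → ℝ) (minSmoothness ℝ 2) (Fin n → ℝ) := inferInstance
  rw [← mpullback_symm_eq he hx, VectorField.mpullback_mlieBracket (n := ∞)
    (hX.mdifferentiableAt (by simp)) (hY.mdifferentiableAt (by simp))
    (contMDiffAt_symm_of_mem_maximalAtlas he hx) hle]
  have h : ∀ Z : VField n M,
      VectorField.mpullback 𝓘(ℝ, Fin n → ℝ) 𝓘(ℝ, Fin n → ℝ) e.symm Z =ᶠ[𝓝 x] fieldCoeff Z e := by
    intro Z
    filter_upwards [e.open_target.mem_nhds hx] with y hy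
    exact mpullback_symm_eq he hy Z
  have hb : ∀ V W : (y : Fin n → ℝ) → TangentSpace 𝓘(ℝ, Fin n → ℝ) y,
      VectorField.mlieBracket 𝓘(ℝ, Fin n → ℝ) V W x = VectorField.lieBracket ℝ V W x := by
    intro V W
    rw [← VectorField.mlieBracketWithin_univ, VectorField.mlieBracketWithin_eq_lieBracketWithin]
    exact congrFun VectorField.lieBracketWithin_univ x
  rw [(h X).mlieBracket_vectorField_eq (h Y)]
  exact hb _ _

/-- The vector field with given components in a chart. -/
noncomputable def fieldOfCoeff (e : OpenPartialHomeomorph M (Fin n → ℝ))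
    (u : (Fin n → ℝ) → (Fin n → ℝ)) : VField n M :=
  VectorField.mpullback 𝓘(ℝ, Fin n → ℝ) 𝓘(ℝ, Fin n → ℝ) e u

theorem isInvertible_toCoeff (he : e ∈ IsManifold.maximalAtlas 𝓘(ℝ, Fin n → ℝ) ∞ M)
    (hx : x ∈ e.target) : (toCoeff e x).IsInvertible :=
  ContinuousLinearMap.IsInvertible.of_inverse
    (ContinuousLinearMap.ext (toCoeff_ofCoeff he hx))
    (ContinuousLinearMap.ext (ofCoeff_toCoeff he hx))

theorem fieldCoeff_fieldOfCoeff (he : e ∈ IsManifold.maximalAtlas 𝓘(ℝ, Fin n → ℝ) ∞ M)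
    (hx : x ∈ e.target) (u : (Fin n → ℝ) → (Fin n → ℝ)) :
    fieldCoeff (fieldOfCoeff e u) e x = u x := by
  have h : (toCoeff e x).inverse = ofCoeff e x :=
    ContinuousLinearMap.inverse_eq (ContinuousLinearMap.ext (toCoeff_ofCoeff he hx))
      (ContinuousLinearMap.ext (ofCoeff_toCoeff he hx))
  have h' : fieldCoeff (fieldOfCoeff e u) e x =
      toCoeff e x ((toCoeff e x).inverse (u (e (e.symm x)))) := rfl
  rw [h', h, toCoeff_ofCoeff he hx, e.right_inv hx]

theorem smoothFieldAt_fieldOfCoeff (he : e ∈ IsManifold.maximalAtlas 𝓘(ℝ, Fin n → ℝ) ∞ M)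
    (hx : x ∈ e.target) {u : (Fin n → ℝ) → (Fin n → ℝ)} (hu : ContDiffAt ℝ ∞ u x) :
    SmoothFieldAt (fieldOfCoeff e u) (e.symm x) := by
  refine ContMDiffAt.mpullback_vectorField_preimage (m := ∞) (n := ∞) ?_
    (contMDiffAt_of_mem_maximalAtlas he (e.map_target hx)) (isInvertible_toCoeff he hx) (by simp)
  rw [e.right_inv hx]
  exact contMDiffAt_vectorSpace_iff_contDiffAt.2 hu

/-! ### Change of coordinates -/

variable {φ : OpenPartialHomeomorph (Fin n → ℝ) (Fin n → ℝ)}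

theorem trans_mem_maximalAtlas (he : e ∈ IsManifold.maximalAtlas 𝓘(ℝ, Fin n → ℝ) ∞ M)
    (hφ : ContDiffOn ℝ ∞ φ φ.source) (hφ' : ContDiffOn ℝ ∞ φ.symm φ.target) :
    e ≫ₕ φ ∈ IsManifold.maximalAtlas 𝓘(ℝ, Fin n → ℝ) ∞ M := by
  refine (IsManifold.mem_maximalAtlas_iff_contMDiffOn _).2 ⟨?_, ?_⟩
  · refine hφ.contMDiffOn.comp ((contMDiffOn_of_mem_maximalAtlas he).mono ?_) ?_ <;>
      intro p hp <;> simp only [mfld_simps] at hp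
    exacts [hp.1, hp.2]
  · refine (contMDiffOn_symm_of_mem_maximalAtlas he).comp (hφ'.contMDiffOn.mono ?_) ?_ <;>
      intro p hp <;> simp only [mfld_simps] at hp
    exacts [hp.1, hp.2]

/-- Tangent spaces at all points are definitionally `Fin n → ℝ`, so the vectors can stay fixed while
the base point is replaced by an equal one. -/
theorem val_congr (g : PseudoRiemannianMetric n M) {p q : M} (h : p = q) (v w : Fin n → ℝ) :
    g.val p v w = g.val q v w := by
  subst h
  rfl

/-- Chain rule for `e.symm = (e ≫ₕ φ).symm ∘ φ` near `x`. The two sides are based at points that are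
only propositionally equal, hence the comparison in `Fin n → ℝ`. -/
theorem ofCoeff_trans (he : e ∈ IsManifold.maximalAtlas 𝓘(ℝ, Fin n → ℝ) ∞ M)
    (hφ : ContDiffOn ℝ ∞ φ φ.source) (hφ' : ContDiffOn ℝ ∞ φ.symm φ.target)
    (hx : x ∈ e.target) (hx' : x ∈ φ.source) (v : Fin n → ℝ) :
    (ofCoeff e x v : Fin n → ℝ) = ofCoeff (e ≫ₕ φ) (φ x) (fderiv ℝ φ x v) := by
  have he' := mdifferentiable_of_mem_maximalAtlas (trans_mem_maximalAtlas he hφ hφ')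
  have h1 : MDifferentiableAt 𝓘(ℝ, Fin n → ℝ) 𝓘(ℝ, Fin n → ℝ) φ x :=
    ((hφ.contDiffAt (φ.open_source.mem_nhds hx')).differentiableAt (by simp)).mdifferentiableAt
  have h2 := (he'.mdifferentiableAt_symm (mem_trans_target hx hx')).hasMFDerivAt.comp x
    h1.hasMFDerivAt
  have h3 : e.symm =ᶠ[𝓝 x] (e ≫ₕ φ).symm ∘ φ := by
    filter_upwards [φ.open_source.mem_nhds hx'] with y hy
    exact (trans_symm_apply hy).symm
  have h4 := (h2.congr_of_eventuallyEq h3).mfderiv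
  rw [mfderiv_eq_fderiv] at h4
  exact DFunLike.congr_fun h4 v

theorem toCoeff_trans (he : e ∈ IsManifold.maximalAtlas 𝓘(ℝ, Fin n → ℝ) ∞ M)
    (hφ : ContDiffOn ℝ ∞ φ φ.source) (hφ' : ContDiffOn ℝ ∞ φ.symm φ.target)
    (hx : x ∈ e.target) (hx' : x ∈ φ.source) (X : VField n M) :
    fieldCoeff X (e ≫ₕ φ) (φ x) = fderiv ℝ φ x (fieldCoeff X e x) := by
  have he' := trans_mem_maximalAtlas he hφ hφ'
  have hXe : (X (e.symm x) : Fin n → ℝ) = X ((e ≫ₕ φ).symm (φ x)) := by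
    rw [trans_symm_apply hx']
  have h1 := ofCoeff_fieldCoeff he hx X
  have h2 := ofCoeff_trans he hφ hφ' hx hx' (fieldCoeff X e x)
  have h3 : ofCoeff (e ≫ₕ φ) (φ x) (fderiv ℝ φ x (fieldCoeff X e x)) =
      X ((e ≫ₕ φ).symm (φ x)) := h2.symm.trans (h1.trans hXe)
  rw [fieldCoeff_eq, ← h3, toCoeff_ofCoeff he' (mem_trans_target hx hx')]

/-- The components of the metric under a change of coordinates. -/
theorem metricCoeff_trans (g : PseudoRiemannianMetric n M)
    (he : e ∈ IsManifold.maximalAtlas 𝓘(ℝ, Fin n → ℝ) ∞ M)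
    (hφ : ContDiffOn ℝ ∞ φ φ.source) (hφ' : ContDiffOn ℝ ∞ φ.symm φ.target)
    (hx : x ∈ e.target) (hx' : x ∈ φ.source) {J : Matrix (Fin n) (Fin n) ℝ}
    (hJ : ∀ a i, fderiv ℝ φ x (Pi.single i 1) a = J a i) :
    metricCoeff g e x = J.transpose * metricCoeff g (e ≫ₕ φ) (φ x) * J := by
  ext i j
  have h : metricCoeff g e x i j =
      g.val (e.symm x) (ofCoeff e x (Pi.single i 1)) (ofCoeff e x (Pi.single j 1)) := rfl
  have h1 := ofCoeff_trans he hφ hφ' hx hx'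
  have h2 : metricCoeff g e x i j = g.val ((e ≫ₕ φ).symm (φ x))
      (ofCoeff (e ≫ₕ φ) (φ x) (fderiv ℝ φ x (Pi.single i 1)))
      (ofCoeff (e ≫ₕ φ) (φ x) (fderiv ℝ φ x (Pi.single j 1))) := by
    rw [h, ← h1, ← h1]
    exact val_congr g (trans_symm_apply hx').symm _ _
  rw [h2, val_ofCoeff]
  simp only [hJ, Matrix.mul_apply, Matrix.transpose_apply, Finset.sum_mul]
  rw [Finset.sum_comm]
  refine Finset.sum_congr rfl fun b _ => Finset.sum_congr rfl fun a _ => ?_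
  ring

theorem apply_eq_sum_single {m : ℕ} (L : (Fin n → ℝ) →L[ℝ] (Fin m → ℝ)) (v : Fin n → ℝ)
    (a : Fin m) : L v a = ∑ i, v i * L (Pi.single i 1) a := by
  conv_lhs => rw [pi_eq_sum_univ' v]
  simp [map_sum]

theorem exists_jacobian_inverse (hφ : ContDiffOn ℝ ∞ φ φ.source)
    (hφ' : ContDiffOn ℝ ∞ φ.symm φ.target) (hx' : x ∈ φ.source) {J : Matrix (Fin n) (Fin n) ℝ}
    (hJ : ∀ a i, fderiv ℝ φ x (Pi.single i 1) a = J a i) :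
    ∃ K : Matrix (Fin n) (Fin n) ℝ, J * K = 1 := by
  have h1 : HasFDerivAt φ (fderiv ℝ φ x) x :=
    ((hφ.contDiffAt (φ.open_source.mem_nhds hx')).differentiableAt (by simp)).hasFDerivAt
  have h2 : HasFDerivAt φ.symm (fderiv ℝ φ.symm (φ x)) (φ x) :=
    ((hφ'.contDiffAt (φ.open_target.mem_nhds (φ.map_source hx'))).differentiableAt
      (by simp)).hasFDerivAt
  have h3 : (fderiv ℝ φ x).comp (fderiv ℝ φ.symm (φ x)) = ContinuousLinearMap.id ℝ _ := by
    rw [← φ.left_inv hx'] at h1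
    have h4 := HasFDerivAt.comp (φ x) h1 h2
    rw [φ.left_inv hx'] at h4
    refine (h4.congr_of_eventuallyEq ?_).unique (hasFDerivAt_id (φ x))
    filter_upwards [φ.open_target.mem_nhds (φ.map_source hx')] with y hy
    exact (φ.right_inv hy).symm
  refine ⟨Matrix.of fun a i => fderiv ℝ φ.symm (φ x) (Pi.single i 1) a, ?_⟩
  ext a i
  have h5 := congrFun (DFunLike.congr_fun h3 (Pi.single i (1 : ℝ))) a
  rw [ContinuousLinearMap.comp_apply, apply_eq_sum_single] at h5
  simpa [Matrix.mul_apply, hJ, Matrix.one_apply, Pi.single_apply, mul_comm] using h5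

/-- Invertibility of the Jacobian allows a guessed metric in the new chart to be verified by pulling
it back to the old one. -/
theorem metricCoeff_trans_eq (g : PseudoRiemannianMetric n M)
    (he : e ∈ IsManifold.maximalAtlas 𝓘(ℝ, Fin n → ℝ) ∞ M)
    (hφ : ContDiffOn ℝ ∞ φ φ.source) (hφ' : ContDiffOn ℝ ∞ φ.symm φ.target)
    (hx : x ∈ e.target) (hx' : x ∈ φ.source) {J : Matrix (Fin n) (Fin n) ℝ}
    (hJ : ∀ a i, fderiv ℝ φ x (Pi.single i 1) a = J a i) {G : Matrix (Fin n) (Fin n) ℝ}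
    (hG : metricCoeff g e x = J.transpose * G * J) : metricCoeff g (e ≫ₕ φ) (φ x) = G := by
  obtain ⟨K, hK⟩ := exists_jacobian_inverse hφ hφ' hx' hJ
  have hK' : K.transpose * J.transpose = 1 := by
    rw [← Matrix.transpose_mul, hK, Matrix.transpose_one]
  have key : ∀ A : Matrix (Fin n) (Fin n) ℝ,
      K.transpose * (J.transpose * A * J) * K = A := fun A => by
    rw [Matrix.mul_assoc J.transpose, ← Matrix.mul_assoc, hK', Matrix.one_mul, Matrix.mul_assoc,
      hK, Matrix.mul_one]
  rw [← key G, ← hG, metricCoeff_trans g he hφ hφ' hx hx' hJ, key]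

end Charts

/-! ### Coordinate changes compatible with adapted coordinates -/

/-- The point with coordinates `(t₁, t₂, z₁, z₂)`. -/
def mkPoint (t : Fin 2 → ℝ) (a b : ℝ) : Fin 4 → ℝ := ![t 0, t 1, a, b]

theorem tProj_mkPoint (t : Fin 2 → ℝ) (a b : ℝ) : tProj (mkPoint t a b) = t := by
  ext i
  fin_cases i <;> rfl

theorem mkPoint_tProj (x : Fin 4 → ℝ) : mkPoint (tProj x) (x 2) (x 3) = x := by
  ext i
  fin_cases i <;> rfl

theorem contDiffOn_mkPoint {n : WithTop ℕ∞} {s : Set (Fin 4 → ℝ)} {u : (Fin 4 → ℝ) → (Fin 2 → ℝ)}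
    {a b : (Fin 4 → ℝ) → ℝ} (hu : ContDiffOn ℝ n u s) (ha : ContDiffOn ℝ n a s)
    (hb : ContDiffOn ℝ n b s) : ContDiffOn ℝ n (fun x => mkPoint (u x) (a x) (b x)) s := by
  rw [contDiffOn_pi] at hu ⊢
  exact forall_fin_four (hu 0) (hu 1) ha hb

/-- Balls of the supremum norm are cubes, so the projection keeps the radius, and the orbit domain
is again open and convex. -/
theorem tProj_image_ball (x : Fin 4 → ℝ) {r : ℝ} (hr : 0 < r) :
    tProj '' Metric.ball x r = Metric.ball (tProj x) r := by
  ext t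
  constructor
  · rintro ⟨y, hy, rfl⟩
    rw [Metric.mem_ball, dist_pi_lt_iff hr] at hy ⊢
    exact fun i => hy (tIdx i)
  · intro ht
    refine ⟨mkPoint t (x 2) (x 3), ?_, tProj_mkPoint ..⟩
    rw [Metric.mem_ball, dist_pi_lt_iff hr] at ht ⊢
    exact forall_fin_four (ht 0) (ht 1) (by simpa [mkPoint] using hr) (by simpa [mkPoint] using hr)

theorem contDiff_tProj {n : WithTop ℕ∞} : ContDiff ℝ n tProj := tProjL.contDiff

section Shear

variable {τ : OpenPartialHomeomorph (Fin 2 → ℝ) (Fin 2 → ℝ)} {F G : (Fin 2 → ℝ) → ℝ}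

theorem contDiffOn_shear (r s : ℝ) (hτ : ContDiffOn ℝ ∞ τ τ.source)
    (hF : ContDiffOn ℝ ∞ F τ.source) (hG : ContDiffOn ℝ ∞ G τ.source) :
    ContDiffOn ℝ ∞ (fun x => mkPoint (τ (tProj x)) (r * x 2 + F (tProj x)) (s * x 3 + G (tProj x)))
      (tProj ⁻¹' τ.source) := by
  have ht : ContDiffOn ℝ ∞ tProj (tProj ⁻¹' τ.source) := contDiff_tProj.contDiffOn
  have hm : MapsTo tProj (tProj ⁻¹' τ.source) τ.source := fun _ hx => hx
  have hc : ∀ i : Fin 4, ContDiffOn ℝ ∞ (fun x : Fin 4 → ℝ => x i) (tProj ⁻¹' τ.source) :=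
    fun i => (contDiff_apply ..).contDiffOn
  exact contDiffOn_mkPoint (hτ.comp ht hm) ((contDiffOn_const.mul (hc 2)).add (hF.comp ht hm))
    ((contDiffOn_const.mul (hc 3)).add (hG.comp ht hm))

theorem contDiffOn_shear_symm (r s : ℝ) (hτ' : ContDiffOn ℝ ∞ τ.symm τ.target)
    (hF : ContDiffOn ℝ ∞ F τ.source) (hG : ContDiffOn ℝ ∞ G τ.source) :
    ContDiffOn ℝ ∞ (fun y => mkPoint (τ.symm (tProj y)) ((y 2 - F (τ.symm (tProj y))) / r)
      ((y 3 - G (τ.symm (tProj y))) / s)) (tProj ⁻¹' τ.target) := by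
  have ht : ContDiffOn ℝ ∞ tProj (tProj ⁻¹' τ.target) := contDiff_tProj.contDiffOn
  have hm : MapsTo tProj (tProj ⁻¹' τ.target) τ.target := fun _ hx => hx
  have hs : ContDiffOn ℝ ∞ (fun y => τ.symm (tProj y)) (tProj ⁻¹' τ.target) := hτ'.comp ht hm
  have hm' : MapsTo (fun y => τ.symm (tProj y)) (tProj ⁻¹' τ.target) τ.source :=
    fun _ hx => τ.map_target hx
  have hc : ∀ i : Fin 4, ContDiffOn ℝ ∞ (fun x : Fin 4 → ℝ => x i) (tProj ⁻¹' τ.target) :=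
    fun i => (contDiff_apply ..).contDiffOn
  exact contDiffOn_mkPoint hs (((hc 2).sub (hF.comp hs hm')).div_const r)
    (((hc 3).sub (hG.comp hs hm')).div_const s)

/-- The coordinate change `(t, z₁, z₂) ↦ (τ(t), r z₁ + F(t), s z₂ + G(t))`. -/
noncomputable def shear {r s : ℝ} (hr : r ≠ 0) (hs : s ≠ 0) (hτ : ContDiffOn ℝ ∞ τ τ.source)
    (hτ' : ContDiffOn ℝ ∞ τ.symm τ.target) (hF : ContDiffOn ℝ ∞ F τ.source)
    (hG : ContDiffOn ℝ ∞ G τ.source) : OpenPartialHomeomorph (Fin 4 → ℝ) (Fin 4 → ℝ) where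
  toFun x := mkPoint (τ (tProj x)) (r * x 2 + F (tProj x)) (s * x 3 + G (tProj x))
  invFun y := mkPoint (τ.symm (tProj y)) ((y 2 - F (τ.symm (tProj y))) / r)
    ((y 3 - G (τ.symm (tProj y))) / s)
  source := tProj ⁻¹' τ.source
  target := tProj ⁻¹' τ.target
  map_source' x hx := by
    rw [mem_preimage, tProj_mkPoint]
    exact τ.map_source hx
  map_target' y hy := by
    rw [mem_preimage, tProj_mkPoint]
    exact τ.map_target hy
  left_inv' x hx := by
    simp only [tProj_mkPoint, τ.left_inv hx]
    conv_rhs => rw [← mkPoint_tProj x]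
    congr 1 <;> simp only [mkPoint, Matrix.cons_val] <;> field_simp <;> ring
  right_inv' y hy := by
    simp only [tProj_mkPoint, τ.right_inv hy]
    conv_rhs => rw [← mkPoint_tProj y]
    congr 1 <;> simp only [mkPoint, Matrix.cons_val] <;> field_simp <;> ring
  open_source := τ.open_source.preimage continuous_tProj
  open_target := τ.open_target.preimage continuous_tProj
  continuousOn_toFun := (contDiffOn_shear r s hτ hF hG).continuousOn
  continuousOn_invFun := (contDiffOn_shear_symm r s hτ' hF hG).continuousOn

variable {r s : ℝ} (hr : r ≠ 0) (hs : s ≠ 0) (hτ : ContDiffOn ℝ ∞ τ τ.source)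
  (hτ' : ContDiffOn ℝ ∞ τ.symm τ.target) (hF : ContDiffOn ℝ ∞ F τ.source)
  (hG : ContDiffOn ℝ ∞ G τ.source)

theorem shear_apply (x : Fin 4 → ℝ) : shear hr hs hτ hτ' hF hG x =
    mkPoint (τ (tProj x)) (r * x 2 + F (tProj x)) (s * x 3 + G (tProj x)) := rfl

theorem shear_contDiffOn : ContDiffOn ℝ ∞ (shear hr hs hτ hτ' hF hG)
    (shear hr hs hτ hτ' hF hG).source :=
  contDiffOn_shear r s hτ hF hG

theorem shear_symm_contDiffOn : ContDiffOn ℝ ∞ (shear hr hs hτ hτ' hF hG).symm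
    (shear hr hs hτ hτ' hF hG).target :=
  contDiffOn_shear_symm r s hτ' hF hG

/-- The Jacobian matrix of a shear. -/
noncomputable def shearJacobian (τ : OpenPartialHomeomorph (Fin 2 → ℝ) (Fin 2 → ℝ)) (r s : ℝ)
    (F G : (Fin 2 → ℝ) → ℝ) (t : Fin 2 → ℝ) : Matrix (Fin 4) (Fin 4) ℝ :=
  !![pderiv 0 (fun t => τ t 0) t, pderiv 1 (fun t => τ t 0) t, 0, 0;
     pderiv 0 (fun t => τ t 1) t, pderiv 1 (fun t => τ t 1) t, 0, 0;
     pderiv 0 F t, pderiv 1 F t, r, 0;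
     pderiv 0 G t, pderiv 1 G t, 0, s]

theorem fderiv_shear {x : Fin 4 → ℝ} (hx : tProj x ∈ τ.source) (a i : Fin 4) :
    fderiv ℝ (shear hr hs hτ hτ' hF hG) x (Pi.single i 1) a =
      shearJacobian τ r s F G (tProj x) a i := by
  have hn := τ.open_source.mem_nhds hx
  have hnz : (∞ : WithTop ℕ∞) ≠ 0 := by simp
  have hd := ((shear_contDiffOn hr hs hτ hτ' hF hG).contDiffAt
    ((shear hr hs hτ hτ' hF hG).open_source.mem_nhds hx)).differentiableAt hnz
  have dτ := fun a => differentiableAt_pi.1 ((hτ.contDiffAt hn).differentiableAt hnz) a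
  have dF := (hF.contDiffAt hn).differentiableAt hnz
  have dG := (hG.contDiffAt hn).differentiableAt hnz
  have dx : ∀ i : Fin 4, DifferentiableAt ℝ (fun y : Fin 4 → ℝ => y i) x := fun i => by fun_prop
  have dF' : DifferentiableAt ℝ (fun y => F (tProj y)) x := dF.comp x tProjL.differentiableAt
  have dG' : DifferentiableAt ℝ (fun y => G (tProj y)) x := dG.comp x tProjL.differentiableAt
  have h1 : fderiv ℝ (shear hr hs hτ hτ' hF hG) x (Pi.single i 1) a =
      pderiv i (fun y => shear hr hs hτ hτ' hF hG y a) x := by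
    rw [pderiv, (hasFDerivAt_pi'.1 hd.hasFDerivAt a).fderiv]
    rfl
  rw [h1]
  have e0 : (fun y => shear hr hs hτ hτ' hF hG y 0) = fun y => τ (tProj y) 0 := rfl
  have e1 : (fun y => shear hr hs hτ hτ' hF hG y 1) = fun y => τ (tProj y) 1 := rfl
  have e2 : (fun y => shear hr hs hτ hτ' hF hG y 2) = fun y => r * y 2 + F (tProj y) := rfl
  have e3 : (fun y => shear hr hs hτ hτ' hF hG y 3) = fun y => s * y 3 + G (tProj y) := rfl
  have p2 : ∀ i, pderiv i (fun y : Fin 4 → ℝ => r * y 2 + F (tProj y)) x =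
      (if i = 2 then r else 0) + pderiv i (fun y => F (tProj y)) x := by
    intro i
    rw [pderiv_add i ((dx 2).const_mul r) dF', pderiv_mul i (differentiableAt_const r) (dx 2),
      pderiv_const, pderiv_proj]
    split_ifs <;> ring
  have p3 : ∀ i, pderiv i (fun y : Fin 4 → ℝ => s * y 3 + G (tProj y)) x =
      (if i = 3 then s else 0) + pderiv i (fun y => G (tProj y)) x := by
    intro i
    rw [pderiv_add i ((dx 3).const_mul s) dG', pderiv_mul i (differentiableAt_const s) (dx 3),
      pderiv_const, pderiv_proj]
    split_ifs <;> ring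
  have q0 := fun a => pderiv_zero_comp_tProj (dτ a)
  have q1 := fun a => pderiv_one_comp_tProj (dτ a)
  have q2 := fun a => pderiv_two_comp_tProj (dτ a)
  have q3 := fun a => pderiv_three_comp_tProj (dτ a)
  revert a i
  refine forall_fin_four ?_ ?_ ?_ ?_ <;> refine forall_fin_four ?_ ?_ ?_ ?_ <;>
    intro h1 <;> clear h1 <;>
    simp only [e0, e1, e2, e3, p2, p3, pderiv_zero_comp_tProj dF, pderiv_one_comp_tProj dF,
      pderiv_two_comp_tProj dF, pderiv_three_comp_tProj dF, pderiv_zero_comp_tProj dG,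
      pderiv_one_comp_tProj dG, pderiv_two_comp_tProj dG, pderiv_three_comp_tProj dG,
      Fin.reduceEq, if_true, if_false, zero_add, add_zero] <;>
    first
    | rfl
    | exact q0 _
    | exact q1 _
    | exact q2 _
    | exact q3 _

end Shear

/-- The Poincaré lemma for one-forms on a convex planar domain. -/
theorem exists_potential {B : Set (Fin 2 → ℝ)} (hB : IsOpen B) (hc : Convex ℝ B)
    {α β : (Fin 2 → ℝ) → ℝ} (hα : ContDiffOn ℝ ∞ α B) (hβ : ContDiffOn ℝ ∞ β B)
    (h : ∀ t ∈ B, pderiv 1 α t = pderiv 0 β t) :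
    ∃ F : (Fin 2 → ℝ) → ℝ, ContDiffOn ℝ ∞ F B ∧
      ∀ t ∈ B, pderiv 0 F t = α t ∧ pderiv 1 F t = β t := by
  set p : Fin 2 → (Fin 2 → ℝ) →L[ℝ] ℝ := fun i => ContinuousLinearMap.proj i
  set θ : (Fin 2 → ℝ) → (Fin 2 → ℝ) →L[ℝ] ℝ := fun t => α t • p 0 + β t • p 1
  have hθ : ContDiffOn ℝ ∞ θ B :=
    (hα.smul contDiffOn_const).add (hβ.smul contDiffOn_const)
  have dθ : ∀ t ∈ B, ∀ v w, fderiv ℝ θ t v w = fderiv ℝ α t v * w 0 + fderiv ℝ β t v * w 1 := by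
    intro t ht v w
    have hα' : DifferentiableAt ℝ α t :=
      (hα.contDiffAt (hB.mem_nhds ht)).differentiableAt (by simp)
    have hβ' : DifferentiableAt ℝ β t :=
      (hβ.contDiffAt (hB.mem_nhds ht)).differentiableAt (by simp)
    have := ((hα'.hasFDerivAt.smul_const (p 0)).add (hβ'.hasFDerivAt.smul_const (p 1))).fderiv
    have h' : fderiv ℝ θ t = _ := this
    rw [h']
    simp [p]
  -- Symmetry of the derivative of `θ = α dt₁ + β dt₂` is exactly its closedness.
  obtain ⟨F, hF⟩ := hc.exists_forall_hasFDerivAt_of_fderiv_symmetric hB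
    (hθ.differentiableOn (by simp)) (by
      intro t ht v w
      rw [dθ t ht, dθ t ht]
      simp only [fderiv_eq_sum_pderiv, Fin.sum_univ_two]
      linear_combination (v 1 * w 0 - v 0 * w 1) * h t ht)
  refine ⟨F, ?_, fun t ht => ?_⟩
  · refine (contDiffOn_infty_iff_fderiv_of_isOpen hB).2
      ⟨fun t ht => (hF t ht).differentiableAt.differentiableWithinAt, hθ.congr fun t ht => ?_⟩
    exact (hF t ht).fderiv
  · simp [pderiv, (hF t ht).fderiv, θ, p]

/-! ### Adapted charts: restriction to balls and composition with shears -/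

section Adapted

variable {M : Type*} [TopologicalSpace M] [ChartedSpace (Fin 4 → ℝ) M]
  [IsManifold 𝓘(ℝ, Fin 4 → ℝ) ∞ M] {𝒢 : Submodule ℝ (VField 4 M)}
  {e : OpenPartialHomeomorph M (Fin 4 → ℝ)}

theorem IsAdaptedChart.exists_ball (he : IsAdaptedChart 𝒢 e) {p : M} (hp : p ∈ e.source) :
    ∃ (e₁ : OpenPartialHomeomorph M (Fin 4 → ℝ)) (ρ : ℝ), 0 < ρ ∧ IsAdaptedChart 𝒢 e₁ ∧
      p ∈ e₁.source ∧ e₁.target = Metric.ball (e p) ρ ∧ Metric.ball (e p) ρ ⊆ e.target ∧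
      (∀ g, metricCoeff g e₁ = metricCoeff g e) := by
  obtain ⟨ρ, hρ, hB⟩ := Metric.isOpen_iff.1 e.open_target _ (e.map_source hp)
  obtain ⟨hm, ξ, hξ, hξe⟩ := he
  have ht : (e ≫ₕ OpenPartialHomeomorph.ofSet (Metric.ball (e p) ρ) Metric.isOpen_ball).target =
      Metric.ball (e p) ρ := by
    rw [OpenPartialHomeomorph.trans_target]
    exact inter_eq_left.2 hB
  refine ⟨e ≫ₕ OpenPartialHomeomorph.ofSet (Metric.ball (e p) ρ) Metric.isOpen_ball, ρ, hρ,
    ⟨trans_mem_maximalAtlas hm contDiffOn_id contDiffOn_id, ξ, hξ, ?_⟩, ?_, ht, hB, fun g => rfl⟩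
  · intro k x hx
    rw [ht] at hx
    exact hξe k x (hB hx)
  · rw [OpenPartialHomeomorph.trans_source]
    exact ⟨hp, Metric.mem_ball_self hρ⟩

variable {τ : OpenPartialHomeomorph (Fin 2 → ℝ) (Fin 2 → ℝ)} {F G : (Fin 2 → ℝ) → ℝ}
  {r s : ℝ} (hr : r ≠ 0) (hs : s ≠ 0) (hτ : ContDiffOn ℝ ∞ τ τ.source)
  (hτ' : ContDiffOn ℝ ∞ τ.symm τ.target) (hF : ContDiffOn ℝ ∞ F τ.source)
  (hG : ContDiffOn ℝ ∞ G τ.source)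

theorem fieldCoeff_trans_shear (he : e ∈ IsManifold.maximalAtlas 𝓘(ℝ, Fin 4 → ℝ) ∞ M)
    {x : Fin 4 → ℝ} (hx : x ∈ e.target) (hx' : tProj x ∈ τ.source) (X : VField 4 M) :
    fieldCoeff X (e ≫ₕ shear hr hs hτ hτ' hF hG) (shear hr hs hτ hτ' hF hG x) =
      (shearJacobian τ r s F G (tProj x)).mulVec (fieldCoeff X e x) := by
  rw [toCoeff_trans he (shear_contDiffOn hr hs hτ hτ' hF hG)
    (shear_symm_contDiffOn hr hs hτ hτ' hF hG) hx hx']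
  ext a
  rw [apply_eq_sum_single]
  simp only [fderiv_shear hr hs hτ hτ' hF hG hx', Matrix.mulVec, dotProduct]
  exact Finset.sum_congr rfl fun i _ => mul_comm _ _

/-- A shear maps `∂_{z₁}, ∂_{z₂}` to `r` and `s` times the new coordinate fields, so the generators
rescaled by `r⁻¹` and `s⁻¹` are the new coordinate fields. -/
theorem IsAdaptedChart.trans_shear (he : IsAdaptedChart 𝒢 e) :
    IsAdaptedChart 𝒢 (e ≫ₕ shear hr hs hτ hτ' hF hG) := by
  obtain ⟨hm, ξ, hξ, hξe⟩ := he
  refine ⟨trans_mem_maximalAtlas hm (shear_contDiffOn hr hs hτ hτ' hF hG)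
    (shear_symm_contDiffOn hr hs hτ hτ' hF hG),
    fun k => (![r, s] k)⁻¹ • ξ k, ?_, ?_⟩
  · have hne : ∀ k, ![r, s] k ≠ 0 := Fin.forall_fin_two.2 ⟨hr, hs⟩
    rw [← hξ]
    apply le_antisymm <;> rw [Submodule.span_le] <;> rintro _ ⟨k, rfl⟩
    · exact Submodule.smul_mem _ _ (Submodule.subset_span ⟨k, rfl⟩)
    · have : ξ k = ![r, s] k • ((![r, s] k)⁻¹ • ξ k) := by
        rw [smul_smul, mul_inv_cancel₀ (hne k), one_smul]
      rw [this]
      exact Submodule.smul_mem _ _ (Submodule.subset_span ⟨k, rfl⟩)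
  · intro k y hy
    obtain ⟨x, hx, hx', rfl⟩ := exists_eq_of_mem_trans_target hy
    have h1 : ∀ c : ℝ, fieldCoeff (c • ξ k) e x = c • fieldCoeff (ξ k) e x := fun c => by
      rw [fieldCoeff_eq, fieldCoeff_eq, Pi.smul_apply, map_smul]
    rw [fieldCoeff_trans_shear hr hs hτ hτ' hF hG hm hx hx', h1, hξe k x hx, Matrix.mulVec_smul,
      Matrix.mulVec_single_one]
    revert k
    refine Fin.forall_fin_two.2 ⟨fun _ => ?_, fun _ => ?_⟩ <;> funext a <;> revert a <;>
      refine forall_fin_four ?_ ?_ ?_ ?_ <;>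
      first
      | exact mul_zero _
      | exact inv_mul_cancel₀ hr
      | exact inv_mul_cancel₀ hs

end Adapted

/-! ### From the normalized form to a reduced chart -/

section Adapted

variable {M : Type*} [TopologicalSpace M] [ChartedSpace (Fin 4 → ℝ) M]
  [IsManifold 𝓘(ℝ, Fin 4 → ℝ) ∞ M]

/-- The metric is reduced in the adapted chart `e`, whose target is a ball. -/
structure IsReducedChart (g : PseudoRiemannianMetric 4 M) (𝒢 : Submodule ℝ (VField 4 M))
    (e : OpenPartialHomeomorph M (Fin 4 → ℝ)) (q : Fin 4 → ℝ) (ρ ε : ℝ)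
    (E f k h : (Fin 2 → ℝ) → ℝ) : Prop where
  adapted : IsAdaptedChart 𝒢 e
  radius_pos : 0 < ρ
  target_eq : e.target = Metric.ball q ρ
  data : IsRedData (Metric.ball (tProj q) ρ) ε E f k h
  E_pos : ∀ t ∈ Metric.ball (tProj q) ρ, 0 < E t
  h_pos : ∀ t ∈ Metric.ball (tProj q) ρ, 0 < h t
  pderiv_h : ∀ t ∈ Metric.ball (tProj q) ρ, pderiv 0 h t ≠ 0
  gradient_pos : ∀ t ∈ Metric.ball (tProj q) ρ, 0 < pderiv 0 h t ^ 2 + ε * pderiv 1 h t ^ 2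
  metric_eq : ∀ x ∈ Metric.ball q ρ, metricCoeff g e x = redMetric ε E f k h x

/-- By the intermediate value theorem a nowhere vanishing continuous function has one sign `σ`.
Replacing `z₂` by `σ z₂` then makes the mixed coefficient positive. -/
theorem exists_sign_mul_pos {B : Set (Fin 2 → ℝ)} (hB : IsPreconnected B) {h : (Fin 2 → ℝ) → ℝ}
    (hh : ContinuousOn h B) (h0 : ∀ t ∈ B, h t ≠ 0) {b : Fin 2 → ℝ} (hb : b ∈ B) :
    ∃ σ : ℝ, σ ^ 2 = 1 ∧ ∀ t ∈ B, 0 < σ * h t := by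
  have key : ∀ u : (Fin 2 → ℝ) → ℝ, ContinuousOn u B → (∀ t ∈ B, u t ≠ 0) → 0 < u b →
      ∀ t ∈ B, 0 < u t := by
    intro u hu hu0 hub t ht
    by_contra hneg
    obtain ⟨s, hs, hs0⟩ := hB.intermediate_value ht hb hu ⟨not_lt.1 hneg, hub.le⟩
    exact hu0 s hs hs0
  rcases lt_or_gt_of_ne (h0 b hb) with hlt | hgt
  · refine ⟨-1, by norm_num, fun t ht => ?_⟩
    rw [neg_one_mul]
    exact key _ hh.neg (fun s hs => neg_ne_zero.2 (h0 s hs)) (neg_pos.2 hlt) t ht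
  · refine ⟨1, by norm_num, fun t ht => ?_⟩
    rw [one_mul]
    exact key h hh h0 hgt t ht

variable {g : PseudoRiemannianMetric 4 M} {𝒢 : Submodule ℝ (VField 4 M)}
  {e : OpenPartialHomeomorph M (Fin 4 → ℝ)} {ε : ℝ} {P h₁₁ h₁₂ f₁ f₂ : (Fin 2 → ℝ) → ℝ}

/-- The new coordinates are `z₁ + F` with `dF = f₁ dt₁`, and `σ z₂` with `σ` the sign of `h₁₂`. -/
theorem HasNormalizedForm.exists_isReducedChart (N : HasNormalizedForm g 𝒢 e ε P h₁₁ h₁₂ f₁ f₂)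
    (hε : ε = 1 ∨ ε = -1) (hf : ∀ t ∈ tProj '' e.target, pderiv 1 f₁ t = 0)
    (hh : ∀ t ∈ tProj '' e.target, pderiv 0 h₁₂ t ≠ 0)
    (hg : ∀ t ∈ tProj '' e.target, 0 < pderiv 0 h₁₂ t ^ 2 + ε * pderiv 1 h₁₂ t ^ 2)
    {p : M} (hp : p ∈ e.source) :
    ∃ (e₁ : OpenPartialHomeomorph M (Fin 4 → ℝ)) (q : Fin 4 → ℝ) (ρ : ℝ)
      (E f k h : (Fin 2 → ℝ) → ℝ), p ∈ e₁.source ∧ IsReducedChart g 𝒢 e₁ q ρ ε E f k h := by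
  obtain ⟨e₀, ρ₀, hρ₀, he₀, hp₀, ht₀, hsub₀, hG₀⟩ := N.adapted.exists_ball hp
  set B := Metric.ball (tProj (e p)) ρ₀ with hBdef
  have hB : IsOpen B := Metric.isOpen_ball
  have hBt : B ⊆ tProj '' e.target := by
    rw [hBdef, ← tProj_image_ball _ hρ₀]
    exact image_mono hsub₀
  have sh := N.smooth_h₁₂.mono hBt
  obtain ⟨F, hF, hF'⟩ := exists_potential hB (convex_ball _ _) (N.smooth_f₁.mono hBt)
    (contDiffOn_const (c := (0 : ℝ))) fun t ht => by
      rw [hf t (hBt ht), pderiv_const]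
  obtain ⟨σ, hσ, hσh⟩ := exists_sign_mul_pos (convex_ball _ _).isPreconnected sh.continuousOn
    (fun t ht => N.h₁₂_ne_zero t (hBt ht)) (Metric.mem_ball_self hρ₀)
  have hσ0 : σ ≠ 0 := by
    rintro rfl
    norm_num at hσ
  set τ := OpenPartialHomeomorph.ofSet B hB with hτdef
  have hτ : ContDiffOn ℝ ∞ τ τ.source := contDiffOn_id
  have hτ' : ContDiffOn ℝ ∞ τ.symm τ.target := contDiffOn_id
  have hZ : ContDiffOn ℝ ∞ (fun _ : Fin 2 → ℝ => (0 : ℝ)) τ.source := contDiffOn_const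
  have hFτ : ContDiffOn ℝ ∞ F τ.source := hF
  set e₁ := e₀ ≫ₕ shear one_ne_zero hσ0 hτ hτ' hFτ hZ with he₁def
  have he₁ : IsAdaptedChart 𝒢 e₁ := he₀.trans_shear ..
  have hp₁ : p ∈ e₁.source := by
    rw [he₁def, OpenPartialHomeomorph.trans_source]
    refine ⟨hp₀, ?_⟩
    have := e₀.map_source hp₀
    rw [ht₀] at this
    change tProj (e₀ p) ∈ B
    rw [hBdef, ← tProj_image_ball _ hρ₀]
    exact mem_image_of_mem _ this
  -- The shear need not map a ball onto a ball, so the chart is shrunk once more.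
  obtain ⟨e₂, ρ, hρ, he₂, hp₂, ht₂, hsub₂, hG₂⟩ := he₁.exists_ball hp₁
  have hq : ∀ x ∈ e₁.target, ∃ y ∈ e₀.target, tProj y ∈ B ∧
      shear one_ne_zero hσ0 hτ hτ' hFτ hZ y = x ∧ tProj y = tProj x := by
    intro x hx
    obtain ⟨y, hy, hy', rfl⟩ := exists_eq_of_mem_trans_target hx
    exact ⟨y, hy, hy', rfl, (tProj_mkPoint ..).symm⟩
  have hBB : Metric.ball (tProj (e₁ p)) ρ ⊆ B := by
    rw [← tProj_image_ball _ hρ]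
    rintro _ ⟨x, hx, rfl⟩
    obtain ⟨y, -, hyB, -, hyx⟩ := hq x (hsub₂ hx)
    rwa [← hyx]
  have hd : ∀ t ∈ Metric.ball (tProj (e₁ p)) ρ, ∀ i,
      pderiv i (fun t => σ * h₁₂ t) t = σ * pderiv i h₁₂ t := by
    intro t ht i
    rw [pderiv_mul i (differentiableAt_const σ)
      ((sh.contDiffAt (hB.mem_nhds (hBB ht))).differentiableAt (by simp)), pderiv_const]
    ring
  refine ⟨e₂, e₁ p, ρ, fun t => Real.exp (-2 * P t), fun t => σ * f₂ t, h₁₁, fun t => σ * h₁₂ t,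
    hp₂, he₂, hρ, ht₂, ⟨Metric.isOpen_ball, ?_, ?_, ?_, ?_, ?_, ?_, ?_⟩, ?_, ?_, ?_, ?_, ?_⟩
  · rcases hε with rfl | rfl <;> norm_num
  · exact (contDiffOn_const.mul ((N.smooth_P.mono hBt).mono hBB)).exp
  · exact contDiffOn_const.mul ((N.smooth_f₂.mono hBt).mono hBB)
  · exact (N.smooth_h₁₁.mono hBt).mono hBB
  · exact contDiffOn_const.mul (sh.mono hBB)
  · exact fun t _ => (Real.exp_pos _).ne'
  · exact fun t ht => (hσh t (hBB ht)).ne'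
  · exact fun t _ => Real.exp_pos _
  · exact fun t ht => hσh t (hBB ht)
  · intro t ht
    rw [hd t ht]
    exact mul_ne_zero hσ0 (hh t (hBt (hBB ht)))
  · intro t ht
    rw [hd t ht, hd t ht]
    have := hg t (hBt (hBB ht))
    rw [mul_pow, mul_pow, hσ]
    linarith
  · intro x hx
    obtain ⟨y, hy, hyB, hyx, htyx⟩ := hq x (hsub₂ hx)
    rw [hG₂, ← hyx]
    refine metricCoeff_trans_eq g he₀.1 (shear_contDiffOn _ _ hτ hτ' hFτ hZ)
      (shear_symm_contDiffOn _ _ hτ hτ' hFτ hZ) hy hyB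
      (fderiv_shear _ _ hτ hτ' hFτ hZ hyB) ?_
    rw [ht₀] at hy
    rw [hG₀, N.metric_eq y (hsub₀ hy) _ rfl]
    obtain ⟨hF0, hF1⟩ := hF' _ hyB
    have p0 : ∀ i j : Fin 2, pderiv i (fun t => τ t j) (tProj y) = if i = j then 1 else 0 :=
      fun i j => pderiv_proj i j
    have pc : ∀ i : Fin 2, pderiv i (fun _ : Fin 2 → ℝ => (0 : ℝ)) (tProj y) = 0 :=
      fun i => pderiv_const i 0
    have hT : tProj (shear one_ne_zero hσ0 hτ hτ' hFτ hZ y) = tProj y :=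
      tProj_mkPoint ..
    unfold shearJacobian redMetric
    rw [hT, hF0, hF1, pc, pc]
    simp only [p0]
    ext i j
    revert i j
    refine forall_fin_four ?_ ?_ ?_ ?_ <;> refine forall_fin_four ?_ ?_ ?_ ?_ <;>
      simp [Matrix.mul_apply, Fin.sum_univ_four]
    · linear_combination (-2 * h₁₂ (tProj y) * f₁ (tProj y) * f₂ (tProj y)) * hσ
    · linear_combination (-h₁₂ (tProj y) * f₂ (tProj y)) * hσ
    · linear_combination (-h₁₂ (tProj y) * f₁ (tProj y)) * hσ
    · linear_combination (-h₁₂ (tProj y) * f₂ (tProj y)) * hσ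
    · linear_combination (-h₁₂ (tProj y)) * hσ
    · exact Or.inl (by linear_combination (-h₁₂ (tProj y)) * hσ)
    · linear_combination (-h₁₂ (tProj y)) * hσ

end Adapted

/-! ### The soliton field in a reduced chart -/

section Analysis

variable {U : Set (Fin 4 → ℝ)} {u : (Fin 4 → ℝ) → ℝ}

/-- A function killed by `∂_{t₂}` and `∂_{t₁} - f ∂_{z₂}` is killed by their bracket `-f_{,t₂}
∂_{z₂}`, hence by `∂_{z₂}` and by `∂_{t₁}`. -/
theorem pderiv_eq_zero_of_shift (hU : IsOpen U) (hu : ContDiffOn ℝ ∞ u U) {f : (Fin 2 → ℝ) → ℝ}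
    (hf : ∀ x ∈ U, DifferentiableAt ℝ f (tProj x) ∧ pderiv 1 f (tProj x) ≠ 0)
    (h1 : ∀ x ∈ U, pderiv 1 u x = 0) (h0 : ∀ x ∈ U, pderiv 0 u x = f (tProj x) * pderiv 3 u x)
    {x : Fin 4 → ℝ} (hx : x ∈ U) : pderiv 0 u x = 0 ∧ pderiv 1 u x = 0 ∧ pderiv 3 u x = 0 := by
  have hn := hU.mem_nhds hx
  have hs := hu.contDiffAt hn
  have e1 : pderiv 1 u =ᶠ[𝓝 x] fun _ => 0 := eventually_of_mem hn h1
  have e0 : pderiv 0 u =ᶠ[𝓝 x] fun y => f (tProj y) * pderiv 3 u y := eventually_of_mem hn h0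
  have z : ∀ i, pderiv i (pderiv 1 u) x = 0 := fun i => by
    rw [pderiv_congr i e1, pderiv_const]
  have h := pderiv_congr 1 e0
  have df : DifferentiableAt ℝ (fun y => f (tProj y)) x :=
    (hf x hx).1.comp x tProjL.differentiableAt
  rw [← pderiv_comm 0 1 hs, z, pderiv_mul 1 df
    ((contDiffAt_pderiv 3 hs).differentiableAt (by simp)), ← pderiv_comm 3 1 hs, z,
    pderiv_one_comp_tProj (hf x hx).1, mul_zero, add_zero] at h
  have h3 := (mul_eq_zero.1 h.symm).resolve_left (hf x hx).2
  exact ⟨by rw [h0 x hx, h3, mul_zero], h1 x hx, h3⟩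

/-- The derivative `∂u/∂z₁` is independent of `t` and `z₂` because `u` is, and of `z₁` because of
`h2`; so it is constant. -/
theorem eq_affine_of_pderiv (hU : IsOpen U) (hc : Convex ℝ U) (hu : ContDiffOn ℝ ∞ u U)
    (h : ∀ x ∈ U, pderiv 0 u x = 0 ∧ pderiv 1 u x = 0 ∧ pderiv 3 u x = 0)
    (h2 : ∀ x ∈ U, ∀ y ∈ U, tProj x = tProj y → pderiv 2 u x = pderiv 2 u y) :
    ∃ a b, ∀ x ∈ U, u x = a * x 2 + b ∧ pderiv 2 u x = a := by
  have hs := fun x hx => hu.contDiffAt (hU.mem_nhds (x := x) hx)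
  have ds := fun x hx => (contDiffAt_pderiv 2 (hs x hx)).differentiableAt (by simp)
  have z : ∀ j, (∀ x ∈ U, pderiv j u x = 0) → ∀ x ∈ U, pderiv j (pderiv 2 u) x = 0 := by
    intro j hj x hx
    have e : pderiv j u =ᶠ[𝓝 x] fun _ => 0 := eventually_of_mem (hU.mem_nhds hx) hj
    rw [← pderiv_comm 2 j (hs x hx), pderiv_congr 2 e, pderiv_const]
  have z2 : ∀ x ∈ U, pderiv 2 (pderiv 2 u) x = 0 := by
    intro x hx
    -- Along this line in the direction of `z₁` the projection `tProj` does not change, so `h2`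
    -- makes `∂u/∂z₁` constant on it.
    have hl : HasDerivAt (fun s : ℝ => x + s • (Pi.single 2 1 : Fin 4 → ℝ)) (Pi.single 2 1) 0 := by
      simpa using ((hasDerivAt_id (0 : ℝ)).smul_const (Pi.single 2 1 : Fin 4 → ℝ)).const_add x
    have hd : HasDerivAt (fun s : ℝ => pderiv 2 u (x + s • (Pi.single 2 1 : Fin 4 → ℝ)))
        (pderiv 2 (pderiv 2 u) x) 0 := by
      refine HasFDerivAt.comp_hasDerivAt (0 : ℝ) (l := pderiv 2 u)
        (l' := fderiv ℝ (pderiv 2 u) x) ?_ hl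
      simpa using (ds x hx).hasFDerivAt
    have hU' : ∀ᶠ s in 𝓝 (0 : ℝ), x + s • (Pi.single 2 1 : Fin 4 → ℝ) ∈ U :=
      hl.continuousAt.eventually_mem (by simpa using hU.mem_nhds hx)
    have he : (fun s : ℝ => pderiv 2 u (x + s • (Pi.single 2 1 : Fin 4 → ℝ))) =ᶠ[𝓝 0]
        fun _ => pderiv 2 u x := by
      filter_upwards [hU'] with s hs
      refine h2 _ hs _ hx ?_
      ext i
      fin_cases i <;> simp [tProj, tIdx]
    exact hd.unique ((hasDerivAt_const _ _).congr_of_eventuallyEq he)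
  rcases U.eq_empty_or_nonempty with rfl | ⟨q, hq⟩
  · exact ⟨0, 0, by simp⟩
  have hconst : ∀ x ∈ U, pderiv 2 u x = pderiv 2 u q := fun x hx =>
    eq_of_pderiv_eq_zero hU hc ds (fun y hy => forall_fin_four
      (z 0 (fun x hx => (h x hx).1) y hy) (z 1 (fun x hx => (h x hx).2.1) y hy) (z2 y hy)
      (z 3 (fun x hx => (h x hx).2.2) y hy)) hx hq
  have dp : ∀ x : Fin 4 → ℝ, DifferentiableAt ℝ (fun y : Fin 4 → ℝ => y 2) x := fun x => by fun_prop
  have du := fun x hx => (hs x hx).differentiableAt (by simp)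
  have hv : ∀ x ∈ U, u x - pderiv 2 u q * x 2 = u q - pderiv 2 u q * q 2 := by
    intro x hx
    refine eq_of_pderiv_eq_zero (u := fun x => u x - pderiv 2 u q * x 2) hU hc
      (fun y hy => (du y hy).sub ((dp y).const_mul _)) (fun y hy => ?_) hx hq
    have hp : ∀ i, pderiv i (fun x => u x - pderiv 2 u q * x 2) y =
        pderiv i u y - pderiv 2 u q * if i = 2 then 1 else 0 := fun i => by
      rw [pderiv_sub i (du y hy) ((dp y).const_mul _), pderiv_mul i (differentiableAt_const _) (dp y),
        pderiv_const, pderiv_proj, zero_mul, zero_add]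
    obtain ⟨k0, k1, k3⟩ := h y hy
    simp only [hp]
    exact forall_fin_four (by simp [k0]) (by simp [k1]) (by simp [hconst y hy]) (by simp [k3])
  exact ⟨pderiv 2 u q, u q - pderiv 2 u q * q 2, fun x hx => ⟨by linarith [hv x hx], hconst x hx⟩⟩

end Analysis

section Adapted

variable {M : Type*} [TopologicalSpace M] [ChartedSpace (Fin 4 → ℝ) M]
  [IsManifold 𝓘(ℝ, Fin 4 → ℝ) ∞ M] {g : PseudoRiemannianMetric 4 M} {𝒢 : Submodule ℝ (VField 4 M)}
  {e : OpenPartialHomeomorph M (Fin 4 → ℝ)} {x : Fin 4 → ℝ}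

theorem IsAdaptedChart.mem_leafDist_iff (he : IsAdaptedChart 𝒢 e) (hx : x ∈ e.target)
    (v : TangentSpace 𝓘(ℝ, Fin 4 → ℝ) (e.symm x)) :
    v ∈ leafDist 𝒢 (e.symm x) ↔ toCoeff e x v 0 = 0 ∧ toCoeff e x v 1 = 0 := by
  obtain ⟨hm, ξ, hξ, hξe⟩ := he
  have hc : ∀ k, toCoeff e x (ξ k (e.symm x)) = Pi.single (zIdx k) 1 := fun k => hξe k x hx
  have h0 : ∀ k, (Pi.single (zIdx k) 1 : Fin 4 → ℝ) 0 = 0 := by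
    intro k; fin_cases k <;> simp [zIdx]
  have h1 : ∀ k, (Pi.single (zIdx k) 1 : Fin 4 → ℝ) 1 = 0 := by
    intro k; fin_cases k <;> simp [zIdx]
  constructor
  · rintro ⟨η, hη, rfl⟩
    rw [← hξ] at hη
    rw [LinearMap.proj_apply]
    induction hη using Submodule.span_induction with
    | mem y hy =>
      obtain ⟨k, rfl⟩ := hy
      rw [hc, h0, h1]
      exact ⟨rfl, rfl⟩
    | zero => simp
    | add y z _ _ hy hz => simp [hy, hz]
    | smul c y _ hy => simp [hy]
  · rintro ⟨hv0, hv1⟩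
    have hv : v = toCoeff e x v 2 • ξ 0 (e.symm x) + toCoeff e x v 3 • ξ 1 (e.symm x) := by
      have h' : toCoeff e x v = toCoeff e x
          (toCoeff e x v 2 • ξ 0 (e.symm x) + toCoeff e x v 3 • ξ 1 (e.symm x)) := by
        rw [map_add, map_smul, map_smul, hc, hc]
        ext a
        revert a
        exact forall_fin_four (by simp [hv0, zIdx]) (by simp [hv1, zIdx]) (by simp [zIdx])
          (by simp [zIdx])
      rw [← ofCoeff_toCoeff hm hx (_ + _), ← h', ofCoeff_toCoeff hm hx]
    rw [hv]
    have hmem : ∀ k, ξ k (e.symm x) ∈ leafDist 𝒢 (e.symm x) := fun k =>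
      ⟨ξ k, hξ ▸ Submodule.subset_span ⟨k, rfl⟩, rfl⟩
    exact Submodule.add_mem _ (Submodule.smul_mem _ _ (hmem 0)) (Submodule.smul_mem _ _ (hmem 1))

variable {q : Fin 4 → ℝ} {ρ ε : ℝ} {E f k h : (Fin 2 → ℝ) → ℝ}

namespace IsReducedChart

theorem tProj_mem (R : IsReducedChart g 𝒢 e q ρ ε E f k h) (hx : x ∈ Metric.ball q ρ) :
    tProj x ∈ Metric.ball (tProj q) ρ := by
  rw [← tProj_image_ball _ R.radius_pos]
  exact mem_image_of_mem _ hx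

/-- Pairing with `∂_{z₂}` gives `h v₂ = 0`; pairing with `∂_{z₁}` then gives `h (f v₀ + v₃) = 0`. -/
theorem isHorizontal_iff (R : IsReducedChart g 𝒢 e q ρ ε E f k h) (hx : x ∈ Metric.ball q ρ)
    (v : TangentSpace 𝓘(ℝ, Fin 4 → ℝ) (e.symm x)) : IsHorizontal g 𝒢 (e.symm x) v ↔
      toCoeff e x v 2 = 0 ∧ toCoeff e x v 3 = -f (tProj x) * toCoeff e x v 0 := by
  have hxt : x ∈ e.target := R.target_eq ▸ hx
  have hm := R.adapted.1
  have hh := (R.h_pos _ (R.tProj_mem hx)).ne'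
  have hval : ∀ w, g.val (e.symm x) v (ofCoeff e x w) =
      ∑ a, ∑ b, toCoeff e x v a * w b * redMetric ε E f k h x a b := by
    intro w
    conv_lhs => rw [← ofCoeff_toCoeff hm hxt v]
    rw [val_ofCoeff, R.metric_eq x hx]
  obtain ⟨g00, g01, g02, g03, g10, g11, g12, g13, g20, g21, g22, g23, g30, g31, g32, g33⟩ :=
    redMetric_entries ε E f k h x
  simp only [Fin.sum_univ_four, g00, g01, g02, g03, g10, g11, g12, g13, g20, g21, g22, g23, g30,
    g31, g32, g33] at hval
  constructor
  · intro H
    have H2 := H (ofCoeff e x (Pi.single 2 1)) ((R.adapted.mem_leafDist_iff hxt _).2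
      (by rw [toCoeff_ofCoeff hm hxt]; simp))
    have H3 := H (ofCoeff e x (Pi.single 3 1)) ((R.adapted.mem_leafDist_iff hxt _).2
      (by rw [toCoeff_ofCoeff hm hxt]; simp))
    rw [hval] at H2 H3
    simp at H2 H3
    have k2 := H3.resolve_right hh
    refine ⟨k2, mul_right_cancel₀ hh ?_⟩
    rw [k2] at H2
    linear_combination H2
  · rintro ⟨h2, h3⟩ w hw
    obtain ⟨w0, w1⟩ := (R.adapted.mem_leafDist_iff hxt w).1 hw
    rw [← ofCoeff_toCoeff hm hxt w, hval, w0, w1, h2, h3]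
    ring

variable {X : VField 4 M}

/-- The bracket of a symmetry of `Ξ^⊥` with a horizontal field. -/
theorem bracket_isHorizontal (R : IsReducedChart g 𝒢 e q ρ ε E f k h)
    (hX : ∀ p, SmoothFieldAt X p) (hs : IsSymmetryOfHorizontal g 𝒢 X)
    {u : (Fin 4 → ℝ) → (Fin 4 → ℝ)} (hu : ContDiffOn ℝ ∞ u (Metric.ball q ρ))
    (h2 : ∀ x ∈ Metric.ball q ρ, u x 2 = 0 ∧ u x 3 = -f (tProj x) * u x 0)
    (hx : x ∈ Metric.ball q ρ) :
    VectorField.lieBracket ℝ (fieldCoeff X e) u x 2 = 0 ∧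
      VectorField.lieBracket ℝ (fieldCoeff X e) u x 3 =
        -f (tProj x) * VectorField.lieBracket ℝ (fieldCoeff X e) u x 0 := by
  have hxt : x ∈ e.target := R.target_eq ▸ hx
  have hm := R.adapted.1
  have hsm : ∀ y ∈ Metric.ball q ρ, SmoothFieldAt (fieldOfCoeff e u) (e.symm y) := fun y hy =>
    smoothFieldAt_fieldOfCoeff hm (R.target_eq ▸ hy) (hu.contDiffAt (Metric.isOpen_ball.mem_nhds hy))
  have hH := hs (e.symm x) (fieldOfCoeff e u) (by
    filter_upwards [e.open_source.mem_nhds (e.map_target hxt)] with p hp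
    have hp' : e p ∈ Metric.ball q ρ := R.target_eq ▸ e.map_source hp
    rw [← e.left_inv hp]
    refine ⟨hsm _ hp', (R.isHorizontal_iff hp' _).2 ?_⟩
    rw [← fieldCoeff_eq, fieldCoeff_fieldOfCoeff hm (e.map_source hp)]
    exact h2 _ hp')
  rw [R.isHorizontal_iff hx, ← fieldCoeff_eq,
    fieldCoeff_mlieBracket hm hxt (hX _) (hsm x hx)] at hH
  have hcongr : fieldCoeff (fieldOfCoeff e u) e =ᶠ[𝓝 x] u := by
    filter_upwards [e.open_target.mem_nhds hxt] with y hy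
    exact fieldCoeff_fieldOfCoeff hm hy u
  rwa [(EventuallyEq.refl _ _).lieBracket_vectorField_eq hcongr] at hH

theorem contDiffOn_fieldCoeff (R : IsReducedChart g 𝒢 e q ρ ε E f k h)
    (hX : ∀ p, SmoothFieldAt X p) (a : Fin 4) :
    ContDiffOn ℝ ∞ (fun x => fieldCoeff X e x a) (Metric.ball q ρ) := fun _ hx =>
  (contDiffAt_pi.1 (contDiffAt_fieldCoeff R.adapted.1 (R.target_eq ▸ hx) (hX _)) a).contDiffWithinAt

theorem pderiv_shift_ne_zero (R : IsReducedChart g 𝒢 e q ρ ε E f k h)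
    (A : StandingAssumptions g 𝒢 X) (hx : x ∈ Metric.ball q ρ) : pderiv 1 f (tProj x) ≠ 0 := by
  intro h0
  have e1 : metricCoeff g e =ᶠ[𝓝 x] redMetric ε E f k h :=
    eventually_of_mem (Metric.isOpen_ball.mem_nhds hx) R.metric_eq
  refine A.orthogonally_intransitive e R.adapted x (R.target_eq ▸ hx) ?_
  rw [curvatureVec_congr e1, R.data.curvatureVec_redMetric (R.tProj_mem hx), h0, zero_div]
  ext i
  fin_cases i <;> rfl

/-- Brackets of `X` with the horizontal frame `∂_{t₂}`, `∂_{t₁} - f ∂_{z₂}` are both vertical and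
horizontal, hence zero: the frame annihilates the coefficients of `X`. -/
theorem pderiv_fieldCoeff (R : IsReducedChart g 𝒢 e q ρ ε E f k h) (A : StandingAssumptions g 𝒢 X)
    (hX : ∀ p, SmoothFieldAt X p) (hx : x ∈ Metric.ball q ρ) (a : Fin 4) (ha : a = 2 ∨ a = 3) :
    pderiv 0 (fun x => fieldCoeff X e x a) x = 0 ∧ pderiv 1 (fun x => fieldCoeff X e x a) x = 0 ∧
      pderiv 3 (fun x => fieldCoeff X e x a) x = 0 := by
  have hV : ∀ y ∈ Metric.ball q ρ, fieldCoeff X e y 0 = 0 ∧ fieldCoeff X e y 1 = 0 := fun y hy =>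
    (R.adapted.mem_leafDist_iff (R.target_eq ▸ hy) _).1 (A.tangent _)
  have hd : ∀ y ∈ Metric.ball q ρ, DifferentiableAt ℝ (fieldCoeff X e) y := fun y hy =>
    differentiableAt_pi.2 fun a => ((R.contDiffOn_fieldCoeff hX a).contDiffAt
      (Metric.isOpen_ball.mem_nhds hy)).differentiableAt (by simp)
  have hV' : ∀ y ∈ Metric.ball q ρ, ∀ v b, fderiv ℝ (fieldCoeff X e) y v b =
      ∑ i, v i * pderiv i (fun x => fieldCoeff X e x b) y := by
    intro y hy v b
    rw [← fderiv_eq_sum_pderiv, (hasFDerivAt_pi'.1 (hd y hy).hasFDerivAt b).fderiv]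
    rfl
  have hz : ∀ y ∈ Metric.ball q ρ, ∀ i, pderiv i (fun x => fieldCoeff X e x 0) y = 0 := by
    intro y hy i
    have : (fun x => fieldCoeff X e x 0) =ᶠ[𝓝 y] fun _ => 0 :=
      eventually_of_mem (Metric.isOpen_ball.mem_nhds hy) fun z hz => (hV z hz).1
    rw [pderiv_congr i this, pderiv_const]
  have sf : ContDiffOn ℝ ∞ (fun y => f (tProj y)) (Metric.ball q ρ) :=
    R.data.smooth_f.comp contDiff_tProj.contDiffOn fun y hy => R.tProj_mem hy
  have df : ∀ y ∈ Metric.ball q ρ, DifferentiableAt ℝ f (tProj y) := fun y hy =>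
    (R.data.differentiableAt (R.tProj_mem hy)).2.1
  have B1 : ∀ y ∈ Metric.ball q ρ, pderiv 1 (fun x => fieldCoeff X e x 2) y = 0 ∧
      pderiv 1 (fun x => fieldCoeff X e x 3) y = 0 := by
    intro y hy
    have := R.bracket_isHorizontal hX A.symmetry (u := fun _ => Pi.single 1 1) contDiffOn_const
      (by simp) hy
    simpa [VectorField.lieBracket, hV' y hy, hz y hy, Fin.sum_univ_four] using this
  have B0 : ∀ y ∈ Metric.ball q ρ,
      pderiv 0 (fun x => fieldCoeff X e x 2) y =
        f (tProj y) * pderiv 3 (fun x => fieldCoeff X e x 2) y ∧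
      pderiv 0 (fun x => fieldCoeff X e x 3) y =
        f (tProj y) * pderiv 3 (fun x => fieldCoeff X e x 3) y := by
    intro y hy
    have su : ContDiffOn ℝ ∞ (fun y => mkPoint ![1, 0] 0 (-f (tProj y))) (Metric.ball q ρ) :=
      contDiffOn_mkPoint contDiffOn_const contDiffOn_const sf.neg
    have := R.bracket_isHorizontal hX A.symmetry su (fun z _ => by simp [mkPoint]) hy
    have hdu := (su.contDiffAt (Metric.isOpen_ball.mem_nhds hy)).differentiableAt (by simp)
    -- The frame field depends on `t` only, while `X` has no `t`-components, so this half of the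
    -- bracket vanishes.
    have hu' : ∀ b, fderiv ℝ (fun y => mkPoint ![1, 0] 0 (-f (tProj y))) y (fieldCoeff X e y) b =
        0 := by
      intro b
      have h1 : fderiv ℝ (fun y => mkPoint ![1, 0] 0 (-f (tProj y))) y (fieldCoeff X e y) b =
          fderiv ℝ (fun y => mkPoint ![1, 0] 0 (-f (tProj y)) b) y (fieldCoeff X e y) := by
        rw [(hasFDerivAt_pi'.1 hdu.hasFDerivAt b).fderiv]
        rfl
      rw [h1, fderiv_eq_sum_pderiv, Fin.sum_univ_four, (hV y hy).1, (hV y hy).2]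
      have hc : ∀ (c : ℝ) (i : Fin 4), pderiv i (fun _ : Fin 4 → ℝ => c) y = 0 :=
        fun c i => pderiv_const i c
      have p2 : pderiv 2 (fun y => -f (tProj y)) y = 0 := by
        rw [pderiv_neg, pderiv_two_comp_tProj (df y hy), neg_zero]
      have p3 : pderiv 3 (fun y => -f (tProj y)) y = 0 := by
        rw [pderiv_neg, pderiv_three_comp_tProj (df y hy), neg_zero]
      revert b
      refine forall_fin_four ?_ ?_ ?_ ?_ <;> intro _ <;> simp [mkPoint, hc, p2, p3]
    simp only [VectorField.lieBracket, Pi.sub_apply, hu', hV' y hy, Fin.sum_univ_four, hz y hy] at this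
    simp [mkPoint] at this
    constructor
    · linear_combination -this.1
    · linear_combination -this.2
  have hf1 : ∀ y ∈ Metric.ball q ρ, DifferentiableAt ℝ f (tProj y) ∧ pderiv 1 f (tProj y) ≠ 0 :=
    fun y hy => ⟨df y hy, R.pderiv_shift_ne_zero A hy⟩
  rcases ha with rfl | rfl
  · exact pderiv_eq_zero_of_shift Metric.isOpen_ball (R.contDiffOn_fieldCoeff hX 2) hf1
      (fun y hy => (B1 y hy).1) (fun y hy => (B0 y hy).1) hx
  · exact pderiv_eq_zero_of_shift Metric.isOpen_ball (R.contDiffOn_fieldCoeff hX 3) hf1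
      (fun y hy => (B1 y hy).2) (fun y hy => (B0 y hy).2) hx

/-- The soliton field, and the reduced equations. -/
theorem exists_fieldCoeff_eq (R : IsReducedChart g 𝒢 e q ρ ε E f k h)
    (S : IsRicciSoliton g X 0) (A : StandingAssumptions g 𝒢 X) :
    ∃ a₁ a₂ a₃, (∀ x ∈ Metric.ball q ρ, fieldCoeff X e x = modelField a₁ a₂ a₃ x) ∧
      IsReducedSoliton (Metric.ball (tProj q) ρ) ε 0 E f h := by
  have hX := S.smooth
  have hV : ∀ y ∈ Metric.ball q ρ, fieldCoeff X e y 0 = 0 ∧ fieldCoeff X e y 1 = 0 := fun y hy =>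
    (R.adapted.mem_leafDist_iff (R.target_eq ▸ hy) _).1 (A.tangent _)
  have hS : ∀ y ∈ Metric.ball q ρ, ∀ i j, ricciCurv (redMetric ε E f k h) i j y + (1 / 2) *
      (redMetric ε E f k h y 2 j * pderiv i (fun y => fieldCoeff X e y 2) y
      + redMetric ε E f k h y i 2 * pderiv j (fun y => fieldCoeff X e y 2) y
      + redMetric ε E f k h y 3 j * pderiv i (fun y => fieldCoeff X e y 3) y
      + redMetric ε E f k h y i 3 * pderiv j (fun y => fieldCoeff X e y 3) y) = 0 := by
    intro y hy i j
    have hn := Metric.isOpen_ball.mem_nhds hy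
    have e1 : metricCoeff g e =ᶠ[𝓝 y] redMetric ε E f k h := eventually_of_mem hn R.metric_eq
    rw [← R.data.lieMetric_redMetric (R.tProj_mem hy) (eventually_of_mem hn fun z hz => (hV z hz).1)
      (eventually_of_mem hn fun z hz => (hV z hz).2), ← ricciCurv_congr e1,
      ← lieMetric_congr e1 (EventuallyEq.refl _ _), S.soliton_eq e R.adapted.1 y (R.target_eq ▸ hy),
      zero_mul]
  have p2 := fun y hy => R.pderiv_fieldCoeff A hX (x := y) hy 2 (Or.inl rfl)
  have p3 := fun y hy => R.pderiv_fieldCoeff A hX (x := y) hy 3 (Or.inr rfl)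
  have hent := redMetric_entries ε E f k h
  have s23 : ∀ y ∈ Metric.ball q ρ, ricciCurv (redMetric ε E f k h) 2 3 y =
      -(1 / 2) * (h (tProj y) * pderiv 2 (fun y => fieldCoeff X e y 2) y) := by
    intro y hy
    have := hS y hy 2 3
    simp only [hent, p2 y hy, p3 y hy] at this
    linear_combination this
  have s22 : ∀ y ∈ Metric.ball q ρ, ricciCurv (redMetric ε E f k h) 2 2 y =
      -(k (tProj y) * pderiv 2 (fun y => fieldCoeff X e y 2) y +
        h (tProj y) * pderiv 2 (fun y => fieldCoeff X e y 3) y) := by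
    intro y hy
    have := hS y hy 2 2
    simp only [hent] at this
    linear_combination this
  -- In the `23` component the Ricci tensor and `h` depend on `t` only, so the same is true of
  -- `∂X²/∂z₁`.
  obtain ⟨c, a₁, h2⟩ := eq_affine_of_pderiv Metric.isOpen_ball (convex_ball _ _)
    (R.contDiffOn_fieldCoeff hX 2) p2 fun y hy z hz hyz => by
      have hy' := s23 y hy
      have hz' := s23 z hz
      rw [(R.data.ricciCurv_redMetric rfl (R.tProj_mem hy)).2.2.2.2.2.2.2.2.2.2.2.1, hyz] at hy'
      rw [(R.data.ricciCurv_redMetric rfl (R.tProj_mem hz)).2.2.2.2.2.2.2.2.2.2.2.1] at hz'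
      have := hy'.symm.trans hz'
      have hh := (R.h_pos _ (R.tProj_mem hz)).ne'
      refine mul_left_cancel₀ hh ?_
      linear_combination (-2) * this
  have red : IsReducedSoliton (Metric.ball (tProj q) ρ) ε c E f h := by
    refine R.data.isReducedSoliton fun t ht => ?_
    rw [← tProj_image_ball _ R.radius_pos] at ht
    obtain ⟨y, hy, rfl⟩ := ht
    have hp := h2 y hy
    refine ⟨y, rfl, ?_, ?_, ?_, ?_, ?_, ?_⟩
    · simpa only [hent, p2 y hy, p3 y hy, mul_zero, zero_mul, add_zero] using hS y hy 0 0
    · simpa only [hent, p2 y hy, p3 y hy, mul_zero, zero_mul, add_zero] using hS y hy 0 1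
    · simpa only [hent, p2 y hy, p3 y hy, mul_zero, zero_mul, add_zero] using hS y hy 1 1
    · simpa only [hent, p2 y hy, p3 y hy, mul_zero, zero_mul, add_zero] using hS y hy 1 2
    · have := hS y hy 0 2
      simp only [hent, p2 y hy, p3 y hy, hp] at this
      linear_combination this
    · rw [s23 y hy, hp.2]
      ring
  have hc : c = 0 := red.eq_zero R.data (Metric.mem_ball_self R.radius_pos)
    (R.pderiv_h _ (Metric.mem_ball_self R.radius_pos))
  subst hc
  -- With `c = 0` the `22` component contains only `∂X³/∂z₁` besides functions of `t`.
  obtain ⟨a₂, a₃, h3⟩ := eq_affine_of_pderiv Metric.isOpen_ball (convex_ball _ _)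
    (R.contDiffOn_fieldCoeff hX 3) p3 fun y hy z hz hyz => by
      have hy' := s22 y hy
      have hz' := s22 z hz
      rw [(R.data.ricciCurv_redMetric rfl (R.tProj_mem hy)).2.2.2.2.2.2.2.2.2.2.1, (h2 y hy).2,
        hyz] at hy'
      rw [(R.data.ricciCurv_redMetric rfl (R.tProj_mem hz)).2.2.2.2.2.2.2.2.2.2.1, (h2 z hz).2] at hz'
      have := hy'.symm.trans hz'
      have hh := (R.h_pos _ (R.tProj_mem hz)).ne'
      refine mul_left_cancel₀ hh ?_
      linear_combination -this
  refine ⟨a₁, a₂, a₃, fun y hy => ?_, red⟩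
  ext a
  revert a
  exact forall_fin_four (hV y hy).1 (hV y hy).2 ((h2 y hy).1.trans (by simp [modelField]))
    ((h3 y hy).1.trans (by simp [modelField]))

end IsReducedChart

end Adapted

/-! ### Isothermal coordinates for the orbit metric -/

theorem pderiv_comp_real {n : ℕ} {μ : ℝ → ℝ} {u : (Fin n → ℝ) → ℝ} {t : Fin n → ℝ} (i : Fin n)
    (hμ : DifferentiableAt ℝ μ (u t)) (hu : DifferentiableAt ℝ u t) :
    pderiv i (fun t => μ (u t)) t = deriv μ (u t) * pderiv i u t := by
  have := (hμ.hasDerivAt.comp_hasFDerivAt t hu.hasFDerivAt).fderiv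
  have h' : fderiv ℝ (fun t => μ (u t)) t = _ := this
  rw [pderiv, h']
  rfl

section Reduced

variable {B : Set (Fin 2 → ℝ)} {ε : ℝ} {E f k h : (Fin 2 → ℝ) → ℝ}

/-- A change of coordinates that brings a reduced soliton metric into the normal form. -/
theorem IsReducedSoliton.exists_normalizing (S : IsReducedSoliton B ε 0 E f h)
    (H : IsRedData B ε E f k h) (hc : Convex ℝ B) (hE : ∀ t ∈ B, 0 < E t) (hh : ∀ t ∈ B, 0 < h t)
    (hg : ∀ t ∈ B, 0 < pderiv 0 h t ^ 2 + ε * pderiv 1 h t ^ 2) (hf : ∀ t ∈ B, pderiv 1 f t ≠ 0)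
    {b : Fin 2 → ℝ} (hb : b ∈ B) :
    ∃ (r s : ℝ) (T₀ T₁ G : (Fin 2 → ℝ) → ℝ), r ≠ 0 ∧ s ≠ 0 ∧ ContDiffOn ℝ ∞ T₀ B ∧
      ContDiffOn ℝ ∞ T₁ B ∧ ContDiffOn ℝ ∞ G B ∧ ∀ t ∈ B, 0 < T₀ t ∧
        pderiv 0 T₀ t * pderiv 1 T₁ t - pderiv 1 T₀ t * pderiv 0 T₁ t ≠ 0 ∧
        E t = radial 0 ![T₀ t, T₁ t] * (pderiv 0 T₀ t ^ 2 + ε * pderiv 0 T₁ t ^ 2) ∧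
        pderiv 0 T₀ t * pderiv 1 T₀ t + ε * (pderiv 0 T₁ t * pderiv 1 T₁ t) = 0 ∧
        ε * E t = radial 0 ![T₀ t, T₁ t] * (pderiv 1 T₀ t ^ 2 + ε * pderiv 1 T₁ t ^ 2) ∧
        s * f t = T₁ t * radial 2 ![T₀ t, T₁ t] * pderiv 0 T₀ t + pderiv 0 G t ∧
        T₁ t * radial 2 ![T₀ t, T₁ t] * pderiv 1 T₀ t + pderiv 1 G t = 0 ∧
        h t = r * s * T₀ t := by
  have hε := H.sq_eq_one
  have hB := H.isOpen
  have sh : ∀ t ∈ B, ContDiffAt ℝ ∞ h t := fun t ht => H.contDiffAt_h ht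
  have sh' : ∀ i, ContDiffOn ℝ ∞ (pderiv i h) B := fun i t ht =>
    (contDiffAt_pderiv i (sh t ht)).contDiffWithinAt
  have hnz : (∞ : WithTop ℕ∞) ≠ 0 := by simp
  have dh : ∀ t ∈ B, DifferentiableAt ℝ h t := fun t ht => (sh t ht).differentiableAt hnz
  have dh' : ∀ i, ∀ t ∈ B, DifferentiableAt ℝ (pderiv i h) t := fun i t ht =>
    (contDiffAt_pderiv i (sh t ht)).differentiableAt hnz
  -- The conjugate function of `h`; its differential is closed because `h_{,t₁t₁} + ε h_{,t₂t₂} =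
  -- 0`.
  obtain ⟨y, sy, hy⟩ := exists_potential hB hc (α := fun t => -ε * pderiv 1 h t)
    (contDiffOn_const.mul (sh' 1)) (sh' 0) fun t ht => by
      rw [pderiv_mul 1 (differentiableAt_const _) (dh' 1 t ht), pderiv_const]
      linear_combination -S.laplacian t ht
  have dy : ∀ t ∈ B, DifferentiableAt ℝ y t := fun t ht =>
    (sy.contDiffAt (hB.mem_nhds ht)).differentiableAt hnz
  set N : (Fin 2 → ℝ) → ℝ := fun t => (pderiv 0 h t ^ 2 + ε * pderiv 1 h t ^ 2) / E t with hN
  have Npos : ∀ t ∈ B, 0 < N t := fun t ht => div_pos (hg t ht) (hE t ht)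
  set C : ℝ := N b / √(h b) with hC
  have Cpos : 0 < C := div_pos (Npos b hb) (Real.sqrt_pos.2 (hh b hb))
  have hC2 : C ^ 2 = N b ^ 2 / h b := by rw [hC, div_pow, Real.sq_sqrt (hh b hb).le]
  -- The first integral fixes only `N² / h`; positivity of `N`, from the gradient condition, selects
  -- the root.
  have NC : ∀ t ∈ B, N t = C * √(h t) := by
    intro t ht
    have h1 : N t ^ 2 / h t = N b ^ 2 / h b := S.exists_gradient_const H hc ht hb
    have h2 : N t ^ 2 = (C * √(h t)) ^ 2 := by
      rw [mul_pow, Real.sq_sqrt (hh t ht).le, hC2, ← h1, div_mul_cancel₀ _ (hh t ht).ne']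
    exact (pow_left_inj₀ (Npos t ht).le (by positivity) two_ne_zero).1 h2
  set κ : ℝ := h b ^ 2 * pderiv 1 f b / E b with hκ
  have κ0 : κ ≠ 0 := div_ne_zero (mul_ne_zero (pow_ne_zero 2 (hh b hb).ne') (hf b hb)) (hE b hb).ne'
  have fκ : ∀ t ∈ B, h t ^ 2 * pderiv 1 f t = κ * E t := by
    intro t ht
    have := S.exists_shift_const H hc ht hb
    rwa [div_eq_iff (hE t ht).ne'] at this
  -- For `T₀ = β² h` and `T₁ = β² y` one has `T₀^{-1/2} (dT₀² + ε dT₁²) = β³ C E (dt₁² + ε dt₂²)`,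
  -- which fixes `β`.
  obtain ⟨β, βpos, hβ⟩ : ∃ β : ℝ, 0 < β ∧ β ^ 3 * C = 1 := by
    refine ⟨C⁻¹ ^ (1 / 3 : ℝ), by positivity, ?_⟩
    rw [← Real.rpow_natCast, ← Real.rpow_mul (by positivity)]
    norm_num [Cpos.ne']
  have hβC : C = 1 / β ^ 3 := by field_simp; linear_combination hβ
  set μ : ℝ → ℝ := fun a => 1 / (a ^ 2 * √a) with hμ
  have sμ : ∀ t ∈ B, ContDiffAt ℝ ∞ μ (h t) := by
    intro t ht
    have := (hh t ht).ne'
    refine contDiffAt_const.div ((contDiffAt_id.pow 2).mul (contDiffAt_id.sqrt this)) ?_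
    have := Real.sqrt_pos.2 (hh t ht)
    have := hh t ht
    change h t ^ 2 * √(h t) ≠ 0
    positivity
  have sm : ContDiffOn ℝ ∞ (fun t => μ (h t)) B := fun t ht =>
    ((sμ t ht).comp t (sh t ht)).contDiffWithinAt
  have dm : ∀ t ∈ B, DifferentiableAt ℝ (fun t => μ (h t)) t := fun t ht =>
    (sm.contDiffAt (hB.mem_nhds ht)).differentiableAt hnz
  -- Closedness of `s f dt₁ - T₁ T₀^{-5/2} dT₀` requires `s κ = C / β = β⁻⁴`. The subtracted form
  -- equals `β⁻¹ y μ(h) dh`, and `G` is a potential of the difference.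
  set s : ℝ := 1 / (β ^ 4 * κ) with hs
  obtain ⟨G, sG, hG⟩ := exists_potential hB hc
    (α := fun t => s * f t + -β⁻¹ * (y t * μ (h t) * pderiv 0 h t))
    (β := fun t => -β⁻¹ * (y t * μ (h t) * pderiv 1 h t))
    ((contDiffOn_const.mul H.smooth_f).add (contDiffOn_const.mul ((sy.mul sm).mul (sh' 0))))
    (contDiffOn_const.mul ((sy.mul sm).mul (sh' 1))) fun t ht => by
      have dc := fun c : ℝ => differentiableAt_const (𝕜 := ℝ) (x := t) c
      have df : DifferentiableAt ℝ f t := (H.contDiffAt_f ht).differentiableAt hnz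
      have d1 := (dy t ht).fun_mul (dm t ht)
      rw [pderiv_add 1 ((dc s).fun_mul df) ((dc _).fun_mul (d1.fun_mul (dh' 0 t ht))),
        pderiv_mul 1 (dc s) df, pderiv_mul 1 (dc _) (d1.fun_mul (dh' 0 t ht)),
        pderiv_mul 0 (dc _) (d1.fun_mul (dh' 1 t ht)), pderiv_mul 1 d1 (dh' 0 t ht),
        pderiv_mul 0 d1 (dh' 1 t ht), pderiv_mul 0 (dy t ht) (dm t ht),
        pderiv_mul 1 (dy t ht) (dm t ht),
        pderiv_comp_real 0 ((sμ t ht).differentiableAt hnz) (dh t ht),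
        pderiv_comp_real 1 ((sμ t ht).differentiableAt hnz) (dh t ht), pderiv_const, pderiv_const,
        pderiv_const, pderiv_comm 1 0 (sh t ht), (hy t ht).1, (hy t ht).2]
      have hw := Real.sqrt_pos.2 (hh t ht)
      have h1 : pderiv 0 h t ^ 2 + ε * pderiv 1 h t ^ 2 = C * √(h t) * E t := by
        rw [← NC t ht, hN]
        field_simp [(hE t ht).ne']
      have h2 : s * pderiv 1 f t = β⁻¹ * μ (h t) * (C * √(h t) * E t) := by
        have := (hh t ht).ne'
        have h3 : pderiv 1 f t = κ * E t / h t ^ 2 := by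
          rw [← fκ t ht]
          field_simp
        rw [h3, hs, hμ, hβC]
        field_simp
      rw [← h1] at h2
      linear_combination h2
  have hd : ∀ u : (Fin 2 → ℝ) → ℝ, (∀ t ∈ B, DifferentiableAt ℝ u t) → ∀ t ∈ B, ∀ i,
      pderiv i (fun t => β ^ 2 * u t) t = β ^ 2 * pderiv i u t := by
    intro u hu t ht i
    rw [pderiv_mul i (differentiableAt_const _) (hu t ht), pderiv_const]
    ring
  -- The factor `r = β² κ` is forced by `h = r s T₀`.
  refine ⟨β ^ 2 * κ, s, fun t => β ^ 2 * h t, fun t => β ^ 2 * y t, G, by positivity, by positivity,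
    contDiffOn_const.mul H.smooth_h, contDiffOn_const.mul sy, sG, fun t ht => ?_⟩
  have hht := hh t ht
  have hw := Real.sqrt_pos.2 hht
  have hEt := hE t ht
  have hsq : √(β ^ 2 * h t) = β * √(h t) := by
    rw [Real.sqrt_mul (by positivity), Real.sqrt_sq βpos.le]
  have r0 : radial 0 ![β ^ 2 * h t, β ^ 2 * y t] = 1 / (β * √(h t)) := by
    simp [radial, hsq]
  have r2 : radial 2 ![β ^ 2 * h t, β ^ 2 * y t] = 1 / ((β ^ 2 * h t) ^ 2 * (β * √(h t))) := by
    simp only [radial, Matrix.cons_val_zero, hsq]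
  have h1 : pderiv 0 h t ^ 2 + ε * pderiv 1 h t ^ 2 = √(h t) * E t / β ^ 3 := by
    have : N t * E t = C * √(h t) * E t := by rw [NC t ht]
    rw [hN, div_mul_cancel₀ _ hEt.ne', hβC] at this
    rw [this]
    ring
  simp only [hd h dh t ht, hd y dy t ht, (hy t ht).1, (hy t ht).2, (hG t ht).1, (hG t ht).2, r0, r2]
  refine ⟨by positivity, ?_, ?_, ?_, ?_, ?_, ?_, ?_⟩
  · have := hg t ht
    have h3 : β ^ 2 * pderiv 0 h t * (β ^ 2 * pderiv 0 h t) -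
        β ^ 2 * pderiv 1 h t * (β ^ 2 * (-ε * pderiv 1 h t)) =
        β ^ 4 * (pderiv 0 h t ^ 2 + ε * pderiv 1 h t ^ 2) := by ring
    rw [h3]
    positivity
  · have h3 : (β ^ 2 * pderiv 0 h t) ^ 2 + ε * (β ^ 2 * (-ε * pderiv 1 h t)) ^ 2 =
        β ^ 4 * (√(h t) * E t / β ^ 3) := by
      rw [← h1]
      linear_combination β ^ 4 * ε * pderiv 1 h t ^ 2 * hε
    rw [h3]
    field_simp
  · linear_combination (-β ^ 4 * pderiv 0 h t * pderiv 1 h t) * hε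
  · have h3 : (β ^ 2 * pderiv 1 h t) ^ 2 + ε * (β ^ 2 * pderiv 0 h t) ^ 2 =
        ε * (β ^ 4 * (√(h t) * E t / β ^ 3)) := by
      rw [← h1]
      linear_combination (-β ^ 4 * pderiv 1 h t ^ 2) * hε
    rw [h3]
    field_simp
  · rw [hμ]
    field_simp
    ring
  · rw [hμ]
    field_simp
    ring
  · rw [hs]
    field_simp

end Reduced

/-- The inverse function theorem at `b`. The Jacobian is nonzero on all of `B`, which makes the
local inverse smooth on its whole domain and not only at the image of `b`. -/
theorem exists_openPartialHomeomorph {B : Set (Fin 2 → ℝ)} (hB : IsOpen B)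
    {T₀ T₁ : (Fin 2 → ℝ) → ℝ} (h₀ : ContDiffOn ℝ ∞ T₀ B) (h₁ : ContDiffOn ℝ ∞ T₁ B)
    (hdet : ∀ t ∈ B, pderiv 0 T₀ t * pderiv 1 T₁ t - pderiv 1 T₀ t * pderiv 0 T₁ t ≠ 0)
    {b : Fin 2 → ℝ} (hb : b ∈ B) :
    ∃ τ : OpenPartialHomeomorph (Fin 2 → ℝ) (Fin 2 → ℝ), b ∈ τ.source ∧ τ.source ⊆ B ∧
      ContDiffOn ℝ ∞ τ τ.source ∧ ContDiffOn ℝ ∞ τ.symm τ.target ∧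
      ∀ t, τ t = ![T₀ t, T₁ t] := by
  set T : (Fin 2 → ℝ) → (Fin 2 → ℝ) := fun t => ![T₀ t, T₁ t] with hT
  have sT : ContDiffOn ℝ ∞ T B := contDiffOn_pi.2 (Fin.forall_fin_two.2 ⟨h₀, h₁⟩)
  have sT' : ∀ t ∈ B, ContDiffAt ℝ ∞ T t := fun t ht => sT.contDiffAt (hB.mem_nhds ht)
  have hequiv : ∀ t ∈ B, ∃ L : (Fin 2 → ℝ) ≃L[ℝ] (Fin 2 → ℝ), HasFDerivAt T (L : _ →L[ℝ] _) t := by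
    intro t ht
    have hd := ((sT' t ht).differentiableAt (by simp)).hasFDerivAt
    have hc : ∀ v a, fderiv ℝ T t v a = ∑ i, v i * pderiv i (fun t => T t a) t := by
      intro v a
      rw [← fderiv_eq_sum_pderiv, (hasFDerivAt_pi'.1 hd a).fderiv]
      rfl
    have hinj : Function.Injective (fderiv ℝ T t : (Fin 2 → ℝ) →ₗ[ℝ] (Fin 2 → ℝ)) := by
      rw [← LinearMap.ker_eq_bot, LinearMap.ker_eq_bot']
      intro v hv'
      have hv : fderiv ℝ T t v = 0 := hv'
      have e0 : v 0 * pderiv 0 T₀ t + v 1 * pderiv 1 T₀ t = 0 :=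
        ((hc v 0).trans (Fin.sum_univ_two _)).symm.trans (congrFun hv 0)
      have e1 : v 0 * pderiv 0 T₁ t + v 1 * pderiv 1 T₁ t = 0 :=
        ((hc v 1).trans (Fin.sum_univ_two _)).symm.trans (congrFun hv 1)
      ext i
      refine mul_right_cancel₀ (hdet t ht) ?_
      rw [Pi.zero_apply, zero_mul]
      revert i
      refine Fin.forall_fin_two.2 ⟨?_, ?_⟩
      · linear_combination pderiv 1 T₁ t * e0 - pderiv 1 T₀ t * e1
      · linear_combination pderiv 0 T₀ t * e1 - pderiv 0 T₁ t * e0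
    refine ⟨(LinearEquiv.ofInjectiveEndo _ hinj).toContinuousLinearEquiv, ?_⟩
    have hL : ((LinearEquiv.ofInjectiveEndo _ hinj).toContinuousLinearEquiv :
        (Fin 2 → ℝ) →L[ℝ] (Fin 2 → ℝ)) = fderiv ℝ T t := ContinuousLinearMap.ext fun v => rfl
    rw [hL]
    exact hd
  obtain ⟨L, hL⟩ := hequiv b hb
  set σ := ((sT' b hb).toOpenPartialHomeomorph T hL (by simp)).restrOpen B hB with hσ
  have hsub : σ.source ⊆ B := inter_subset_right
  refine ⟨σ, ⟨(sT' b hb).mem_toOpenPartialHomeomorph_source hL (by simp), hb⟩, hsub,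
    sT.mono hsub, fun y hy => ?_, fun t => rfl⟩
  have hyB := hsub (σ.map_target hy)
  obtain ⟨L', hL'⟩ := hequiv _ hyB
  exact (σ.contDiffAt_symm hy hL' (sT' _ hyB)).contDiffWithinAt

/-! ### The normal form -/

/-- The pullback of a reduced metric by a shear. -/
theorem redMetric_eq_transpose_mul {τ : OpenPartialHomeomorph (Fin 2 → ℝ) (Fin 2 → ℝ)} {r s ε : ℝ}
    {G E f k h E' f' k' h' : (Fin 2 → ℝ) → ℝ} {x y : Fin 4 → ℝ} (hxy : tProj y = τ (tProj x))
    (h00 : E (tProj x) = E' (τ (tProj x)) * (pderiv 0 (fun t => τ t 0) (tProj x) ^ 2 +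
      ε * pderiv 0 (fun t => τ t 1) (tProj x) ^ 2))
    (h01 : pderiv 0 (fun t => τ t 0) (tProj x) * pderiv 1 (fun t => τ t 0) (tProj x) +
      ε * (pderiv 0 (fun t => τ t 1) (tProj x) * pderiv 1 (fun t => τ t 1) (tProj x)) = 0)
    (h11 : ε * E (tProj x) = E' (τ (tProj x)) * (pderiv 1 (fun t => τ t 0) (tProj x) ^ 2 +
      ε * pderiv 1 (fun t => τ t 1) (tProj x) ^ 2))
    (h02 : s * f (tProj x) = f' (τ (tProj x)) * pderiv 0 (fun t => τ t 0) (tProj x) +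
      pderiv 0 G (tProj x))
    (h12 : f' (τ (tProj x)) * pderiv 1 (fun t => τ t 0) (tProj x) + pderiv 1 G (tProj x) = 0)
    (h22 : k (tProj x) = r ^ 2 * k' (τ (tProj x)))
    (h23 : h (tProj x) = r * s * h' (τ (tProj x))) :
    redMetric ε E f k h x = (shearJacobian τ r s (fun _ => 0) G (tProj x)).transpose *
      redMetric ε E' f' k' h' y * shearJacobian τ r s (fun _ => 0) G (tProj x) := by
  have hz : ∀ i : Fin 2, pderiv i (fun _ : Fin 2 → ℝ => (0 : ℝ)) (tProj x) = 0 :=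
    fun i => pderiv_const i 0
  unfold redMetric shearJacobian
  rw [hxy, hz, hz, h11, h00, h22, h23]
  generalize pderiv 0 (fun t => τ t 0) (tProj x) = a at *
  generalize pderiv 1 (fun t => τ t 0) (tProj x) = b at *
  generalize pderiv 0 (fun t => τ t 1) (tProj x) = c at *
  generalize pderiv 1 (fun t => τ t 1) (tProj x) = d at *
  ext i j
  revert i j
  refine forall_fin_four ?_ ?_ ?_ ?_ <;> refine forall_fin_four ?_ ?_ ?_ ?_ <;>
    simp [Matrix.mul_apply, Fin.sum_univ_four]
  · ring
  · linear_combination (-E' (τ (tProj x))) * h01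
  · linear_combination r * h' (τ (tProj x)) * h02
  · linear_combination (-E' (τ (tProj x))) * h01
  · ring
  · exact Or.inl (by linear_combination h' (τ (tProj x)) * h12)
  · linear_combination r * h' (τ (tProj x)) * h02
  · linear_combination (-r * h' (τ (tProj x))) * h12
  · ring
  · ring
  · ring

section Adapted

variable {M : Type*} [TopologicalSpace M] [ChartedSpace (Fin 4 → ℝ) M]
  [IsManifold 𝓘(ℝ, Fin 4 → ℝ) ∞ M] {g : PseudoRiemannianMetric 4 M} {𝒢 : Submodule ℝ (VField 4 M)}
  {e : OpenPartialHomeomorph M (Fin 4 → ℝ)}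

/-- In a chart in which the metric and the soliton field have the normal form, the function `ψ`
satisfies the model equation. -/
theorem modelEquation_of_isRicciSoliton {X : VField 4 M} (S : IsRicciSoliton g X 0) {ε : ℝ}
    (hε : ε ^ 2 = 1) {D : Set (Fin 2 → ℝ)} (hD : IsOpen D) {ψ : (Fin 2 → ℝ) → ℝ}
    (hψ : ContDiffOn ℝ ∞ ψ D) (h0 : ∀ t ∈ D, 0 < t 0)
    (he : e ∈ IsManifold.maximalAtlas 𝓘(ℝ, Fin 4 → ℝ) ∞ M) {a₁ a₂ a₃ : ℝ}
    (hG : ∀ x ∈ e.target, metricCoeff g e x = modelRed ε ψ x)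
    (hX : ∀ x ∈ e.target, fieldCoeff X e x = modelField a₁ a₂ a₃ x) {x : Fin 4 → ℝ}
    (hx : x ∈ e.target) (hxD : tProj x ∈ D) : ModelEquation ε a₂ ψ (tProj x) := by
  have hn := e.open_target.mem_nhds hx
  have e1 : metricCoeff g e =ᶠ[𝓝 x] modelRed ε ψ := eventually_of_mem hn hG
  have e2 : fieldCoeff X e =ᶠ[𝓝 x] modelField a₁ a₂ a₃ := eventually_of_mem hn hX
  have h := S.soliton_eq e he x hx 2 2
  rw [ricciCurv_congr e1, lieMetric_congr e1 e2, ricciCurv_modelRed hD hε hψ h0 rfl hxD,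
    lieMetric_modelRed hD hε hψ h0 hxD, if_pos ⟨rfl, rfl⟩, if_pos ⟨rfl, rfl⟩, zero_mul] at h
  exact (modelEquation_iff (h0 _ hxD)).2 h

variable {q : Fin 4 → ℝ} {ρ ε : ℝ} {E f k h : (Fin 2 → ℝ) → ℝ} {X : VField 4 M}

/-- The normalizing functions define a shear `(t, z₁, z₂) ↦ (τ(t), r z₁, s z₂ + G(t))`. The
coefficient `k` stays free and defines `ψ`, whose equation is then read off from the soliton
equation in the new chart. -/
theorem IsReducedChart.exists_normalForm (R : IsReducedChart g 𝒢 e q ρ ε E f k h)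
    (S : IsRicciSoliton g X 0) (A : StandingAssumptions g 𝒢 X) {p : M} (hp : p ∈ e.source) :
    ∃ e' : OpenPartialHomeomorph M (Fin 4 → ℝ), IsAdaptedChart 𝒢 e' ∧ p ∈ e'.source ∧
      ∃ (a₁ a₂ a₃ : ℝ) (ψ : (Fin 2 → ℝ) → ℝ), ContDiffOn ℝ ∞ ψ (tProj '' e'.target) ∧
        (∀ t ∈ tProj '' e'.target, 0 < t 0 ∧ ModelEquation ε a₂ ψ t) ∧
        ∀ x ∈ e'.target, metricCoeff g e' x = modelMetric ε ψ x ∧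
          fieldCoeff X e' x = modelField a₁ a₂ a₃ x ∧
          orbitMetric (metricCoeff g e') x = orbitModel ε (tProj x) := by
  obtain ⟨a₁, a₂, a₃, hXe, red⟩ := R.exists_fieldCoeff_eq S A
  have hpb : e p ∈ Metric.ball q ρ := R.target_eq ▸ e.map_source hp
  obtain ⟨r, s, T₀, T₁, G, hr, hs, sT₀, sT₁, sG, hT⟩ := red.exists_normalizing R.data
    (convex_ball _ _) R.E_pos R.h_pos R.gradient_pos (fun t ht => by
      rw [← tProj_image_ball _ R.radius_pos] at ht
      obtain ⟨x, hx, rfl⟩ := ht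
      exact R.pderiv_shift_ne_zero A hx) (R.tProj_mem hpb)
  obtain ⟨τ, hbτ, hτB, hτ, hτ', hτT⟩ := exists_openPartialHomeomorph Metric.isOpen_ball sT₀ sT₁
    (fun t ht => (hT t ht).2.1) (R.tProj_mem hpb)
  have hτ0 : (fun t => τ t 0) = T₀ := funext fun t => by rw [hτT]; rfl
  have hτ1 : (fun t => τ t 1) = T₁ := funext fun t => by rw [hτT]; rfl
  have hZ : ContDiffOn ℝ ∞ (fun _ : Fin 2 → ℝ => (0 : ℝ)) τ.source := contDiffOn_const
  have sGτ := sG.mono hτB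
  set φ := shear hr hs hτ hτ' hZ sGτ with hφ
  have he' : IsAdaptedChart 𝒢 (e ≫ₕ φ) := R.adapted.trans_shear hr hs hτ hτ' hZ sGτ
  have hpos : ∀ t ∈ τ.target, 0 < t 0 := by
    intro t ht
    rw [← τ.right_inv ht, hτT]
    exact (hT _ (hτB (τ.map_target ht))).1
  -- Solved from `k / r² = ψ t₁ + 4ε / (9 √t₁)`, where `k / r²` is the `dz₁²` coefficient after `z₁`
  -- is scaled by `r`.
  set ψ : (Fin 2 → ℝ) → ℝ :=
    fun t => (k (τ.symm t) / r ^ 2 - 4 * ε / 9 * radial 0 t) / t 0 with hψ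
  have sψ : ContDiffOn ℝ ∞ ψ τ.target := by
    refine ((((R.data.smooth_k.comp hτ' fun t ht => hτB (τ.map_target ht)).div_const _).sub
      (contDiffOn_const.mul fun t ht => ?_)).div (contDiff_apply ..).contDiffOn
      fun t ht => (hpos t ht).ne')
    exact (contDiffAt_radial 0 (hpos t ht)).contDiffWithinAt
  have hleaf : ∀ t ∈ τ.target, modelLeaf ε ψ t = k (τ.symm t) / r ^ 2 := by
    intro t ht
    have := (hpos t ht).ne'
    rw [modelLeaf, hψ]
    field_simp
    ring
  have hpt : ∀ y ∈ (e ≫ₕ φ).target, ∃ x ∈ e.target, tProj x ∈ τ.source ∧ φ x = y ∧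
      tProj y = τ (tProj x) := by
    intro y hy
    obtain ⟨x, hx, hx', rfl⟩ := exists_eq_of_mem_trans_target hy
    exact ⟨x, hx, hx', rfl, tProj_mkPoint ..⟩
  have htar : ∀ y ∈ (e ≫ₕ φ).target, tProj y ∈ τ.target := by
    intro y hy
    obtain ⟨x, -, hx, -, hxy⟩ := hpt y hy
    exact hxy ▸ τ.map_source hx
  have hG : ∀ y ∈ (e ≫ₕ φ).target, metricCoeff g (e ≫ₕ φ) y = modelRed ε ψ y := by
    intro y hy
    obtain ⟨x, hx, hxτ, rfl, hxy⟩ := hpt y hy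
    refine metricCoeff_trans_eq g R.adapted.1 (shear_contDiffOn hr hs hτ hτ' hZ sGτ)
      (shear_symm_contDiffOn hr hs hτ hτ' hZ sGτ) hx hxτ (fderiv_shear hr hs hτ hτ' hZ sGτ hxτ) ?_
    rw [R.metric_eq x (R.target_eq ▸ hx)]
    obtain ⟨-, -, k00, k01, k11, k02, k12, k23⟩ := hT _ (hτB hxτ)
    refine redMetric_eq_transpose_mul hxy ?_ ?_ ?_ ?_ ?_ ?_ ?_
    · rw [hτ0, hτ1, hτT, k00]
    · rw [hτ0, hτ1, k01]
    · rw [hτ0, hτ1, hτT, k11]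
    · rw [hτ0, hτT, k02]
      rfl
    · rw [hτ0, hτT]
      exact k12
    · rw [hleaf _ (τ.map_source hxτ), τ.left_inv hxτ]
      field_simp
    · rw [hτT, k23]
      rfl
  have hX : ∀ y ∈ (e ≫ₕ φ).target,
      fieldCoeff X (e ≫ₕ φ) y = modelField (r * a₁) (s * a₂ / r) (s * a₃) y := by
    intro y hy
    obtain ⟨x, hx, hxτ, rfl, -⟩ := hpt y hy
    rw [hφ, fieldCoeff_trans_shear hr hs hτ hτ' hZ sGτ R.adapted.1 hx hxτ,
      hXe x (R.target_eq ▸ hx)]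
    ext a
    revert a
    refine forall_fin_four ?_ ?_ ?_ ?_ <;>
      simp [Matrix.mulVec, dotProduct, Fin.sum_univ_four, shearJacobian, modelField, shear_apply,
        mkPoint]
    field_simp
  refine ⟨e ≫ₕ φ, he', ?_, r * a₁, s * a₂ / r, s * a₃, ψ, sψ.mono ?_, ?_, fun y hy => ?_⟩
  · rw [OpenPartialHomeomorph.trans_source]
    exact ⟨hp, hbτ⟩
  · rintro _ ⟨y, hy, rfl⟩
    exact htar y hy
  · rintro _ ⟨y, hy, rfl⟩
    exact ⟨hpos _ (htar y hy), modelEquation_of_isRicciSoliton S R.data.sq_eq_one τ.open_target sψ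
      hpos he'.1 hG hX hy (htar y hy)⟩
  · have h0 := hpos _ (htar y hy)
    refine ⟨(hG y hy).trans (modelMetric_eq_modelRed ε ψ h0).symm, hX y hy, ?_⟩
    rw [orbitMetric_congr (hG y hy), modelRed, orbitMetric_redMetric h0.ne', orbitModel]
    simp [radial, div_eq_mul_inv]

end Adapted

/-! ### The theorem -/

theorem mainTheorem4 :
    -- every such soliton has the normal form, near every point
    (∀ (M : Type*) [TopologicalSpace M] [ChartedSpace (Fin 4 → ℝ) M]
      [IsManifold 𝓘(ℝ, Fin 4 → ℝ) ∞ M]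
      (g : PseudoRiemannianMetric 4 M) (𝒢 : Submodule ℝ (VField 4 M)) (X : VField 4 M),
      IsRicciSoliton g X 0 → StandingAssumptions g 𝒢 X →
      ∀ ε₀ : ℝ, (ε₀ = 1 ∨ ε₀ = -1) →
      ∀ (e : OpenPartialHomeomorph M (Fin 4 → ℝ)) (P h₁₁ h₁₂ f₁ f₂ : (Fin 2 → ℝ) → ℝ),
      HasNormalizedForm g 𝒢 e ε₀ P h₁₁ h₁₂ f₁ f₂ →
      (∀ t ∈ tProj '' e.target, pderiv 1 f₁ t = 0) →
      (∀ t ∈ tProj '' e.target, pderiv 0 h₁₂ t ≠ 0) →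
      (∀ t ∈ tProj '' e.target, 0 < pderiv 0 h₁₂ t ^ 2 + ε₀ * pderiv 1 h₁₂ t ^ 2) →
      ∀ p ∈ e.source, ∃ e' : OpenPartialHomeomorph M (Fin 4 → ℝ),
        IsAdaptedChart 𝒢 e' ∧ p ∈ e'.source ∧
        ∃ (a₁ a₂ a₃ : ℝ) (ψ : (Fin 2 → ℝ) → ℝ),
          ContDiffOn ℝ ∞ ψ (tProj '' e'.target) ∧
          (∀ t ∈ tProj '' e'.target, 0 < t 0 ∧ ModelEquation ε₀ a₂ ψ t) ∧
          ∀ x ∈ e'.target,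
            metricCoeff g e' x = modelMetric ε₀ ψ x ∧
            fieldCoeff X e' x = modelField a₁ a₂ a₃ x ∧
            orbitMetric (metricCoeff g e') x = orbitModel ε₀ (tProj x)) ∧
    -- the constants and the solution of the equation are arbitrary
    (∀ ε₀ : ℝ, (ε₀ = 1 ∨ ε₀ = -1) → ∀ (a₁ a₂ a₃ : ℝ) (D : Set (Fin 2 → ℝ)), IsOpen D →
      ∀ ψ : (Fin 2 → ℝ) → ℝ, ContDiffOn ℝ ∞ ψ D →
      (∀ t ∈ D, 0 < t 0 ∧ ModelEquation ε₀ a₂ ψ t) →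
      ∀ x : Fin 4 → ℝ, tProj x ∈ D →
        (modelMetric ε₀ ψ x).det ≠ 0 ∧
        (leafMetric (modelMetric ε₀ ψ) x).det ≠ 0 ∧
        curvatureVec (modelMetric ε₀ ψ) x ≠ 0 ∧
        curvatureNormSq (modelMetric ε₀ ψ) x = 0 ∧
        ∀ i j, ricciCurv (modelMetric ε₀ ψ) i j x
          + (1 / 2) * lieMetric (modelMetric ε₀ ψ) (modelField a₁ a₂ a₃) i j x = 0) ∧
    -- the Gauss curvature of the orbit metric
    (∀ ε₀ : ℝ, (ε₀ = 1 ∨ ε₀ = -1) → ∀ t : Fin 2 → ℝ, 0 < t 0 →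
      gaussCurv (orbitModel ε₀) t = -(t 0) ^ (-(3 / 2) : ℝ) / 4) :=
  ⟨fun _ _ _ _ _ _ _ S A _ hε _ _ _ _ _ _ N hf hh hg _ hp => by
    obtain ⟨_, _, _, _, _, _, _, hp₁, R⟩ := N.exists_isReducedChart hε hf hh hg hp
    exact R.exists_normalForm S A hp₁,
  fun _ hε a₁ a₂ a₃ _ hD _ hψ hm _ hx => model_isSoliton hε a₁ a₂ a₃ hD hψ hm hx,
  fun _ hε _ ht => gaussCurv_orbitModel (by rcases hε with rfl | rfl <;> norm_num) ht⟩
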